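/- All graphs are finite and simple. Let $G$ be a graph with vertex set $V(G)$ and let $A_G$ be its adjacency matrix over $GF(2)$; for $X,Y\subseteq V(G)$ let $A_G[X,Y]$ be the submatrix with rows indexed by $X$ and columns by $Y$. The linear rank-width of $G$ is the minimum, over all linear orderings $x_1,\dots,x_n$ of $V(G)$, of $\max_{1\le i\le n}\operatorname{rk} A_G[\{x_1,\dots,x_i\},\{x_{i+1},\dots,x_n\}]$. The graph $G$ is distance hereditary if every induced path of $G$ is isometric. A split of a connected graph $G$ is a bipartition $\{X,Y\}$ of $V(G)$ with $|X|,|Y|\ge 2$ and $\operatorname{rk}A_G[X,Y]=1$; a graph is prime if it has no split. For a split $\{X,Y\}$ let $G^X$ be obtained from $G[X]$ by adding a new vertex $h_X$ adjacent to exactly those $x\in X$ that have a neighbour in $Y$; define $G^Y$ and $h_Y$ in the same way. The vertices $h_X,h_Y$ are called neighbour markers. A decomposition of $G$ is obtained from $\{G\}$ by repeatedly replacing a member $H$ that has a split $\{X,Y\}$ by $H^X$ and $H^Y$. Its members are called blocks; two blocks are neighbours if they contain two neighbour markers, one each. A decomposition is canonical if (i) each block is prime, or a clique with at least $3$ vertices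 (a clique block), or a star with at least $3$ vertices (a star block); (ii) no two clique blocks are neighbours; (iii) if two star blocks are neighbours, then their two neighbour markers are either both centres or both not centres. The tree of a decomposition has the blocks as nodes, two blocks being adjacent if and only if they are neighbours. Theorem. Let $G$ be a connected graph with at least two vertices. Then $G$ has a canonical decomposition and, for every canonical decomposition of $G$ with tree $T_G$ (the split decomposition tree of $G$), $G$ has linear rank-width $1$ if and only if $G$ is distance hereditary and $T_G$ is a path, where a single node counts as a path. -/

import Mathlib

universe u

/-! ## Cut-rank and linear rank-width -/

section CutRank

open Classical in
/-- The rank over the two-element field of the submatrix `A_G[X, Y]` of the adjacency matrix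
of `G`, with rows indexed by `X` and columns indexed by `Y`. -/
noncomputable def cutRank {V : Type u} (G : SimpleGraph V) (X Y : Set V) : ℕ :=
  Matrix.eRank ((G.adjMatrix (ZMod 2)).submatrix
    (Subtype.val : X → V) (Subtype.val : Y → V)) |>.toNat

open Classical in
/-- `cutRank` is the usual matrix rank (`Matrix.eRank` only avoids a `Fintype` instance). -/
theorem cutRank_eq_rank {V : Type u} (G : SimpleGraph V) (X Y : Set V) [Fintype Y] :
    cutRank G X Y = Matrix.rank ((G.adjMatrix (ZMod 2)).submatrix
      (Subtype.val : X → V) (Subtype.val : Y → V)) := by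
  rw [cutRank, Matrix.eRank_toNat_eq_finrank, Matrix.rank_eq_finrank_span_cols]

/-- The cut-rank of the linear ordering `π 0, …, π (n - 1)` of the vertices: the maximum over
`1 ≤ i ≤ n` of the rank of `A_G[X, Y]` where `X` consists of the first `i` vertices and `Y`
of the remaining ones. -/
noncomputable def orderingCutRank {V : Type u} (G : SimpleGraph V) {n : ℕ} (π : Fin n ≃ V) : ℕ :=
  (Finset.Icc 1 n).sup fun i =>
    cutRank G {v | (π.symm v : ℕ) < i} {v | i ≤ (π.symm v : ℕ)}

/-- The linear rank-width of a finite graph: the minimum cut-rank of a linear ordering of its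
vertices. -/
noncomputable def linearRankWidth {V : Type u} (G : SimpleGraph V) : ℕ :=
  sInf (Set.range fun π : Fin (Nat.card V) ≃ V => orderingCutRank G π)

end CutRank

/-- A graph is distance hereditary if its induced paths are isometric. -/
def IsDistanceHereditary {V : Type u} (G : SimpleGraph V) : Prop :=
  ∀ (n : ℕ) (f : SimpleGraph.pathGraph n ↪g G) (i j : Fin n),
    G.dist (f i) (f j) = (SimpleGraph.pathGraph n).dist i j

/-- A graph which is a path (the one-vertex path is allowed). -/
def IsPathShaped {W : Type u} (T : SimpleGraph W) : Prop :=
  ∃ n : ℕ, 1 ≤ n ∧ Nonempty (T ≃g SimpleGraph.pathGraph n)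

/-! ## Splits -/

/-- The bipartition `{X, Xᶜ}` is a split of `G`: both sides have at least two elements and the
cut-rank between them is `1`. -/
def IsSplit {V : Type u} (G : SimpleGraph V) (X : Set V) : Prop :=
  X.Nontrivial ∧ Xᶜ.Nontrivial ∧ cutRank G X Xᶜ = 1

/-- A graph without a split. -/
def IsPrimeGraph {V : Type u} (G : SimpleGraph V) : Prop :=
  ∀ X : Set V, ¬ IsSplit G X

/-- The graph `G^X`: its vertices are those of `X` together with a new marker vertex `none`,
which is adjacent to the vertices of `X` having a neighbour outside `X`. -/
def markerGraph {V : Type u} (G : SimpleGraph V) (X : Set V) : SimpleGraph (Option X) where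
  Adj
    | some x, some y => G.Adj x y
    | some x, none => ∃ y ∉ X, G.Adj x y
    | none, some x => ∃ y ∉ X, G.Adj x y
    | none, none => False
  symm := ⟨by
    rintro (_ | x) (_ | y) h
    · exact h
    · exact h
    · exact h
    · exact G.adj_symm h⟩
  loopless := ⟨by
    rintro (_ | x) h
    · exact h
    · exact G.loopless.irrefl _ h⟩

/-- A complete graph with at least three vertices. -/
def IsCliqueGraph {V : Type u} (G : SimpleGraph V) : Prop :=
  3 ≤ Nat.card V ∧ G = ⊤

/-- A star with at least three vertices and centre `c`. -/
def IsStarGraphAt {V : Type u} (G : SimpleGraph V) (c : V) : Prop :=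
  3 ≤ Nat.card V ∧ G = SimpleGraph.starGraph c

/-! ## Decompositions -/

/-- The decompositions of `G`, by the order in which splits are performed: either `G` itself is
the only block, or one has taken a split `{X, Xᶜ}` of `G` and then decomposed the two graphs
`G^X` and `G^{Xᶜ}`. -/
inductive Decomposition : {V : Type u} → SimpleGraph V → Type (u + 1)
  | single {V : Type u} (G : SimpleGraph V) : Decomposition G
  | split {V : Type u} {G : SimpleGraph V} (X : Set V) (hX : IsSplit G X)
      (D₁ : Decomposition (markerGraph G X)) (D₂ : Decomposition (markerGraph G Xᶜ)) :
      Decomposition G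

namespace Decomposition

/-- The (indices of the) blocks of a decomposition. -/
def Block : {V : Type u} → {G : SimpleGraph V} → Decomposition G → Type
  | _, _, single _ => Unit
  | _, _, split _ _ D₁ D₂ => D₁.Block ⊕ D₂.Block

/-- The vertices of `S(D)`: the disjoint union of the vertex sets of all blocks. -/
def Vertex : {V : Type u} → {G : SimpleGraph V} → Decomposition G → Type u
  | V, _, single _ => V
  | _, _, split _ _ D₁ D₂ => D₁.Vertex ⊕ D₂.Vertex

/-- The block containing a vertex of `S(D)`. -/
def blockOf : {V : Type u} → {G : SimpleGraph V} → (D : Decomposition G) → D.Vertex → D.Block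
  | _, _, single _ => fun _ => ()
  | _, _, split _ _ D₁ D₂ => Sum.map D₁.blockOf D₂.blockOf

open Classical in
/-- The vertices of the decomposed graph, as vertices of `S(D)`. -/
noncomputable def incl :
    {V : Type u} → {G : SimpleGraph V} → (D : Decomposition G) → V → D.Vertex
  | _, _, single _ => fun v => v
  | _, _, split X _ D₁ D₂ => fun v =>
      if h : v ∈ X then Sum.inl (D₁.incl (some ⟨v, h⟩)) else Sum.inr (D₂.incl (some ⟨v, h⟩))

/-- The solid edges of `S(D)`: the edges of the blocks. -/
def solid : {V : Type u} → {G : SimpleGraph V} → (D : Decomposition G) → SimpleGraph D.Vertex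
  | _, G, single _ => G
  | _, _, split _ _ D₁ D₂ => SimpleGraph.sum D₁.solid D₂.solid

/-- The marked edges of `S(D)`: those joining the two neighbour markers `h_X` and `h_Y` of a
split which has been performed. -/
noncomputable def marked :
    {V : Type u} → {G : SimpleGraph V} → (D : Decomposition G) → SimpleGraph D.Vertex
  | _, _, single _ => ⊥
  | _, _, split _ _ D₁ D₂ =>
      SimpleGraph.sum D₁.marked D₂.marked ⊔
        SimpleGraph.edge (Sum.inl (D₁.incl none)) (Sum.inr (D₂.incl none))

/-- The block with index `b`, as a graph. -/
def blockGraph {V : Type u} {G : SimpleGraph V} (D : Decomposition G) (b : D.Block) :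
    SimpleGraph {w : D.Vertex // D.blockOf w = b} :=
  D.solid.comap Subtype.val

/-- A decomposition is canonical if (i) every block is prime, a clique with at least three
vertices or a star with at least three vertices, (ii) no two clique blocks are neighbours, and
(iii) if two star blocks are neighbours, then their markers are both centres or both not
centres. -/
structure IsCanonical {V : Type u} {G : SimpleGraph V} (D : Decomposition G) : Prop where
  block_shape : ∀ b : D.Block,
    IsPrimeGraph (D.blockGraph b) ∨ IsCliqueGraph (D.blockGraph b) ∨
      ∃ c, IsStarGraphAt (D.blockGraph b) c
  clique_clique : ∀ h k : D.Vertex, D.marked.Adj h k →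
    ¬ (IsCliqueGraph (D.blockGraph (D.blockOf h)) ∧ IsCliqueGraph (D.blockGraph (D.blockOf k)))
  star_star : ∀ h k : D.Vertex, D.marked.Adj h k → ∀ c c',
    IsStarGraphAt (D.blockGraph (D.blockOf h)) c →
    IsStarGraphAt (D.blockGraph (D.blockOf k)) c' →
    (h = c.val ↔ k = c'.val)

/-- The tree of a decomposition: the nodes are the blocks, and two distinct blocks are adjacent
if a marked edge joins them. Since the blocks of a connected graph are connected, this is
`S(D)` with all solid edges contracted. -/
def tree {V : Type u} {G : SimpleGraph V} (D : Decomposition G) : SimpleGraph D.Block where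
  Adj a b := a ≠ b ∧ ∃ h k : D.Vertex, D.marked.Adj h k ∧ D.blockOf h = a ∧ D.blockOf k = b
  symm := ⟨fun _ _ ⟨hab, h, k, hk, ha, hb⟩ => ⟨hab.symm, k, h, hk.symm, hb, ha⟩⟩
  loopless := ⟨fun _ h => h.1 rfl⟩

end Decomposition

/-! For a connected graph the splits are the nontrivial bipartitions whose cut has rank at most one
(`LowCut`), and linear rank-width one means that some ordering of the vertices has only low initial
segments (`IsLowLayout`). Two facts carry the work: corners and symmetric differences of crossing
low cuts are low (`LowCut.inter`, `LowCut.symmDiff`), and the low cuts of a marker graph are the low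
cuts of `G` that do not separate the vertices identified to the marker (`lowCut_markerGraph_iff`).
The latter allows induction along decompositions.

Each split performed in a canonical decomposition is crossed by no low cut. Indeed two crossing low
cuts divide the graph into four corners joined like a clique or a star; seen from the two sides of
the split, the two markers then lie in two cliques, or are the centre of one star and a leaf of
another, which conditions (ii) and (iii) forbid (`IsCanonical.not_crosses`). Conversely a forbidden
pair of markers produces a crossing low cut (`isCanonical_split_of_not_crosses`). If every split is
crossed, the graph is prime, a clique or a star (`prime_or_clique_or_star_of_splits_crossed`);
otherwise one splits along an uncrossed split and continues. This gives existence.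

Let a low layout be given. Its first two vertices are twins, or one of them has no neighbour except
possibly the other; deleting a vertex and using induction shows that the graph is distance
hereditary (`IsLowLayout.noShortcut`). An uncrossed split cannot be interleaved by the layout
(`IsLowLayout.lt_of_not_crosses`), so the layout breaks into layouts of the two marker graphs with
the markers at the adjoining ends, and the tree is a path (`IsCanonical.hasTreeLayout`).

Conversely, a connected distance-hereditary graph with at least four vertices has a split
(`NoShortcut.exists_lowCut`), so all cuts of all blocks are low. Each block can be ordered
arbitrarily, in particular with its markers at the ends, and the orders are concatenated along the
path (`hasLowLayouts`). -/

/-- The cut between `X` and its complement has rank at most one: two vertices of `X` with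
neighbours outside `X` have the same neighbours outside `X`. -/
def LowCut {V : Type u} (G : SimpleGraph V) (X : Set V) : Prop :=
  ∀ ⦃x x' y y' : V⦄, x ∈ X → x' ∈ X → y ∉ X → y' ∉ X → G.Adj x y → G.Adj x' y' → G.Adj x y'

/-! ### Distance-hereditary graphs and their splits. -/

section DistanceHereditary

variable {V : Type u} {G : SimpleGraph V}

/-- The vertices `f 0, …, f n` form an induced path, in this order. -/
def IsInducedPath (G : SimpleGraph V) (n : ℕ) (f : ℕ → V) : Prop :=
  (∀ i ≤ n, ∀ j ≤ n, f i = f j → i = j) ∧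
    ∀ i ≤ n, ∀ j ≤ n, (G.Adj (f i) (f j) ↔ i + 1 = j ∨ j + 1 = i)

/-- No walk is a shortcut of an induced path with the same ends. -/
def NoShortcut (G : SimpleGraph V) : Prop :=
  ∀ (n : ℕ) (f : ℕ → V), IsInducedPath G n f → ∀ w : G.Walk (f 0) (f n), n ≤ w.length

theorem pathGraph_le_add_length {n : ℕ} {a b : Fin n} (w : (SimpleGraph.pathGraph n).Walk a b) :
    (b : ℕ) ≤ a + w.length := by
  induction w with
  | nil => simp
  | cons h p ih =>
    rw [SimpleGraph.pathGraph_adj] at h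
    simp only [SimpleGraph.Walk.length_cons]
    omega

theorem pathGraph_exists_walk {n : ℕ} (k : ℕ) (a b : Fin n) (h : (b : ℕ) = a + k) :
    ∃ w : (SimpleGraph.pathGraph n).Walk a b, w.length = k := by
  induction k generalizing b with
  | zero =>
    obtain rfl : b = a := Fin.ext (by simpa using h)
    exact ⟨.nil, rfl⟩
  | succ k ih =>
    have hb := b.2
    obtain ⟨w, hw⟩ := ih ⟨a + k, by omega⟩ rfl
    have hadj : (SimpleGraph.pathGraph n).Adj ⟨a + k, by omega⟩ b := by
      rw [SimpleGraph.pathGraph_adj]; left; simp only; omega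
    exact ⟨w.concat hadj, by simp [hw]⟩

theorem IsDistanceHereditary.noShortcut (h : IsDistanceHereditary G) : NoShortcut G := by
  intro n f hf w
  let φ : SimpleGraph.pathGraph (n + 1) ↪g G :=
    { toFun := fun i => f i
      inj' := fun i j hij => Fin.ext (hf.1 i (by omega) j (by omega) hij)
      map_rel_iff' := by
        intro i j
        rw [SimpleGraph.pathGraph_adj]
        exact hf.2 i (by omega) j (by omega) }
  have h1 := h (n + 1) φ 0 (Fin.last n)
  have h2 : G.dist (φ 0) (φ (Fin.last n)) ≤ w.length := by
    exact SimpleGraph.dist_le w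
  obtain ⟨p, hp⟩ := (SimpleGraph.pathGraph_connected n).exists_walk_length_eq_dist 0 (Fin.last n)
  have h3 := pathGraph_le_add_length p
  simp at h3
  omega

theorem NoShortcut.isDistanceHereditary (h : NoShortcut G) : IsDistanceHereditary G := by
  intro n f
  have key : ∀ i j : Fin n, i ≤ j →
      G.dist (f i) (f j) = (SimpleGraph.pathGraph n).dist i j := by
    intro i j hij
    obtain ⟨k, hk⟩ := Nat.exists_eq_add_of_le (show (i : ℕ) ≤ j from hij)
    obtain ⟨w, hw⟩ := pathGraph_exists_walk k i j hk
    have h1 := SimpleGraph.dist_le w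
    obtain ⟨p, hp⟩ := w.reachable.exists_walk_length_eq_dist
    have h2 := SimpleGraph.dist_le (p.map f.toHom)
    have hj := j.2
    -- The subpath from `i` to `j`, shifted to start at `0`; the default `f i` concerns only indices
    -- that are never inspected.
    let g : ℕ → V := fun m => if hm : (i : ℕ) + m < n then f ⟨i + m, hm⟩ else f i
    have hgv : ∀ m (hm : m ≤ k), g m = f ⟨i + m, by omega⟩ := fun m hm => dif_pos (by omega)
    have hg : IsInducedPath G k g := by
      refine ⟨fun a ha b hb hab => ?_, fun a ha b hb => ?_⟩
      · rw [hgv a ha, hgv b hb] at hab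
        have := congrArg Fin.val (f.injective hab)
        simpa using this
      · rw [hgv a ha, hgv b hb, SimpleGraph.Embedding.map_adj_iff, SimpleGraph.pathGraph_adj]
        simp only
        omega
    obtain ⟨q, hq⟩ := (w.map f.toHom).reachable.exists_walk_length_eq_dist
    have e0 : f i = g 0 := by rw [hgv 0 (by omega)]; congr 1
    have ek : f j = g k := by rw [hgv k le_rfl]; congr 1; exact Fin.ext hk
    have h3 := h k g hg (q.copy e0 ek)
    simp only [SimpleGraph.Walk.length_copy, SimpleGraph.Walk.length_map] at h3 h2
    change q.length = G.dist (f i) (f j) at hq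
    change G.dist (f i) (f j) ≤ _ at h2
    omega
  intro i j
  rcases le_total i j with hij | hij
  · exact key i j hij
  · rw [SimpleGraph.dist_comm, key j i hij, SimpleGraph.dist_comm]

theorem NoShortcut.comap {W : Type u} {H : SimpleGraph W} (h : NoShortcut G) (φ : H ↪g G) :
    NoShortcut H := by
  intro n f hf w
  have := h n (φ ∘ f) ⟨fun i hi j hj hij => hf.1 i hi j hj (φ.injective hij), fun i hi j hj => by
    rw [Function.comp, Function.comp, SimpleGraph.Embedding.map_adj_iff]
    exact hf.2 i hi j hj⟩ (w.map φ.toHom)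
  simpa using this

/-- The walk `a e d` is shorter than the induced path `a b c d`. Adjacencies of `e` to `b` and `c`
are left free, so the 5-cycle, the house and the gem are excluded together. -/
theorem NoShortcut.not_common_of_path_four (h : NoShortcut G) {a b c d e : V} (hab : G.Adj a b)
    (hbc : G.Adj b c) (hcd : G.Adj c d) (hac : ¬ G.Adj a c) (hbd : ¬ G.Adj b d)
    (had : ¬ G.Adj a d) (hae : G.Adj a e) (hed : G.Adj e d) : False := by
  let f : ℕ → V := fun n => match n with | 0 => a | 1 => b | 2 => c | _ => d
  have hca : ¬ G.Adj c a := fun h => hac h.symm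
  have hdb : ¬ G.Adj d b := fun h => hbd h.symm
  have hda : ¬ G.Adj d a := fun h => had h.symm
  have hf : IsInducedPath G 3 f := by
    constructor
    · intro i hi j hj hij
      interval_cases i <;> interval_cases j <;> simp only [f] at hij <;> first
        | rfl
        | (subst hij
           first
           | exact absurd hab (by simp)
           | exact absurd hbc (by simp)
           | exact absurd hcd (by simp)
           | contradiction)
    · intro i hi j hj
      interval_cases i <;> interval_cases j <;>
        simp [f, hab, hbc, hcd, hac, hbd, had, hca, hdb, hda, hab.symm, hbc.symm, hcd.symm]
  have := h 3 f hf (.cons hae (.cons hed .nil))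
  simp at this

/-- The walk through `x` replaces four edges by two, whatever the adjacencies of `x` to `b`, `c` and
`d`. -/
theorem NoShortcut.not_common_of_path_five (h : NoShortcut G) {a b c d e x : V} (hab : G.Adj a b)
    (hbc : G.Adj b c) (hcd : G.Adj c d) (hde : G.Adj d e) (hac : ¬ G.Adj a c) (had : ¬ G.Adj a d)
    (hae : ¬ G.Adj a e) (hbd : ¬ G.Adj b d) (hbe : ¬ G.Adj b e) (hce : ¬ G.Adj c e)
    (hax : G.Adj a x) (hxe : G.Adj x e) : False := by
  let f : ℕ → V := fun n => match n with | 0 => a | 1 => b | 2 => c | 3 => d | _ => e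
  have sym : ∀ {u v : V}, ¬ G.Adj u v → ¬ G.Adj v u := fun h h' => h h'.symm
  have hf : IsInducedPath G 4 f := by
    constructor
    · intro i hi j hj hij
      interval_cases i <;> interval_cases j <;> simp only [f] at hij <;> first
        | rfl
        | (subst hij
           first
           | exact absurd hab (by simp)
           | exact absurd hbc (by simp)
           | exact absurd hcd (by simp)
           | exact absurd hde (by simp)
           | exact absurd hde.symm had
           | contradiction)
    · intro i hi j hj
      interval_cases i <;> interval_cases j <;>
        simp [f, hab, hbc, hcd, hde, hac, hbd, had, hae, hbe, hce, sym hac, sym hbd, sym had,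
          sym hae, sym hbe, sym hce, hab.symm, hbc.symm, hcd.symm, hde.symm]
  have := h 4 f hf (.cons hax (.cons hxe .nil))
  simp at this

/-- In the subgraph induced by `S`, shortest paths are shortest paths of `G`. -/
theorem NoShortcut.exists_closer_neighbor (h : NoShortcut G) (S : Set V) {r y : S}
    (hr : (G.induce S).Reachable r y) (hne : r ≠ y) :
    ∃ z ∈ S, G.Adj z y ∧ G.dist r z + 1 = G.dist r y := by
  obtain ⟨p, hp⟩ := hr.exists_walk_length_eq_dist
  have hdist : ∀ i ≤ p.length, (G.induce S).dist r (p.getVert i) = i := by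
    intro i hi
    have h1 := SimpleGraph.dist_le (p.take i)
    have h2 := SimpleGraph.dist_le (p.drop i)
    have h3 := SimpleGraph.Reachable.dist_triangle_left (p.take i).reachable y
    rw [SimpleGraph.Walk.take_length] at h1
    rw [SimpleGraph.Walk.drop_length] at h2
    omega
  -- A shortest path of the induced subgraph has no chord, so it is an induced path of `G` and hence
  -- shortest in `G` too.
  let f : ℕ → V := fun i => (p.getVert i : V)
  have hf : IsInducedPath G p.length f := by
    refine ⟨fun i hi j hj hij => ?_, fun i hi j hj => ⟨fun hij => ?_, ?_⟩⟩
    · rw [← hdist i hi, ← hdist j hj, Subtype.ext hij]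
    · have hadj : (G.induce S).Adj (p.getVert i) (p.getVert j) := hij
      have h1 := (hadj.diff_dist_adj (u := r))
      have h2 := (hadj.symm.diff_dist_adj (u := r))
      rw [hdist i hi, hdist j hj] at h1
      have hne : i ≠ j := by rintro rfl; exact hadj.ne rfl
      omega
    · rintro (rfl | rfl)
      · exact p.adj_getVert_succ (by omega)
      · exact (p.adj_getVert_succ (by omega)).symm
  have f0 : f 0 = r := by simp [f]
  have fl : f p.length = y := by simp [f]
  have hdG : ∀ i ≤ p.length, G.dist r (f i) = i := by
    intro i hi
    have hle : G.dist r (f i) ≤ i := by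
      have := SimpleGraph.dist_le ((p.take i).map (SimpleGraph.Embedding.induce S).toHom)
      rw [SimpleGraph.Walk.length_map, SimpleGraph.Walk.take_length] at this
      exact this.trans (min_le_left _ _)
    have hreach : G.Reachable r (f i) :=
      ((p.take i).map (SimpleGraph.Embedding.induce S).toHom).reachable
    obtain ⟨w, hw⟩ := hreach.exists_walk_length_eq_dist
    have := h i f ⟨fun a ha b hb => hf.1 a (ha.trans hi) b (hb.trans hi),
      fun a ha b hb => hf.2 a (ha.trans hi) b (hb.trans hi)⟩ (w.copy f0.symm rfl)
    rw [SimpleGraph.Walk.length_copy] at this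
    omega
  have hpos : 0 < p.length := by
    rcases Nat.eq_zero_or_pos p.length with h0 | h0
    · exact absurd (SimpleGraph.Walk.eq_of_length_eq_zero h0) hne
    · exact h0
  refine ⟨f (p.length - 1), (p.getVert _).2, ?_, ?_⟩
  · rw [← fl]
    exact (hf.2 _ (by omega) _ le_rfl).2 (Or.inl (by omega))
  · rw [hdG _ (by omega), ← fl, hdG _ le_rfl]
    omega

theorem SimpleGraph.Connected.exists_parent (hG : G.Connected) (r : V) {u : V} {k : ℕ}
    (hu : G.dist r u = k + 1) : ∃ v, G.Adj v u ∧ G.dist r v = k := by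
  obtain ⟨p, hp⟩ := hG.exists_walk_length_eq_dist r u
  have hnil : ¬ p.Nil := by rw [← SimpleGraph.Walk.length_eq_zero_iff]; omega
  refine ⟨p.penultimate, p.adj_penultimate hnil, ?_⟩
  have h1 := SimpleGraph.dist_le p.dropLast
  have h2 := (p.adj_penultimate hnil).diff_dist_adj (u := r)
  have h3 : p.dropLast.length = p.length - 1 := by
    simp
  omega

theorem dist_le_succ_of_adj (r : V) {u v : V}
    (h : G.Adj u v) : G.dist r u ≤ G.dist r v + 1 := by
  have := h.diff_dist_adj (u := r)
  omega

theorem SimpleGraph.Connected.induce_reachable (hG : G.Connected) (r : V) {S : Set V} {n : ℕ}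
    (hS : ∀ u, G.dist r u < n → u ∈ S) (hr : r ∈ S) {a : V} (ha : a ∈ S) (hd : G.dist r a ≤ n) :
    (G.induce S).Reachable ⟨r, hr⟩ ⟨a, ha⟩ := by
  induction hk : G.dist r a generalizing a with
  | zero =>
    obtain rfl := hG.dist_eq_zero_iff.1 hk
    exact .refl _
  | succ k ih =>
    obtain ⟨v, hv, hvk⟩ := hG.exists_parent r hk
    refine (ih (hS v (by omega)) (by omega) hvk).trans ?_
    exact SimpleGraph.Adj.reachable (by simpa using hv)

/-- Induce on the layers below `k` together with `a`, `x`, `y`. There `y` needs a neighbour at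
distance `k` from `r`, and `a` is the only candidate. -/
theorem NoShortcut.adj_of_adj_parent (h : NoShortcut G) (hG : G.Connected) (r : V) {k : ℕ}
    {x y a : V} (hx : G.dist r x = k + 1) (hy : G.dist r y = k + 1) (ha : G.dist r a = k)
    (hxy : G.Adj x y) (hax : G.Adj a x) : G.Adj a y := by
  by_contra hay
  let S : Set V := {u | G.dist r u < k} ∪ {a, x, y}
  have hrS : r ∈ S := by
    rcases Nat.eq_zero_or_pos k with rfl | hk
    · exact .inr (.inl (hG.dist_eq_zero_iff.1 ha))
    · exact .inl (by simpa using hk)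
  have haS : a ∈ S := .inr (.inl rfl)
  have hxS : x ∈ S := .inr (.inr (.inl rfl))
  have hyS : y ∈ S := .inr (.inr (.inr rfl))
  have hreach : (G.induce S).Reachable ⟨r, hrS⟩ ⟨y, hyS⟩ :=
    ((hG.induce_reachable r (n := k) (fun u hu => .inl hu) hrS haS ha.le).trans
      (SimpleGraph.Adj.reachable (v := ⟨x, hxS⟩) (by simpa using hax))).trans
      (SimpleGraph.Adj.reachable (by simpa using hxy))
  obtain ⟨z, hz, hzy, hd⟩ := h.exists_closer_neighbor S hreach (fun e => by
    have e' : r = y := congrArg Subtype.val e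
    subst e'
    simp at hy)
  simp only at hd
  rcases hz with hz | rfl | rfl | rfl
  · have : G.dist r z < k := hz
    omega
  · exact hay hzy
  · omega
  · omega

/-- As for `adj_of_adj_parent`, with `w` reached through `v` and `c` in the induced subgraph. -/
theorem NoShortcut.adj_of_common_child (h : NoShortcut G) (hG : G.Connected) (r : V) {k : ℕ}
    {v w c a : V} (hv : G.dist r v = k + 1) (hw : G.dist r w = k + 1) (hc : G.dist r c = k + 2)
    (ha : G.dist r a = k) (hcv : G.Adj c v) (hcw : G.Adj c w) (hav : G.Adj a v) : G.Adj a w := by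
  by_contra haw
  have hvw : ¬ G.Adj v w := fun hvw => haw (h.adj_of_adj_parent hG r hv hw ha hvw hav)
  let S : Set V := {u | G.dist r u < k} ∪ {a, v, c, w}
  have hrS : r ∈ S := by
    rcases Nat.eq_zero_or_pos k with rfl | hk
    · exact .inr (.inl (hG.dist_eq_zero_iff.1 ha))
    · exact .inl (by simpa using hk)
  have haS : a ∈ S := .inr (.inl rfl)
  have hvS : v ∈ S := .inr (.inr (.inl rfl))
  have hcS : c ∈ S := .inr (.inr (.inr (.inl rfl)))
  have hwS : w ∈ S := .inr (.inr (.inr (.inr rfl)))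
  have hreach : (G.induce S).Reachable ⟨r, hrS⟩ ⟨w, hwS⟩ :=
    (((hG.induce_reachable r (n := k) (fun u hu => .inl hu) hrS haS ha.le).trans
      (SimpleGraph.Adj.reachable (v := ⟨v, hvS⟩) (by simpa using hav))).trans
      (SimpleGraph.Adj.reachable (v := ⟨c, hcS⟩) (by simpa using hcv.symm))).trans
      (SimpleGraph.Adj.reachable (by simpa using hcw))
  obtain ⟨z, hz, hzy, hd⟩ := h.exists_closer_neighbor S hreach (fun e => by
    have e' : r = w := congrArg Subtype.val e
    subst e'
    simp at hw)
  simp only at hd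
  rcases hz with hz | rfl | rfl | rfl | rfl
  · have : G.dist r z < k := hz
    omega
  · exact haw hzy
  · exact hvw hzy
  · omega
  · omega

/-- The neighbourhood of a vertex `c` in the last distance layer is a homogeneous set if the layer
is independent and `c` has minimum degree in it. -/
theorem NoShortcut.neighbors_homogeneous [Finite V] (h : NoShortcut G) (hG : G.Connected) (r : V)
    {k : ℕ} (hmax : ∀ u, G.dist r u ≤ k + 2)
    (hind : ∀ u v, G.dist r u = k + 2 → G.dist r v = k + 2 → ¬ G.Adj u v) {c : V}
    (hc : G.dist r c = k + 2)
    (hmin : ∀ z, G.dist r z = k + 2 → (G.neighborSet c).ncard ≤ (G.neighborSet z).ncard)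
    {s s' z : V} (hs : G.Adj c s) (hs' : G.Adj c s') (hz : ¬ G.Adj c z) (hsz : G.Adj s z) :
    G.Adj s' z := by
  have layer : ∀ {x t}, G.dist r x = k + 2 → G.Adj x t → G.dist r t = k + 1 := by
    intro x t hx ht
    have h1 := dist_le_succ_of_adj r ht
    have h2 := hmax t
    have h3 : G.dist r t ≠ k + 2 := fun h3 => hind x t hx h3 ht
    omega
  have hds := layer hc hs
  have hds' := layer hc hs'
  by_contra hs'z
  obtain ⟨d, hd, hdk⟩ := hG.exists_parent r hds
  have hds'' : G.Adj d s' := h.adj_of_common_child hG r hds hds' hc hdk hs hs' hd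
  have hcd : ¬ G.Adj c d := fun hcd => by have := layer hc hcd; omega
  -- a neighbour of `s` in the same layer outside `N(c)` is a neighbour of `s'`
  have same : ∀ {z s s'}, G.Adj c s → G.Adj c s' → ¬ G.Adj c z → G.Adj s z → G.dist r z = k + 1 →
      G.dist r s = k + 1 → G.Adj d s → G.Adj d s' → G.Adj s' z := by
    intro z s s' hs hs' hz hsz hzk hds hd hds''
    by_contra hs'z
    have hdz : G.Adj d z := h.adj_of_adj_parent hG r hds hzk hdk hsz hd
    by_cases hss : G.Adj s s'
    · exact h.not_common_of_path_four hs' hds''.symm hdz hcd hs'z hz hs hsz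
    · exact h.not_common_of_path_four hs'.symm hs hsz (fun e => hss e.symm) hz hs'z
        hds''.symm hdz
  have hzs := dist_le_succ_of_adj r hsz
  have hzs' := dist_le_succ_of_adj r hsz.symm
  have hz3 : G.dist r z = k ∨ G.dist r z = k + 1 ∨ G.dist r z = k + 2 := by omega
  rcases hz3 with hzk | hzk | hzk
  · exact hs'z (h.adj_of_common_child hG r hds hds' hc hzk hs hs' hsz.symm).symm
  · exact hs'z (same hs hs' hz hsz hzk hds hd hds'')
  -- Otherwise `N(z)` is contained in `N(c)`, strictly because of `s'`, against the minimality of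
  -- the degree of `c`.
  · obtain ⟨t, htz, htc⟩ : ∃ t, G.Adj z t ∧ ¬ G.Adj c t := by
      by_contra! hcon
      have hss : G.neighborSet z ⊂ G.neighborSet c :=
        ⟨fun t ht => hcon t ht, fun hsub => hs'z ((hsub hs' : G.Adj z s')).symm⟩
      exact absurd (Set.ncard_lt_ncard hss) (not_lt.2 (hmin z hzk))
    have htk := layer hzk htz
    have hdt : G.Adj d t := h.adj_of_common_child hG r hds htk hzk hdk hsz.symm htz hd
    by_cases hts : G.Adj s t
    · have hts' : G.Adj s' t := same hs hs' htc hts htk hds hd hds''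
      exact h.not_common_of_path_four hs' hts' htz.symm htc hs'z hz hs hsz
    · have hts' : ¬ G.Adj s' t := fun e => hts (same hs' hs htc e htk hds' hds'' hd)
      by_cases hss : G.Adj s s'
      · exact h.not_common_of_path_four hss.symm hsz htz hs'z hts hts' hds''.symm hdt
      · exact h.not_common_of_path_five hs'.symm hs hsz htz (fun e => hss e.symm) hs'z hts' hz
          htc hts hds''.symm hdt

/-- A connected distance-hereditary graph with at least four vertices has a split. -/
theorem NoShortcut.exists_lowCut [Finite V] (h : NoShortcut G) (hG : G.Connected)
    (hcard : 4 ≤ Nat.card V) : ∃ X : Set V, X.Nontrivial ∧ Xᶜ.Nontrivial ∧ LowCut G X := by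
  have pair : ∀ a b : V, ({a, b} : Set V)ᶜ.Nontrivial := by
    intro a b
    rw [← Set.one_lt_ncard_iff_nontrivial]
    have h1 := Set.ncard_add_ncard_compl ({a, b} : Set V)
    have h2 : ({a, b} : Set V).ncard ≤ 2 := Set.ncard_insert_le _ _ |>.trans (by simp)
    omega
  by_cases htop : G = ⊤
  · subst htop
    have : Nontrivial V := Finite.one_lt_card_iff_nontrivial.1 (by omega)
    obtain ⟨a, b, hab⟩ := exists_pair_ne V
    refine ⟨{a, b}, ⟨a, by simp, b, by simp, hab⟩, pair a b, ?_⟩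
    intro x x' y y' hx hx' hy hy' _ _
    rw [SimpleGraph.top_adj]
    rintro rfl
    exact hy' hx
  obtain ⟨r, u, hru, hru'⟩ : ∃ r u, r ≠ u ∧ ¬ G.Adj r u := by
    by_contra! hcon
    exact htop (by ext a b; rw [SimpleGraph.top_adj]; exact ⟨fun h => h.ne, hcon a b⟩)
  have : Nonempty V := ⟨r⟩
  obtain ⟨m, hm⟩ := Finite.exists_max (G.dist r)
  have hm2 : 2 ≤ G.dist r m := (hG.one_lt_dist_of_ne_of_not_adj hru hru').trans_le (hm u)
  obtain ⟨k, hk⟩ := Nat.exists_eq_add_of_le' hm2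
  rw [hk] at hm
  -- If the last layer is independent, the split is the neighbourhood of a vertex `c` of minimum
  -- degree in it, or `c` with its only neighbour. Otherwise it is a component of the last layer
  -- with an edge, whose vertices have the same neighbours in the layer before.
  by_cases hind : ∀ u v, G.dist r u = k + 2 → G.dist r v = k + 2 → ¬ G.Adj u v
  · have hfin : {z | G.dist r z = k + 2}.Finite := Set.toFinite _
    obtain ⟨c, hc, hmin⟩ := Set.exists_min_image _ (fun z => (G.neighborSet z).ncard) hfin ⟨m, hk⟩
    have hc : G.dist r c = k + 2 := hc
    by_cases hS : (G.neighborSet c).Nontrivial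
    · refine ⟨G.neighborSet c, hS, ⟨c, by simp, r, ?_, ?_⟩, ?_⟩
      · intro hcr
        have := dist_le_succ_of_adj r (show G.Adj c r from hcr)
        simp at this
        omega
      · rintro rfl
        simp at hc
      · intro x x' y y' hx hx' hy hy' _ hxy'
        exact h.neighbors_homogeneous hG r hm hind hc hmin hx' hx hy' hxy'
    · rw [Set.not_nontrivial_iff] at hS
      obtain ⟨s, hs, -⟩ := hG.exists_parent r hc
      refine ⟨{c, s}, ⟨c, by simp, s, by simp, hs.ne'⟩, pair c s, ?_⟩
      have hc' : ∀ {y}, y ∉ ({c, s} : Set V) → ¬ G.Adj c y := by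
        intro y hy hcy
        exact hy (.inr (hS hcy hs.symm))
      rintro x x' y y' (rfl | rfl) (rfl | rfl) hy hy' hxy hxy'
      · exact hxy'
      · exact absurd hxy (hc' hy)
      · exact absurd hxy' (hc' hy')
      · exact hxy'
  · push Not at hind
    obtain ⟨c, c', hc, hc', hcc⟩ := hind
    let R : V → V → Prop := fun a b => G.Adj a b ∧ G.dist r b = k + 2
    let C : Set V := {z | Relation.ReflTransGen R c z}
    have hC : ∀ z ∈ C, G.dist r z = k + 2 ∧
        ∀ a, G.dist r a = k + 1 → (G.Adj a c ↔ G.Adj a z) := by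
      intro z hz
      induction (show Relation.ReflTransGen R c z from hz) with
      | refl => exact ⟨hc, fun a _ => Iff.rfl⟩
      | tail h1 h2 ih =>
        obtain ⟨ih1, ih2⟩ := ih h1
        refine ⟨h2.2, fun a ha => (ih2 a ha).trans
          ⟨h.adj_of_adj_parent hG r ih1 h2.2 ha h2.1, h.adj_of_adj_parent hG r h2.2 ih1 ha h2.1.symm⟩⟩
    refine ⟨C, ⟨c, .refl, c', .tail .refl ⟨hcc, hc'⟩, hcc.ne⟩, ?_, ?_⟩
    · obtain ⟨a, ha, hak⟩ := hG.exists_parent r hc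
      refine ⟨a, fun haC => ?_, r, fun hrC => ?_, ?_⟩
      · have := (hC a haC).1; omega
      · have := (hC r hrC).1; simp at this
      · rintro rfl; simp at hak
    · intro x x' y y' hx hx' hy hy' _ hxy'
      have h1 : G.dist r y' = k + 1 := by
        have e1 := hm y'
        have e2 := dist_le_succ_of_adj r hxy'
        have e3 := (hC x' hx').1
        have e4 : G.dist r y' ≠ k + 2 := fun e4 =>
          hy' (Relation.ReflTransGen.tail hx' ⟨hxy', e4⟩)
        omega
      exact (((hC x hx).2 y' h1).1 (((hC x' hx').2 y' h1).2 hxy'.symm)).symm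

end DistanceHereditary

/-! ### Low cuts, their corners, and marker graphs as contractions. -/

section Cuts

variable {V : Type u} {G : SimpleGraph V}

theorem LowCut.compl {X : Set V} (h : LowCut G X) : LowCut G Xᶜ := by
  intro x x' y y' hx hx' hy hy' hxy hxy'
  rw [Set.notMem_compl_iff] at hy hy'
  exact (h hy' hy hx' hx hxy'.symm hxy.symm).symm

theorem lowCut_compl_iff {X : Set V} : LowCut G Xᶜ ↔ LowCut G X :=
  ⟨fun h => compl_compl X ▸ h.compl, LowCut.compl⟩

theorem lowCut_of_subsingleton {X : Set V} (h : X.Subsingleton) : LowCut G X := by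
  intro x x' y y' hx hx' _ _ _ hxy'
  exact h hx' hx ▸ hxy'

theorem lowCut_comap {W : Type u} {H : SimpleGraph W} (e : H ≃g G) {X : Set V}
    (h : LowCut G X) : LowCut H (e ⁻¹' X) := by
  intro x x' y y' hx hx' hy hy' hxy hxy'
  exact e.map_adj_iff.1 (h hx hx' hy hy' (e.map_adj_iff.2 hxy) (e.map_adj_iff.2 hxy'))

/-- A failure of `LowCut` is a triangular 2 by 2 submatrix with ones on the diagonal. Without one,
the matrix is the outer product of the indicators of the vertices that have a neighbour across the
cut. -/
theorem cutRank_le_one_iff [Finite V] {X : Set V} : cutRank G X Xᶜ ≤ 1 ↔ LowCut G X := by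
  classical
  have := Fintype.ofFinite V
  rw [cutRank_eq_rank]
  set A := (G.adjMatrix (ZMod 2)).submatrix (Subtype.val : X → V)
    (Subtype.val : (Xᶜ : Set V) → V) with hA
  constructor
  · intro h x x' y y' hx hx' hy hy' hxy hxy'
    by_contra hcon
    let B : Matrix (Fin 2) (Fin 2) (ZMod 2) :=
      A.submatrix ![⟨x, hx⟩, ⟨x', hx'⟩] ![⟨y, hy⟩, ⟨y', hy'⟩]
    have hdet : B.det ≠ 0 := by
      rw [Matrix.det_fin_two]
      simp [B, A, hxy, hxy', hcon]
    have h1 := Matrix.rank_of_det_ne_zero hdet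
    have h2 : B.rank ≤ A.rank := Matrix.rank_submatrix_le _ _ _
    simp at h1
    omega
  · intro h
    have hv : A = Matrix.vecMulVec (fun x : X => if ∃ y ∉ X, G.Adj x y then 1 else 0)
        (fun y : (Xᶜ : Set V) => if ∃ x ∈ X, G.Adj x y then 1 else 0) := by
      ext ⟨x, hx⟩ ⟨y, hy⟩
      rw [Matrix.vecMulVec_apply]
      by_cases hxy : G.Adj x y
      · have h1 : ∃ y ∉ X, G.Adj x y := ⟨y, hy, hxy⟩
        have h2 : ∃ x ∈ X, G.Adj x y := ⟨x, hx, hxy⟩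
        simp only [A, Matrix.submatrix_apply, SimpleGraph.adjMatrix_apply, if_pos hxy, if_pos h1,
          if_pos h2, mul_one]
      · have h1 : ¬ ((∃ y ∉ X, G.Adj x y) ∧ ∃ x ∈ X, G.Adj x y) := by
          rintro ⟨⟨y', hy', h1⟩, x', hx', h2⟩
          exact hxy (h hx hx' hy' hy h1 h2)
        simp only [A, Matrix.submatrix_apply, SimpleGraph.adjMatrix_apply, if_neg hxy]
        rcases not_and_or.1 h1 with h1 | h1
        · rw [if_neg h1, zero_mul]
        · rw [if_neg h1, mul_zero]
    rw [hv]
    exact Matrix.rank_vecMulVec_le _ _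

theorem cutRank_ne_zero [Finite V] {X : Set V} {x y : V} (hx : x ∈ X) (hy : y ∉ X)
    (hxy : G.Adj x y) : cutRank G X Xᶜ ≠ 0 := by
  classical
  have := Fintype.ofFinite V
  rw [cutRank_eq_rank]
  set A := (G.adjMatrix (ZMod 2)).submatrix (Subtype.val : X → V)
    (Subtype.val : (Xᶜ : Set V) → V) with hA
  let B : Matrix (Fin 1) (Fin 1) (ZMod 2) := A.submatrix ![⟨x, hx⟩] ![⟨y, hy⟩]
  have hdet : B.det ≠ 0 := by
    rw [Matrix.det_fin_one]
    simp [B, A, hxy]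
  have h1 := Matrix.rank_of_det_ne_zero hdet
  have h2 : B.rank ≤ A.rank := Matrix.rank_submatrix_le _ _ _
  simp at h1
  omega

/-- Every bipartition into nonempty parts is crossed by an edge. -/
def EdgeConn (G : SimpleGraph V) : Prop :=
  ∀ P : Set V, P.Nonempty → Pᶜ.Nonempty → ∃ u ∈ P, ∃ v ∉ P, G.Adj u v

theorem SimpleGraph.Connected.edgeConn (h : G.Connected) : EdgeConn G := by
  rintro P ⟨u, hu⟩ ⟨v, hv⟩
  obtain ⟨w⟩ := h.preconnected u v
  obtain ⟨d, -, h1, h2⟩ := w.exists_boundary_dart P hu hv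
  exact ⟨d.fst, h1, d.snd, h2, d.adj⟩

theorem EdgeConn.connected [Nonempty V] (h : EdgeConn G) : G.Connected := by
  refine ⟨fun u v => ?_⟩
  by_contra hcon
  obtain ⟨a, ha, b, hb, hab⟩ := h {w | G.Reachable u w} ⟨u, .refl u⟩ ⟨v, hcon⟩
  exact hb (SimpleGraph.Reachable.trans ha hab.reachable)

/-- Connectivity excludes rank zero. -/
theorem isSplit_iff [Finite V] (h : EdgeConn G) {X : Set V} :
    IsSplit G X ↔ X.Nontrivial ∧ Xᶜ.Nontrivial ∧ LowCut G X := by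
  refine and_congr_right fun h1 => and_congr_right fun h2 => ?_
  obtain ⟨x, hx, y, hy, hxy⟩ := h X h1.nonempty h2.nonempty
  rw [← cutRank_le_one_iff]
  have := cutRank_ne_zero hx hy hxy
  omega

/-- The four corners of the two bipartitions given by `X` and `P` are nonempty. -/
def Crosses (X P : Set V) : Prop :=
  (X ∩ P).Nonempty ∧ (X \ P).Nonempty ∧ (P \ X).Nonempty ∧ (X ∪ P)ᶜ.Nonempty

theorem Crosses.symm {X P : Set V} (h : Crosses X P) : Crosses P X :=
  ⟨Set.inter_comm X P ▸ h.1, h.2.2.1, h.2.1, Set.union_comm X P ▸ h.2.2.2⟩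

theorem Crosses.compl_left {X P : Set V} (h : Crosses X P) : Crosses Xᶜ P := by
  obtain ⟨⟨a, ha⟩, ⟨b, hb⟩, ⟨c, hc⟩, d, hd⟩ := h
  refine ⟨⟨c, hc.2, hc.1⟩, ⟨d, ?_⟩, ⟨a, ha.2, ?_⟩, ⟨b, ?_⟩⟩ <;> simp_all

theorem Crosses.compl_right {X P : Set V} (h : Crosses X P) : Crosses X Pᶜ :=
  h.symm.compl_left.symm

/-- Connectivity is needed when the two edges leave `X ∩ P` into the different corners `X \ P` and
`P \ X`. An edge leaving the fourth corner is then moved by the two cuts until its outer end `z` is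
adjacent to both `u` and `u'`; comparison with the edges to `z` completes the rectangle. -/
theorem LowCut.inter (hG : EdgeConn G) {X P : Set V} (hX : LowCut G X) (hP : LowCut G P)
    (hc : Crosses X P) : LowCut G (X ∩ P) := by
  obtain ⟨-, -, -, h4⟩ := hc
  have key : ∀ {u u' v v'}, u ∈ X → u ∈ P → u' ∈ X → u' ∈ P → v ∈ X → v ∉ P → v' ∉ X → v' ∈ P →
      G.Adj u v → G.Adj u' v' → ∃ z, z ∉ X ∧ z ∉ P ∧ G.Adj u z ∧ G.Adj u' z := by
    intro u u' v v' h1 h2 h1' h2' h3 h3' h4' h4'' huv huv'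
    obtain ⟨z, hz, t, ht, hzt⟩ := hG _ h4 ⟨u, by simp [h1]⟩
    simp only [Set.mem_compl_iff, Set.mem_union, not_or] at hz ht
    have hz1 := hz.1
    have hz2 := hz.2
    suffices hs : ∃ z' , z' ∉ X ∧ z' ∉ P ∧ ∃ t ∈ X, t ∈ P ∧ G.Adj t z' by
      obtain ⟨z, hz1, hz2, t, ht1, ht2, htz⟩ := hs
      have e1 : G.Adj u' z := hX h1' ht1 h4' hz1 huv' htz
      exact ⟨z, hz1, hz2, hP h2 h2' h3' hz2 huv e1, e1⟩
    by_cases htX : t ∈ X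
    · by_cases htP : t ∈ P
      · exact ⟨z, hz1, hz2, t, htX, htP, hzt.symm⟩
      · exact ⟨z, hz1, hz2, u', h1', h2', hX h1' htX h4' hz1 huv' hzt.symm⟩
    · have htP : t ∈ P := by tauto
      exact ⟨z, hz1, hz2, u, h1, h2, hP h2 htP h3' hz2 huv hzt.symm⟩
  rintro u u' v v' ⟨h1, h2⟩ ⟨h1', h2'⟩ hv hv' huv huv'
  have hv : v ∉ X ∨ v ∉ P := by rw [Set.mem_inter_iff] at hv; tauto
  have hv' : v' ∉ X ∨ v' ∉ P := by rw [Set.mem_inter_iff] at hv'; tauto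
  by_cases a : v ∈ X <;> by_cases b : v ∈ P <;> by_cases c : v' ∈ X <;> by_cases d : v' ∈ P <;>
    first
    | exact hX h1 h1' a c huv huv'
    | exact hP h2 h2' b d huv huv'
    | (exfalso; tauto)
    | (obtain ⟨z, z1, z2, z3, z4⟩ := key h1 h2 h1' h2' a b c d huv huv'
       exact hX h1 h1' z1 c z3 huv')
    | (obtain ⟨z, z1, z2, z3, z4⟩ := key h1' h2' h1 h2 c d a b huv' huv
       exact hP h2 h2' z2 d z4 huv')

/-- One of the cuts turns the given edges into the edges `u u'` and `v v'`, to which the other cut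
applies. -/
theorem LowCut.adj_of_opposite_corners {X P : Set V} (hX : LowCut G X) (hP : LowCut G P)
    {u u' v v' : V} (hu : u ∈ X) (hu' : u ∉ P) (hu1 : u' ∉ X) (hu2 : u' ∈ P)
    (h : v ∈ X ∧ v ∈ P ∧ v' ∉ X ∧ v' ∉ P ∨ v ∉ X ∧ v ∉ P ∧ v' ∈ X ∧ v' ∈ P)
    (huv : G.Adj u v) (huv' : G.Adj u' v') : G.Adj u v' := by
  rcases h with ⟨h1, h2, h3, h4⟩ | ⟨h1, h2, h3, h4⟩
  · have e1 : G.Adj v v' := hP h2 hu2 hu' h4 huv.symm huv'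
    have e2 : G.Adj u' u := hP hu2 h2 h4 hu' huv' huv.symm
    exact hX hu h1 hu1 h3 e2.symm e1
  · have e1 : G.Adj u u' := hX hu h3 h1 hu1 huv huv'.symm
    have e2 : G.Adj v' v := hX h3 hu hu1 h1 huv'.symm huv
    exact (hP h4 hu2 h2 hu' e2 e1.symm).symm

/-- All four corners are low, which settles two edges that have ends in a common corner on the same
side. The remaining pairs of edges meet all four corners. -/
theorem LowCut.symmDiff (hG : EdgeConn G) {X P : Set V} (hX : LowCut G X) (hP : LowCut G P)
    (hc : Crosses X P) : LowCut G (symmDiff X P) := by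
  have h1 : LowCut G (X ∩ P) := hX.inter hG hP hc
  have h2 : LowCut G (X ∩ Pᶜ) := hX.inter hG hP.compl hc.compl_right
  have h3 : LowCut G (Xᶜ ∩ P) := hX.compl.inter hG hP hc.compl_left
  have h4 : LowCut G (Xᶜ ∩ Pᶜ) := hX.compl.inter hG hP.compl hc.compl_left.compl_right
  intro u u' v v' hu hu' hv hv' huv huv'
  have n2 : ∀ {w}, w ∉ _root_.symmDiff X P → w ∉ X ∩ Pᶜ := fun hw h => hw (.inl h)
  have n3 : ∀ {w}, w ∉ _root_.symmDiff X P → w ∉ Xᶜ ∩ P := fun hw h => hw (.inr ⟨h.2, h.1⟩)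
  have n1 : ∀ {w}, w ∈ _root_.symmDiff X P → w ∉ X ∩ P := by
    rintro w (a | a) h
    · exact a.2 h.2
    · exact a.2 h.1
  have n4 : ∀ {w}, w ∈ _root_.symmDiff X P → w ∉ Xᶜ ∩ Pᶜ := by
    rintro w (a | a) h
    · exact h.1 a.1
    · exact h.2 a.1
  have out : ∀ w, w ∉ _root_.symmDiff X P → (w ∈ X ∧ w ∈ P ∨ w ∉ X ∧ w ∉ P) := by
    intro w hw
    rw [Set.mem_symmDiff] at hw
    tauto
  rcases id hu with a | a <;> rcases id hu' with b | b
  · exact h2 a b (n2 hv) (n2 hv') huv huv'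
  · rcases out v hv with c | c <;> rcases out v' hv' with d | d
    · exact (h1 d c (n1 hu') (n1 hu) huv'.symm huv.symm).symm
    · exact hX.adj_of_opposite_corners hP a.1 a.2 b.2 b.1 (by tauto) huv huv'
    · exact hX.adj_of_opposite_corners hP a.1 a.2 b.2 b.1 (by tauto) huv huv'
    · exact (h4 d c (n4 hu') (n4 hu) huv'.symm huv.symm).symm
  · rcases out v hv with c | c <;> rcases out v' hv' with d | d
    · exact (h1 d c (n1 hu') (n1 hu) huv'.symm huv.symm).symm
    · exact hP.adj_of_opposite_corners hX a.1 a.2 b.2 b.1 (by tauto) huv huv'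
    · exact hP.adj_of_opposite_corners hX a.1 a.2 b.2 b.1 (by tauto) huv huv'
    · exact (h4 d c (n4 hu') (n4 hu) huv'.symm huv.symm).symm
  · exact h3 ⟨a.2, a.1⟩ ⟨b.2, b.1⟩ (n3 hv) (n3 hv') huv huv'

/-- The map from a graph to its marker graph that identifies the vertices outside `X`. -/
noncomputable def markerProj (X : Set V) (v : V) : Option X :=
  open Classical in if h : v ∈ X then some ⟨v, h⟩ else none

theorem markerProj_mem {X : Set V} {v : V} (h : v ∈ X) : markerProj X v = some ⟨v, h⟩ :=
  dif_pos h

theorem markerProj_notMem {X : Set V} {v : V} (h : v ∉ X) : markerProj X v = none :=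
  dif_neg h

theorem markerProj_coe {X : Set V} (v : X) : markerProj X v = some v :=
  markerProj_mem v.2

theorem markerProj_surjective {X : Set V} (hX : Xᶜ.Nonempty) :
    Function.Surjective (markerProj X) := by
  obtain ⟨y, hy⟩ := hX
  rintro (_ | x)
  · exact ⟨y, markerProj_notMem hy⟩
  · exact ⟨x, markerProj_coe x⟩

theorem markerProj_adj {X : Set V} {u v : V} (h : G.Adj u v) (hne : u ∈ X ∨ v ∈ X) :
    (markerGraph G X).Adj (markerProj X u) (markerProj X v) := by
  by_cases hu : u ∈ X <;> by_cases hv : v ∈ X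
  · rw [markerProj_mem hu, markerProj_mem hv]; exact h
  · rw [markerProj_mem hu, markerProj_notMem hv]; exact ⟨v, hv, h⟩
  · rw [markerProj_notMem hu, markerProj_mem hv]; exact ⟨u, hu, h.symm⟩
  · tauto

theorem exists_adj_of_markerGraph_adj {X : Set V} {a b : Option X}
    (h : (markerGraph G X).Adj a b) :
    ∃ u v, markerProj X u = a ∧ markerProj X v = b ∧ G.Adj u v := by
  rcases a with _ | x <;> rcases b with _ | y
  · exact h.elim
  · obtain ⟨z, hz, hyz⟩ := h
    exact ⟨z, y, markerProj_notMem hz, markerProj_coe y, hyz.symm⟩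
  · obtain ⟨z, hz, hyz⟩ := h
    exact ⟨x, z, markerProj_coe x, markerProj_notMem hz, hyz⟩
  · exact ⟨x, y, markerProj_coe x, markerProj_coe y, h⟩

/-- Edges between disjoint sets of the marker graph correspond to edges between their preimages. -/
theorem exists_markerGraph_adj_iff {X : Set V} {P Q : Set (Option X)} (h : Disjoint P Q) :
    (∃ a ∈ P, ∃ b ∈ Q, (markerGraph G X).Adj a b) ↔
      ∃ u ∈ markerProj X ⁻¹' P, ∃ v ∈ markerProj X ⁻¹' Q, G.Adj u v := by
  constructor
  · rintro ⟨a, ha, b, hb, hab⟩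
    obtain ⟨u, v, rfl, rfl, huv⟩ := exists_adj_of_markerGraph_adj hab
    exact ⟨u, ha, v, hb, huv⟩
  · rintro ⟨u, hu, v, hv, huv⟩
    refine ⟨_, hu, _, hv, markerProj_adj huv ?_⟩
    by_contra! hcon
    refine Set.disjoint_left.1 h hu ?_
    rw [markerProj_notMem hcon.1, ← markerProj_notMem hcon.2]
    exact hv

theorem EdgeConn.markerGraph (hG : EdgeConn G) {X : Set V} (hX : Xᶜ.Nonempty) :
    EdgeConn (markerGraph G X) := by
  intro P hP hP'
  have hs := markerProj_surjective hX
  exact (exists_markerGraph_adj_iff (disjoint_compl_right (a := P))).2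
    (hG (markerProj X ⁻¹' P) (hP.preimage hs) (hP'.preimage hs))

/-- The marker graph arises from `G` by identifying the vertices outside `X`. As `X` is low, those
among them with a neighbour in `X` all have the same ones, so an edge at the marker can be realised
at any of them. -/
theorem lowCut_markerGraph_iff {X : Set V} (hX : LowCut G X) {P : Set (Option X)} :
    LowCut (markerGraph G X) P ↔ LowCut G (markerProj X ⁻¹' P) := by
  constructor
  · intro h u u' v v' hu hu' hv hv' huv huv'
    have side : ∀ {u v}, u ∈ markerProj X ⁻¹' P → v ∉ markerProj X ⁻¹' P → u ∈ X ∨ v ∈ X := by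
      intro u v hu hv
      by_contra! hcon
      apply hv
      rw [Set.mem_preimage, markerProj_notMem hcon.2, ← markerProj_notMem hcon.1]
      exact hu
    have e1 := markerProj_adj huv (side hu hv)
    have e2 := markerProj_adj huv' (side hu' hv')
    have e3 := h hu hu' hv hv' e1 e2
    by_cases a : u ∈ X <;> by_cases b : v' ∈ X
    · rw [markerProj_mem a, markerProj_mem b] at e3; exact e3
    · rw [markerProj_mem a, markerProj_notMem b] at e3
      obtain ⟨z, hz, hz'⟩ := e3
      by_cases c : u' ∈ X
      · exact hX a c hz b hz' huv'
      · exfalso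
        have := side hu' hv'
        tauto
    · rw [markerProj_notMem a, markerProj_mem b] at e3
      obtain ⟨z, hz, hz'⟩ := e3
      by_cases c : v ∈ X
      · exact (hX b c hz a hz' huv.symm).symm
      · exfalso
        have := side hu hv
        tauto
    · have := side hu hv'
      tauto
  · intro h a a' b b' ha ha' hb hb' hab hab'
    obtain ⟨u, v, rfl, rfl, huv⟩ := exists_adj_of_markerGraph_adj hab
    obtain ⟨u', v', rfl, rfl, huv'⟩ := exists_adj_of_markerGraph_adj hab'
    refine markerProj_adj (h ha ha' hb hb' huv huv') ?_
    by_contra! hcon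
    apply hb'
    rw [markerProj_notMem hcon.2, ← markerProj_notMem hcon.1]
    exact ha

/-- The marker graph of a cut of rank one is an induced subgraph. -/
theorem exists_markerGraph_embedding {X : Set V} (hX : LowCut G X) {x y : V} (hx : x ∈ X)
    (hy : y ∉ X) (hxy : G.Adj x y) : Nonempty (markerGraph G X ↪g G) := by
  refine ⟨⟨⟨fun a => a.elim y (↑), ?_⟩, ?_⟩⟩
  · rintro (_ | a) (_ | b) hab
    · rfl
    · exact absurd ((show y = b from hab) ▸ b.2) hy
    · exact absurd ((show a = y from hab) ▸ a.2) hy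
    · exact congrArg some (Subtype.ext hab)
  · have key : ∀ a : X, G.Adj a y ↔ ∃ y ∉ X, G.Adj a y :=
      fun a => ⟨fun h => ⟨y, hy, h⟩, fun ⟨z, hz, h⟩ => hX a.2 hx hz hy h hxy⟩
    rintro (_ | a) (_ | b)
    · simp
    · exact (G.adj_comm _ _).trans (key b)
    · exact key a
    · exact Iff.rfl

end Cuts

/-! ### Graphs in which every cut is low. -/

section BrittleGraphs

variable {V : Type u} {G : SimpleGraph V}

/-- Pairwise meeting edges form a star or a triangle, and a fourth vertex, not being isolated,
excludes the triangle. -/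
theorem exists_star_of_edges_meet [Finite V] (hG : EdgeConn G) (hcard : 4 ≤ Nat.card V)
    (h : ∀ x y z w, G.Adj x y → G.Adj z w → x = z ∨ x = w ∨ y = z ∨ y = w) :
    ∃ c, IsStarGraphAt G c := by
  have nontriv : Nontrivial V := Finite.one_lt_card_iff_nontrivial.1 (by omega)
  have nbr : ∀ v, ∃ w, G.Adj v w := by
    intro v
    obtain ⟨w, hw⟩ := exists_ne v
    obtain ⟨u, rfl, z, hz, huz⟩ := hG {v} ⟨v, rfl⟩ ⟨w, hw⟩
    exact ⟨z, huz⟩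
  have fourth : ∀ a b c : V, ∃ d, d ≠ a ∧ d ≠ b ∧ d ≠ c := by
    intro a b c
    by_contra! hcon
    have h1 : (Set.univ : Set V) ⊆ {a, b, c} := fun d _ => by
      have := hcon d
      simp only [Set.mem_insert_iff, Set.mem_singleton_iff]
      tauto
    have h2 := Set.ncard_le_ncard h1
    rw [Set.ncard_univ] at h2
    have h3 : ({a, b, c} : Set V).ncard ≤ 3 :=
      (Set.ncard_insert_le _ _).trans (Nat.succ_le_succ ((Set.ncard_insert_le _ _).trans (by simp)))
    omega
  obtain ⟨a, b, hab⟩ := exists_pair_ne V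
  obtain ⟨u, v, w, huv, hvw, huw⟩ : ∃ u v w, G.Adj v u ∧ G.Adj v w ∧ u ≠ w := by
    obtain ⟨b, hab⟩ := nbr a
    obtain ⟨c, hca, hcb, -⟩ := fourth a b a
    obtain ⟨d, hcd⟩ := nbr c
    rcases h a b c d hab hcd with rfl | rfl | rfl | rfl
    · exact absurd rfl hca
    · exact ⟨c, a, b, hcd.symm, hab, hcb⟩
    · exact absurd rfl hcb
    · exact ⟨c, b, a, hcd.symm, hab.symm, hca⟩
  have hnuw : ¬ G.Adj u w := by
    intro huw'
    obtain ⟨d, hdu, hdv, hdw⟩ := fourth u v w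
    obtain ⟨e, hde⟩ := nbr d
    have h1 := h d e v u hde huv
    have h2 := h d e v w hde hvw
    have h3 := h d e u w hde huw'
    have := huv.ne
    have := hvw.ne
    grind
  have hall : ∀ x y, G.Adj x y → x = v ∨ y = v := by
    intro x y hxy
    have h1 := h x y v u hxy huv
    have h2 := h x y v w hxy hvw
    by_contra! hcon
    have h3 : (x = u ∧ y = w) ∨ (x = w ∧ y = u) := by grind
    rcases h3 with ⟨rfl, rfl⟩ | ⟨rfl, rfl⟩
    · exact hnuw hxy
    · exact hnuw hxy.symm
  refine ⟨v, by omega, ?_⟩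
  ext x y
  rw [SimpleGraph.starGraph_adj]
  refine ⟨fun h => ⟨h.ne, hall x y h⟩, ?_⟩
  have : ∀ x, x ≠ v → G.Adj v x := by
    intro x hx
    obtain ⟨y, hxy⟩ := nbr x
    rcases hall x y hxy with e | rfl
    · exact absurd e hx
    · exact hxy.symm
  rintro ⟨hne, rfl | rfl⟩
  · exact this y hne.symm
  · exact (this x hne).symm

/-- A connected graph with at least three vertices all of whose cuts have rank one is a clique or
a star. -/
theorem isClique_or_isStar_of_forall_lowCut [Finite V] (hG : EdgeConn G)
    (hcard : 3 ≤ Nat.card V) (h : ∀ X : Set V, LowCut G X) :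
    IsCliqueGraph G ∨ ∃ c, IsStarGraphAt G c := by
  rcases Nat.lt_or_ge 3 (Nat.card V) with hcard' | hcard'
  · by_cases hm : ∀ x y z w, G.Adj x y → G.Adj z w → x = z ∨ x = w ∨ y = z ∨ y = w
    · exact .inr (exists_star_of_edges_meet hG hcard' hm)
    push Not at hm
    -- The pair `{x, z}` is low. Hence two disjoint edges span a `K₄`, which then absorbs every
    -- other vertex.
    have key : ∀ {x y z w}, G.Adj x y → G.Adj z w → x ≠ z → x ≠ w → y ≠ z → y ≠ w →
        G.Adj x w := by
      intro x y z w hxy hzw h1 h2 h3 h4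
      exact h {x, z} (.inl rfl) (.inr rfl) (by simp [hxy.ne', h3]) (by simp [h2.symm, hzw.ne'])
        hxy hzw
    have nontriv : Nontrivial V := Finite.one_lt_card_iff_nontrivial.1 (by omega)
    have nbr : ∀ v, ∃ w, G.Adj v w := by
      intro v
      obtain ⟨w, hw⟩ := exists_ne v
      obtain ⟨u, rfl, z, hz, huz⟩ := hG {v} ⟨v, rfl⟩ ⟨w, hw⟩
      exact ⟨z, huz⟩
    obtain ⟨x, y, z, w, hxy, hzw, h1, h2, h3, h4⟩ := hm
    have hxw := key hxy hzw h1 h2 h3 h4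
    have hxz := key hxy hzw.symm h2 h1 h4 h3
    have hyw := key hxy.symm hzw h3 h4 h1 h2
    have hyz := key hxy.symm hzw.symm h4 h3 h2 h1
    have hK : ∀ v, v ≠ x → v ≠ y → v ≠ z → v ≠ w →
        G.Adj v x ∧ G.Adj v y ∧ G.Adj v z ∧ G.Adj v w := by
      intro v hx hy hz hw
      have tri : ∀ {a b c d}, v ≠ a → v ≠ b → v ≠ c → v ≠ d → G.Adj a b → G.Adj a c → G.Adj b c →
          G.Adj b d → G.Adj c d → G.Adj v a → G.Adj a d →
          G.Adj v b ∧ G.Adj v c ∧ G.Adj v d := by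
        intro a b c d ha hb hc hd hab hac hbc hbd hcd hva had
        exact ⟨key hva hbc.symm hc hb hac.ne hab.ne, key hva hbc hb hc hab.ne hac.ne,
          key hva hbd hb hd hab.ne had.ne⟩
      obtain ⟨t, hvt⟩ := nbr v
      by_cases htx : t = x
      · subst htx
        have := tri hx hy hz hw hxy hxz hyz hyw hzw hvt hxw
        exact ⟨hvt, this⟩
      by_cases hty : t = y
      · subst hty
        have := tri hy hx hz hw hxy.symm hyz hxz hxw hzw hvt hyw
        exact ⟨this.1, hvt, this.2⟩
      by_cases htz : t = z
      · subst htz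
        have := tri hz hx hy hw hxz.symm hyz.symm hxy hxw hyw hvt hzw
        exact ⟨this.1, this.2.1, hvt, this.2.2⟩
      by_cases htw : t = w
      · subst htw
        have := tri hw hx hy hz hxw.symm hyw.symm hxy hxz hyz hvt hzw.symm
        exact ⟨this.1, this.2.1, this.2.2, hvt⟩
      exact ⟨key hvt hxy.symm hy hx hty htx, key hvt hxy hx hy htx hty,
        key hvt hzw.symm hw hz htw htz, key hvt hzw hz hw htz htw⟩
    left
    refine ⟨hcard, ?_⟩
    ext a b
    rw [SimpleGraph.top_adj]
    refine ⟨fun h => h.ne, fun hab => ?_⟩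
    by_cases ha : a ≠ x ∧ a ≠ y ∧ a ≠ z ∧ a ≠ w
    · obtain ⟨a1, a2, a3, a4⟩ := hK a ha.1 ha.2.1 ha.2.2.1 ha.2.2.2
      by_cases hb : b ≠ x ∧ b ≠ y ∧ b ≠ z ∧ b ≠ w
      · obtain ⟨b1, b2, b3, b4⟩ := hK b hb.1 hb.2.1 hb.2.2.1 hb.2.2.2
        exact key a1 b2.symm ha.2.1 hab hxy.ne hb.1.symm
      · grind
    · by_cases hb : b ≠ x ∧ b ≠ y ∧ b ≠ z ∧ b ≠ w
      · obtain ⟨b1, b2, b3, b4⟩ := hK b hb.1 hb.2.1 hb.2.2.1 hb.2.2.2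
        grind [SimpleGraph.adj_comm]
      · grind [SimpleGraph.adj_comm]
  · obtain ⟨a, b, c, hab, hac, hbc, huniv⟩ : ∃ a b c : V, a ≠ b ∧ a ≠ c ∧ b ≠ c ∧
        ∀ v, v = a ∨ v = b ∨ v = c := by
      have h3 : (Set.univ : Set V).ncard = 3 := by rw [Set.ncard_univ]; omega
      obtain ⟨a, b, c, hab, hac, hbc, hu⟩ := Set.ncard_eq_three.1 h3
      refine ⟨a, b, c, hab, hac, hbc, fun v => ?_⟩
      have : v ∈ (Set.univ : Set V) := trivial
      rw [hu] at this
      simpa using this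
    have nbr : ∀ v, ∃ w, G.Adj v w := by
      intro v
      have : Nontrivial V := ⟨a, b, hab⟩
      obtain ⟨w, hw⟩ := exists_ne v
      obtain ⟨u, rfl, z, hz, huz⟩ := hG {v} ⟨v, rfl⟩ ⟨w, hw⟩
      exact ⟨z, huz⟩
    have hstar : ∀ {a b c : V}, a ≠ b → a ≠ c → b ≠ c → (∀ v, v = a ∨ v = b ∨ v = c) →
        ¬ G.Adj a b → IsStarGraphAt G c := by
      intro a b c hab hac hbc huniv hn
      refine ⟨hcard, ?_⟩
      have hca : G.Adj c a := by
        obtain ⟨t, ht⟩ := nbr a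
        rcases huniv t with rfl | rfl | rfl
        · exact absurd ht (G.loopless.irrefl _)
        · exact absurd ht hn
        · exact ht.symm
      have hcb : G.Adj c b := by
        obtain ⟨t, ht⟩ := nbr b
        rcases huniv t with rfl | rfl | rfl
        · exact absurd ht.symm hn
        · exact absurd ht (G.loopless.irrefl _)
        · exact ht.symm
      have hn' : ¬ G.Adj b a := fun h => hn h.symm
      ext u v
      rw [SimpleGraph.starGraph_adj]
      rcases huniv u with rfl | rfl | rfl <;> rcases huniv v with rfl | rfl | rfl <;>
        simp [hca, hcb, hca.symm, hcb.symm, hn, hn', hac, hbc, hac.symm, hbc.symm]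
    by_cases h1 : G.Adj a b
    · by_cases h2 : G.Adj a c
      · by_cases h3 : G.Adj b c
        · refine .inl ⟨hcard, ?_⟩
          ext u v
          rw [SimpleGraph.top_adj]
          refine ⟨fun h => h.ne, fun hne => ?_⟩
          rcases huniv u with rfl | rfl | rfl <;> rcases huniv v with rfl | rfl | rfl <;>
            first | exact absurd rfl hne | assumption | (apply SimpleGraph.Adj.symm; assumption)
        · exact .inr ⟨a, hstar hbc hab.symm hac.symm (fun v => by have := huniv v; tauto) h3⟩
      · exact .inr ⟨b, hstar hac hab hbc.symm (fun v => by have := huniv v; tauto) h2⟩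
    · exact .inr ⟨c, hstar hab hac hbc huniv h1⟩

theorem IsCliqueGraph.lowCut (h : IsCliqueGraph G) (X : Set V) : LowCut G X := by
  intro x x' y y' hx _ _ hy' _ _
  rw [h.2, SimpleGraph.top_adj]
  rintro rfl
  exact hy' hx

theorem IsStarGraphAt.lowCut {c : V} (h : IsStarGraphAt G c) (X : Set V) : LowCut G X := by
  intro x x' y y' hx hx' hy hy' hxy hxy'
  rw [h.2, SimpleGraph.starGraph_adj] at *
  have : x ≠ y' := by rintro rfl; exact hy' hx
  refine ⟨this, ?_⟩
  rcases hxy.2 with rfl | rfl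
  · exact .inl rfl
  · rcases hxy'.2 with rfl | rfl
    · exact absurd hx' hy
    · exact .inr rfl

end BrittleGraphs

/-! ### Graphs in which every split is crossed. -/

section CrossedSplits

variable {V : Type u} {G : SimpleGraph V}

theorem LowCut.union (hG : EdgeConn G) {X P : Set V} (hX : LowCut G X) (hP : LowCut G P)
    (hc : Crosses X P) : LowCut G (X ∪ P) := by
  have := (hX.compl.inter hG hP.compl hc.compl_left.compl_right).compl
  rwa [Set.compl_inter, compl_compl, compl_compl] at this

theorem LowCut.diff (hG : EdgeConn G) {X P : Set V} (hX : LowCut G X) (hP : LowCut G P)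
    (hc : Crosses X P) : LowCut G (X \ P) :=
  hX.inter hG hP.compl hc.compl_right

theorem Crosses.nontrivial {X P : Set V} (h : Crosses X P) : P.Nontrivial := by
  obtain ⟨⟨a, ha⟩, -, ⟨b, hb⟩, -⟩ := h
  exact ⟨a, ha.2, b, hb.1, fun e => hb.2 (e ▸ ha.1)⟩

/-- Complement `P` if necessary so that it contains `a`. If it misses `b`, then `a` lies in both
sets and `b` in neither, so both lie outside the symmetric difference. -/
theorem exists_lowCut_containing_pair (hG : EdgeConn G) {X P : Set V}
    (hX : LowCut G X) (hP : LowCut G P) (hc : Crosses X P) {a b : V} (ha : a ∈ X) (hb : b ∉ X) :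
    ∃ M : Set V, Mᶜ.Nontrivial ∧ LowCut G M ∧ a ∈ M ∧ b ∈ M := by
  have key : ∀ P : Set V, LowCut G P → Crosses X P → a ∈ P →
      ∃ M : Set V, Mᶜ.Nontrivial ∧ LowCut G M ∧ a ∈ M ∧ b ∈ M := by
    intro P hP hc haP
    by_cases hbP : b ∈ P
    · exact ⟨P, hc.compl_right.nontrivial, hP, haP, hbP⟩
    · refine ⟨(symmDiff X P)ᶜ, ?_, (hX.symmDiff hG hP hc).compl, ?_, ?_⟩
      · obtain ⟨-, ⟨c, hc⟩, ⟨d, hd⟩, -⟩ := hc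
        rw [compl_compl]
        exact ⟨c, .inl hc, d, .inr hd, fun e => hd.2 (e ▸ hc.1)⟩
      · rw [Set.mem_compl_iff, Set.mem_symmDiff]; tauto
      · rw [Set.mem_compl_iff, Set.mem_symmDiff]; tauto
  by_cases haP : a ∈ P
  · exact key P hP hc haP
  · exact key Pᶜ hP.compl hc.compl_right haP

/-- Let `M` be a smallest low set containing `a` and `b` whose complement is nontrivial. If `M` is
larger than the pair, it has a maximal low proper subset `N` with at least two elements. A low `Q ⊆
M` crossing `N` is impossible: `N ∪ Q = M` by maximality, neither set contains both `a` and `b`, so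
both lie in the low set `N ∆ Q`, which is smaller than `M`. But the split `N` is crossed, and this
yields such a `Q`. -/
theorem lowCut_pair_of_splits_crossed [Finite V] (hG : EdgeConn G)
    (hcross : ∀ X : Set V, X.Nontrivial → Xᶜ.Nontrivial → LowCut G X →
      ∃ P, LowCut G P ∧ Crosses X P)
    (hex : ∃ X : Set V, X.Nontrivial ∧ Xᶜ.Nontrivial ∧ LowCut G X) {a b : V} (hab : a ≠ b) :
    LowCut G {a, b} := by
  have hM : ∃ M : Set V, Mᶜ.Nontrivial ∧ LowCut G M ∧ a ∈ M ∧ b ∈ M := by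
    obtain ⟨X, hX1, hX2, hX⟩ := hex
    obtain ⟨P, hP, hc⟩ := hcross X hX1 hX2 hX
    by_cases ha : a ∈ X <;> by_cases hb : b ∈ X
    · exact ⟨X, hX2, hX, ha, hb⟩
    · exact exists_lowCut_containing_pair hG hX hP hc ha hb
    · exact exists_lowCut_containing_pair hG hX.compl hP hc.compl_left ha (not_not.2 hb)
    · exact ⟨Xᶜ, (compl_compl X).symm ▸ hX1, hX.compl, ha, hb⟩
  obtain ⟨M, ⟨hM1, hM, ha, hb⟩, hMmin⟩ := Set.exists_min_image
    {M : Set V | Mᶜ.Nontrivial ∧ LowCut G M ∧ a ∈ M ∧ b ∈ M} Set.ncard (Set.toFinite _) hM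
  have hmin : ∀ L : Set V, LowCut G L → a ∈ L → b ∈ L → L ⊆ M → L = M := fun L hL haL hbL hLM =>
    Set.eq_of_subset_of_ncard_le hLM
      (hMmin L ⟨hM1.mono (Set.compl_subset_compl.2 hLM), hL, haL, hbL⟩)
  suffices hs : M ⊆ {a, b} by
    have : M = {a, b} := hs.antisymm (by rintro x (rfl | rfl) <;> assumption)
    exact this ▸ hM
  intro c hcM
  by_contra hcab
  have hca : c ≠ a := fun e => hcab (.inl e)
  have hcb : c ≠ b := fun e => hcab (.inr e)
  have hN : ∃ N : Set V, LowCut G N ∧ N.Nontrivial ∧ N ⊂ M := by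
    obtain ⟨P, hP, hc⟩ := hcross M ⟨a, ha, b, hb, hab⟩ hM1 hM
    have key : ∀ P : Set V, LowCut G P → Crosses M P → c ∈ P →
        ∃ N : Set V, LowCut G N ∧ N.Nontrivial ∧ N ⊂ M := by
      intro P hP hc hcP
      have hlow := hM.inter hG hP hc
      have hlow' := hM.diff hG hP hc
      have hlt : M ∩ P ⊂ M := by
        obtain ⟨-, ⟨d, hd⟩, -, -⟩ := hc
        exact ⟨Set.inter_subset_left, fun h => hd.2 (h hd.1).2⟩
      by_cases haP : a ∈ P
      · exact ⟨M ∩ P, hlow, ⟨c, ⟨hcM, hcP⟩, a, ⟨ha, haP⟩, hca⟩, hlt⟩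
      · by_cases hbP : b ∈ P
        · exact ⟨M ∩ P, hlow, ⟨c, ⟨hcM, hcP⟩, b, ⟨hb, hbP⟩, hcb⟩, hlt⟩
        · have := hmin (M \ P) hlow' ⟨ha, haP⟩ ⟨hb, hbP⟩ Set.sdiff_subset
          rw [← this] at hcM
          exact absurd hcP hcM.2
    by_cases hcP : c ∈ P
    · exact key P hP hc hcP
    · exact key Pᶜ hP.compl hc.compl_right hcP
  obtain ⟨N, ⟨hN, hN1, hNM⟩, hNmax⟩ := Set.exists_max_image
    {N : Set V | LowCut G N ∧ N.Nontrivial ∧ N ⊂ M} Set.ncard (Set.toFinite _) hN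
  have hnot : ¬ (a ∈ N ∧ b ∈ N) := fun h => hNM.ne (hmin N hN h.1 h.2 hNM.subset)
  have inside : ∀ Q : Set V, LowCut G Q → Crosses N Q → Q ⊆ M → False := by
    intro Q hQ hc hQM
    have hU : N ∪ Q = M := by
      by_contra hne
      have hUM : N ∪ Q ⊂ M := (Set.union_subset hNM.subset hQM).ssubset_of_ne hne
      have h1 := hNmax (N ∪ Q) ⟨hN.union hG hQ hc, hN1.mono Set.subset_union_left, hUM⟩
      obtain ⟨-, -, ⟨d, hd⟩, -⟩ := hc
      have h2 : N ⊂ N ∪ Q := ⟨Set.subset_union_left, fun h => hd.2 (h (.inr hd.1))⟩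
      exact absurd (Set.ncard_lt_ncard h2) (not_lt.2 h1)
    have hnotQ : ¬ (a ∈ Q ∧ b ∈ Q) := by
      rintro ⟨h1, h2⟩
      have h3 := hmin Q hQ h1 h2 hQM
      obtain ⟨-, ⟨d, hd⟩, -, -⟩ := hc
      exact hd.2 (h3 ▸ hNM.subset hd.1)
    have hdiff : symmDiff N Q ⊆ M := by
      rintro x (hx | hx)
      · exact hNM.subset hx.1
      · exact hQM hx.1
    have ha' : a ∈ N ∪ Q := hU ▸ ha
    have hb' : b ∈ N ∪ Q := hU ▸ hb
    rw [Set.mem_union] at ha' hb'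
    have h1 := hmin (symmDiff N Q) (hN.symmDiff hG hQ hc)
      (by rw [Set.mem_symmDiff]; tauto) (by rw [Set.mem_symmDiff]; tauto) hdiff
    obtain ⟨⟨d, hd⟩, -, -, -⟩ := hc
    have h2 : d ∈ symmDiff N Q := h1 ▸ hNM.subset hd.1
    rw [Set.mem_symmDiff] at h2
    have := hd.1
    have := hd.2
    tauto
  obtain ⟨P, hP, hc⟩ := hcross N hN1 (hM1.mono (Set.compl_subset_compl.2 hNM.subset)) hN
  by_cases h1 : P ⊆ M
  · exact inside P hP hc h1
  by_cases h2 : Pᶜ ⊆ M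
  · exact inside Pᶜ hP.compl hc.compl_right h2
  obtain ⟨p, hpP, hpM⟩ := Set.not_subset.1 h1
  obtain ⟨q, hqP, hqM⟩ := Set.not_subset.1 h2
  obtain ⟨⟨d, hd⟩, ⟨e, he⟩, -, -⟩ := hc
  have hcM : Crosses M P := ⟨⟨d, hNM.subset hd.1, hd.2⟩, ⟨e, hNM.subset he.1, he.2⟩, ⟨p, hpP, hpM⟩,
    q, fun h => h.elim hqM hqP⟩
  -- Now `P` crosses `M` too. An element of `M` outside `N` shows which of `M ∩ P` and `M \ P`
  -- crosses `N`.
  by_cases h3 : M ∩ P ⊆ N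
  · obtain ⟨m, hmM, hmN⟩ := Set.not_subset.1 hNM.2
    refine inside (M \ P) (hM.diff hG hP hcM) ⟨⟨e, he.1, hNM.subset he.1, he.2⟩,
      ⟨d, hd.1, fun h => h.2 hd.2⟩, ⟨m, ⟨hmM, fun h => hmN (h3 ⟨hmM, h⟩)⟩, hmN⟩,
      ⟨p, fun h => ?_⟩⟩ Set.sdiff_subset
    exact h.elim (fun h => hpM (hNM.subset h)) (fun h => hpM h.1)
  · obtain ⟨m, hmM, hmN⟩ := Set.not_subset.1 h3
    refine inside (M ∩ P) (hM.inter hG hP hcM) ⟨⟨d, hd.1, hNM.subset hd.1, hd.2⟩,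
      ⟨e, he.1, fun h => he.2 h.2⟩, ⟨m, hmM, hmN⟩, ⟨p, fun h => ?_⟩⟩ Set.inter_subset_left
    exact h.elim (fun h => hpM (hNM.subset h)) (fun h => hpM h.1)

/-- Add the vertices one at a time: for `x ∈ X` the pair `{x, c}` crosses `X` unless the new set is
this pair or everything, and unions of crossing low sets are low. -/
theorem forall_lowCut_of_pairs [Finite V] (hG : EdgeConn G)
    (h : ∀ a b : V, a ≠ b → LowCut G {a, b}) (X : Set V) : LowCut G X := by
  induction X, Set.toFinite X using Set.Finite.induction_on with
  | empty => exact lowCut_of_subsingleton Set.subsingleton_empty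
  | @insert c X hc _ ih =>
    rcases X.eq_empty_or_nonempty with rfl | ⟨x, hx⟩
    · exact lowCut_of_subsingleton (by simp)
    have hxc : x ≠ c := fun e => hc (e ▸ hx)
    by_cases h1 : X ⊆ {x, c}
    · have : insert c X = {x, c} := by
        ext y
        simp only [Set.mem_insert_iff, Set.mem_singleton_iff]
        constructor
        · rintro (rfl | hy)
          · exact .inr rfl
          · exact h1 hy
        · rintro (rfl | rfl)
          · exact .inr hx
          · exact .inl rfl
      rw [this]
      exact h x c hxc
    by_cases h2 : (insert c X)ᶜ.Nonempty
    · obtain ⟨y, hyX, hy⟩ := Set.not_subset.1 h1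
      have hU : X ∪ {x, c} = insert c X := by
        ext z
        simp only [Set.mem_insert_iff, Set.mem_union, Set.mem_singleton_iff]
        constructor
        · rintro (hz | rfl | rfl)
          · exact .inr hz
          · exact .inr hx
          · exact .inl rfl
        · rintro (rfl | hz)
          · exact .inr (.inr rfl)
          · exact .inl hz
      have hcr : Crosses X {x, c} :=
        ⟨⟨x, hx, .inl rfl⟩, ⟨y, hyX, hy⟩, ⟨c, .inr rfl, hc⟩, by rwa [hU]⟩
      exact hU ▸ ih.union hG (h x c hxc) hcr
    · rw [Set.not_nonempty_iff_eq_empty] at h2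
      rw [← lowCut_compl_iff, h2]
      exact lowCut_of_subsingleton Set.subsingleton_empty

/-- If every split of a graph is crossed by a split, then the graph is prime, a clique or a star. -/
theorem prime_or_clique_or_star_of_splits_crossed [Finite V] (hG : EdgeConn G)
    (hcross : ∀ X : Set V, IsSplit G X → ∃ P, LowCut G P ∧ Crosses X P) :
    IsPrimeGraph G ∨ IsCliqueGraph G ∨ ∃ c, IsStarGraphAt G c := by
  by_cases hp : IsPrimeGraph G
  · exact .inl hp
  right
  have hex : ∃ X, IsSplit G X := by
    unfold IsPrimeGraph at hp
    push Not at hp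
    exact hp
  simp only [isSplit_iff hG] at hex hcross
  have hcard : 3 ≤ Nat.card V := by
    obtain ⟨X, h1, h2, -⟩ := hex
    rw [← Set.one_lt_ncard_iff_nontrivial] at h1 h2
    have := Set.ncard_add_ncard_compl X
    omega
  refine isClique_or_isStar_of_forall_lowCut hG hcard (forall_lowCut_of_pairs hG fun a b hab => ?_)
  exact lowCut_pair_of_splits_crossed hG (fun X h1 h2 h3 => hcross X ⟨h1, h2, h3⟩) hex hab

end CrossedSplits

/-! ### Invariance of block shapes under isomorphism. -/

section Isomorphisms

variable {V W : Type u} {G : SimpleGraph V} {H : SimpleGraph W}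

theorem exists_adj_of_cutRank_ne_zero [Finite V] {X : Set V} (h : cutRank G X Xᶜ ≠ 0) :
    ∃ x ∈ X, ∃ y ∉ X, G.Adj x y := by
  classical
  have := Fintype.ofFinite V
  by_contra! hcon
  apply h
  rw [cutRank_eq_rank]
  have h0 : (G.adjMatrix (ZMod 2)).submatrix (Subtype.val : X → V)
      (Subtype.val : (Xᶜ : Set V) → V) = 0 := by
    ext ⟨x, hx⟩ ⟨y, hy⟩
    simp [hcon x hx y hy]
  rw [h0, Matrix.rank_zero]

/-- The explicit edge stands in for connectivity, which is not at hand for the block graphs. -/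
theorem isSplit_iff_exists_adj [Finite V] {X : Set V} : IsSplit G X ↔
    X.Nontrivial ∧ Xᶜ.Nontrivial ∧ LowCut G X ∧ ∃ x ∈ X, ∃ y ∉ X, G.Adj x y := by
  refine and_congr_right fun h1 => and_congr_right fun h2 => ?_
  rw [← cutRank_le_one_iff]
  constructor
  · intro h
    exact ⟨h.le, exists_adj_of_cutRank_ne_zero (by omega)⟩
  · rintro ⟨h, x, hx, y, hy, hxy⟩
    have := cutRank_ne_zero hx hy hxy
    omega

theorem IsPrimeGraph.of_iso [Finite V] (e : H ≃g G) (h : IsPrimeGraph H) : IsPrimeGraph G := by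
  have : Finite W := Finite.of_equiv V e.symm.toEquiv
  intro X hX
  apply h (e ⁻¹' X)
  rw [isSplit_iff_exists_adj] at hX ⊢
  obtain ⟨h1, h2, h3, x, hx, y, hy, hxy⟩ := hX
  refine ⟨h1.preimage e.surjective, h2.preimage e.surjective, lowCut_comap e h3,
    e.symm x, by simpa using hx, e.symm y, by simpa using hy, e.symm.map_adj_iff.2 hxy⟩

theorem IsCliqueGraph.of_iso (e : H ≃g G) (h : IsCliqueGraph H) : IsCliqueGraph G := by
  refine ⟨Nat.card_congr e.toEquiv ▸ h.1, ?_⟩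
  ext x y
  refine e.symm.map_adj_iff.symm.trans ?_
  simp [h.2]

theorem IsStarGraphAt.of_iso (e : H ≃g G) {c : W} (h : IsStarGraphAt H c) :
    IsStarGraphAt G (e c) := by
  refine ⟨Nat.card_congr e.toEquiv ▸ h.1, ?_⟩
  ext x y
  refine e.symm.map_adj_iff.symm.trans ?_
  simp [h.2, SimpleGraph.starGraph_adj, RelIso.symm_apply_eq]

/-- The shapes of the blocks of a canonical decomposition. -/
def IsBlockShape (G : SimpleGraph V) : Prop :=
  IsPrimeGraph G ∨ IsCliqueGraph G ∨ ∃ c, IsStarGraphAt G c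

theorem IsBlockShape.of_iso [Finite V] (e : H ≃g G) (h : IsBlockShape H) : IsBlockShape G := by
  rcases h with h | h | ⟨c, h⟩
  · exact .inl (h.of_iso e)
  · exact .inr (.inl (h.of_iso e))
  · exact .inr (.inr ⟨_, h.of_iso e⟩)

end Isomorphisms

/-! ### The canonical conditions in terms of the kinds of the markers. -/

namespace Decomposition

variable {V : Type u} {G : SimpleGraph V}

theorem finite_vertex {V : Type u} {G : SimpleGraph V} (D : Decomposition G) :
    Finite V → Finite D.Vertex := by
  induction D with
  | single G => exact id
  | split X hX D₁ D₂ ih₁ ih₂ =>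
    intro hV
    have := ih₁ inferInstance
    have := ih₂ inferInstance
    exact inferInstanceAs (Finite (D₁.Vertex ⊕ D₂.Vertex))

/-- The block of a decomposition with one block is the graph itself. -/
def singleIso (G : SimpleGraph V) : (single G).blockGraph () ≃g G where
  toFun := Subtype.val
  invFun v := ⟨v, rfl⟩
  left_inv _ := rfl
  right_inv _ := rfl
  map_rel_iff' := Iff.rfl

section Split

variable {X : Set V} {hX : IsSplit G X} {D₁ : Decomposition (markerGraph G X)}
  {D₂ : Decomposition (markerGraph G Xᶜ)}

/-- The blocks of the first part of a split are blocks of the decomposition. -/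
def inlIso (b : D₁.Block) :
    D₁.blockGraph b ≃g (split X hX D₁ D₂).blockGraph (Sum.inl b) where
  toFun w := ⟨Sum.inl w.1, congrArg Sum.inl w.2⟩
  invFun w := match w with
    | ⟨Sum.inl w, h⟩ => ⟨w, Sum.inl_injective h⟩
    | ⟨Sum.inr _, h⟩ => (Sum.inr_ne_inl h).elim
  left_inv _ := rfl
  right_inv w := match w with
    | ⟨Sum.inl _, _⟩ => rfl
    | ⟨Sum.inr _, h⟩ => (Sum.inr_ne_inl h).elim
  map_rel_iff' := Iff.rfl

/-- The blocks of the second part of a split are blocks of the decomposition. -/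
def inrIso (b : D₂.Block) :
    D₂.blockGraph b ≃g (split X hX D₁ D₂).blockGraph (Sum.inr b) where
  toFun w := ⟨Sum.inr w.1, congrArg Sum.inr w.2⟩
  invFun w := match w with
    | ⟨Sum.inr w, h⟩ => ⟨w, Sum.inr_injective h⟩
    | ⟨Sum.inl _, h⟩ => (Sum.inl_ne_inr h).elim
  left_inv _ := rfl
  right_inv w := match w with
    | ⟨Sum.inr _, _⟩ => rfl
    | ⟨Sum.inl _, h⟩ => (Sum.inl_ne_inr h).elim
  map_rel_iff' := Iff.rfl

theorem incl_split_mem {v : V} (h : v ∈ X) :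
    (split X hX D₁ D₂).incl v = (Sum.inl (D₁.incl (some ⟨v, h⟩)) : D₁.Vertex ⊕ D₂.Vertex) :=
  dif_pos h

theorem incl_split_notMem {v : V} (h : v ∉ X) :
    (split X hX D₁ D₂).incl v = (Sum.inr (D₂.incl (some ⟨v, h⟩)) : D₁.Vertex ⊕ D₂.Vertex) :=
  dif_neg h

end Split

/-- The block of `w` is a clique block. -/
def CliqueAt (D : Decomposition G) (w : D.Vertex) : Prop :=
  IsCliqueGraph (D.blockGraph (D.blockOf w))

/-- The block of `w` is a star block with centre `w`. -/
def CentreAt (D : Decomposition G) (w : D.Vertex) : Prop :=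
  IsStarGraphAt (D.blockGraph (D.blockOf w)) ⟨w, rfl⟩

/-- The block of `w` is a star block and `w` is not its centre. -/
def LeafAt (D : Decomposition G) (w : D.Vertex) : Prop :=
  ∃ c, c.val ≠ w ∧ IsStarGraphAt (D.blockGraph (D.blockOf w)) c

theorem cliqueAt_single {v : V} : (single G).CliqueAt v ↔ IsCliqueGraph G :=
  ⟨fun h => h.of_iso (singleIso G), fun h => h.of_iso (singleIso G).symm⟩

theorem centreAt_single {v : V} : (single G).CentreAt v ↔ IsStarGraphAt G v :=
  ⟨fun h => h.of_iso (singleIso G), fun h => h.of_iso (singleIso G).symm⟩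

theorem leafAt_single {v : V} : (single G).LeafAt v ↔ ∃ c ≠ v, IsStarGraphAt G c :=
  ⟨fun ⟨c, hc, h⟩ => ⟨c.1, hc, h.of_iso (singleIso G)⟩,
    fun ⟨c, hc, h⟩ => ⟨⟨c, rfl⟩, hc, h.of_iso (singleIso G).symm⟩⟩

section Split

variable {X : Set V} {hX : IsSplit G X} {D₁ : Decomposition (markerGraph G X)}
  {D₂ : Decomposition (markerGraph G Xᶜ)}

theorem cliqueAt_inl {w : D₁.Vertex} :
    (split X hX D₁ D₂).CliqueAt (Sum.inl w : D₁.Vertex ⊕ D₂.Vertex) ↔ D₁.CliqueAt w :=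
  ⟨fun h => h.of_iso (inlIso _).symm, fun h => h.of_iso (inlIso _)⟩

theorem cliqueAt_inr {w : D₂.Vertex} :
    (split X hX D₁ D₂).CliqueAt (Sum.inr w : D₁.Vertex ⊕ D₂.Vertex) ↔ D₂.CliqueAt w :=
  ⟨fun h => h.of_iso (inrIso _).symm, fun h => h.of_iso (inrIso _)⟩

theorem centreAt_inl {w : D₁.Vertex} :
    (split X hX D₁ D₂).CentreAt (Sum.inl w : D₁.Vertex ⊕ D₂.Vertex) ↔ D₁.CentreAt w :=
  ⟨fun h => h.of_iso (inlIso _).symm, fun h => h.of_iso (inlIso (D₁.blockOf w))⟩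

theorem centreAt_inr {w : D₂.Vertex} :
    (split X hX D₁ D₂).CentreAt (Sum.inr w : D₁.Vertex ⊕ D₂.Vertex) ↔ D₂.CentreAt w :=
  ⟨fun h => h.of_iso (inrIso _).symm, fun h => h.of_iso (inrIso (D₂.blockOf w))⟩

theorem leafAt_inl {w : D₁.Vertex} :
    (split X hX D₁ D₂).LeafAt (Sum.inl w : D₁.Vertex ⊕ D₂.Vertex) ↔ D₁.LeafAt w := by
  constructor
  · rintro ⟨⟨c | c, hcw⟩, hc, h⟩
    · exact ⟨⟨c, Sum.inl_injective (β := D₂.Block) hcw⟩, fun e => hc (congrArg Sum.inl e),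
        h.of_iso (inlIso _).symm⟩
    · exact (Sum.inr_ne_inl hcw).elim
  · rintro ⟨c, hc, h⟩
    exact ⟨⟨Sum.inl c.1, congrArg Sum.inl c.2⟩, fun e => hc (Sum.inl_injective e), h.of_iso (inlIso _)⟩

theorem leafAt_inr {w : D₂.Vertex} :
    (split X hX D₁ D₂).LeafAt (Sum.inr w : D₁.Vertex ⊕ D₂.Vertex) ↔ D₂.LeafAt w := by
  constructor
  · rintro ⟨⟨c | c, hcw⟩, hc, h⟩
    · exact (Sum.inl_ne_inr hcw).elim
    · exact ⟨⟨c, Sum.inr_injective (α := D₁.Block) hcw⟩, fun e => hc (congrArg Sum.inr e),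
        h.of_iso (inrIso _).symm⟩
  · rintro ⟨c, hc, h⟩
    exact ⟨⟨Sum.inr c.1, congrArg Sum.inr c.2⟩, fun e => hc (Sum.inr_injective e), h.of_iso (inrIso _)⟩

theorem marked_inl_inl {w w' : D₁.Vertex} :
    (split X hX D₁ D₂).marked.Adj (Sum.inl w : D₁.Vertex ⊕ D₂.Vertex)
      (Sum.inl w' : D₁.Vertex ⊕ D₂.Vertex) ↔ D₁.marked.Adj w w' := by
  change (SimpleGraph.sum D₁.marked D₂.marked ⊔ SimpleGraph.edge _ _).Adj _ _ ↔ _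
  simp [SimpleGraph.edge_adj]

theorem marked_inr_inr {w w' : D₂.Vertex} :
    (split X hX D₁ D₂).marked.Adj (Sum.inr w : D₁.Vertex ⊕ D₂.Vertex)
      (Sum.inr w' : D₁.Vertex ⊕ D₂.Vertex) ↔ D₂.marked.Adj w w' := by
  change (SimpleGraph.sum D₁.marked D₂.marked ⊔ SimpleGraph.edge _ _).Adj _ _ ↔ _
  simp [SimpleGraph.edge_adj]

theorem marked_inl_inr {w : D₁.Vertex} {w' : D₂.Vertex} :
    (split X hX D₁ D₂).marked.Adj (Sum.inl w : D₁.Vertex ⊕ D₂.Vertex)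
      (Sum.inr w' : D₁.Vertex ⊕ D₂.Vertex) ↔ w = D₁.incl none ∧ w' = D₂.incl none := by
  change (SimpleGraph.sum D₁.marked D₂.marked ⊔ SimpleGraph.edge _ _).Adj _ _ ↔ _
  simp [SimpleGraph.edge_adj]

end Split

/-- Marked edges can be read in both directions, so condition (iii) amounts to the exclusion of a
centre joined to a leaf. -/
theorem isCanonical_iff {D : Decomposition G} : D.IsCanonical ↔
    (∀ b, IsBlockShape (D.blockGraph b)) ∧ ∀ h k, D.marked.Adj h k →
      ¬ (D.CliqueAt h ∧ D.CliqueAt k) ∧ ¬ (D.CentreAt h ∧ D.LeafAt k) := by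
  constructor
  · rintro ⟨h1, h2, h3⟩
    refine ⟨h1, fun h k hk => ⟨h2 h k hk, ?_⟩⟩
    rintro ⟨hc, c', hc', hk'⟩
    exact hc' ((h3 h k hk _ c' hc hk').1 rfl).symm
  · rintro ⟨h1, h2⟩
    refine ⟨h1, fun h k hk => (h2 h k hk).1, ?_⟩
    have key : ∀ h k, D.marked.Adj h k → ∀ c c', IsStarGraphAt (D.blockGraph (D.blockOf h)) c →
        IsStarGraphAt (D.blockGraph (D.blockOf k)) c' → h = c.val → k = c'.val := by
      intro h k hk c c' hc hc' e
      by_contra hne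
      have hcc : c = ⟨h, rfl⟩ := Subtype.ext e.symm
      subst hcc
      exact (h2 h k hk).2 ⟨hc, c', fun e => hne e.symm, hc'⟩
    exact fun h k hk c c' hc hc' => ⟨key h k hk c c' hc hc', key k h hk.symm c' c hc' hc⟩

theorem blockShape_split_iff [Finite V] {X : Set V} {hX : IsSplit G X}
    {D₁ : Decomposition (markerGraph G X)} {D₂ : Decomposition (markerGraph G Xᶜ)} :
    (∀ b, IsBlockShape ((split X hX D₁ D₂).blockGraph b)) ↔
      (∀ b, IsBlockShape (D₁.blockGraph b)) ∧ ∀ b, IsBlockShape (D₂.blockGraph b) := by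
  have := (split X hX D₁ D₂).finite_vertex inferInstance
  have := D₁.finite_vertex inferInstance
  have := D₂.finite_vertex inferInstance
  constructor
  · intro h
    exact ⟨fun b => (h (Sum.inl b)).of_iso (inlIso b).symm,
      fun b => (h (Sum.inr b)).of_iso (inrIso b).symm⟩
  · rintro ⟨h1, h2⟩ (b | b)
    · exact (h1 b).of_iso (inlIso b)
    · exact (h2 b).of_iso (inrIso b)

/-- Only the new marked edge adds conditions to those of the two parts; this is the form used in all
inductions. -/
theorem isCanonical_split_iff [Finite V] {X : Set V} {hX : IsSplit G X}
    {D₁ : Decomposition (markerGraph G X)} {D₂ : Decomposition (markerGraph G Xᶜ)} :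
    (split X hX D₁ D₂).IsCanonical ↔ D₁.IsCanonical ∧ D₂.IsCanonical ∧
      ¬ (D₁.CliqueAt (D₁.incl none) ∧ D₂.CliqueAt (D₂.incl none)) ∧
      ¬ (D₁.CentreAt (D₁.incl none) ∧ D₂.LeafAt (D₂.incl none)) ∧
      ¬ (D₂.CentreAt (D₂.incl none) ∧ D₁.LeafAt (D₁.incl none)) := by
  rw [isCanonical_iff, isCanonical_iff, isCanonical_iff, blockShape_split_iff]
  constructor
  · rintro ⟨⟨h1, h2⟩, h3⟩
    refine ⟨⟨h1, fun h k hk => ?_⟩, ⟨h2, fun h k hk => ?_⟩, ?_⟩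
    · have := h3 (Sum.inl h) (Sum.inl k) (marked_inl_inl.2 hk)
      rwa [cliqueAt_inl, cliqueAt_inl, centreAt_inl, leafAt_inl] at this
    · have := h3 (Sum.inr h) (Sum.inr k) (marked_inr_inr.2 hk)
      rwa [cliqueAt_inr, cliqueAt_inr, centreAt_inr, leafAt_inr] at this
    · have hm := (marked_inl_inr (hX := hX) (D₁ := D₁) (D₂ := D₂)).2 ⟨rfl, rfl⟩
      have e1 := h3 _ _ hm
      have e2 := h3 _ _ hm.symm
      rw [cliqueAt_inl, cliqueAt_inr, centreAt_inl, leafAt_inr] at e1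
      rw [cliqueAt_inl, cliqueAt_inr, centreAt_inr, leafAt_inl] at e2
      exact ⟨e1.1, e1.2, e2.2⟩
  · rintro ⟨⟨h1, h1'⟩, ⟨h2, h2'⟩, h3, h4, h5⟩
    refine ⟨⟨h1, h2⟩, ?_⟩
    rintro (h | h) (k | k) hk
    · rw [cliqueAt_inl, cliqueAt_inl, centreAt_inl, leafAt_inl]
      exact h1' h k (marked_inl_inl.1 hk)
    · obtain ⟨rfl, rfl⟩ := marked_inl_inr.1 hk
      rw [cliqueAt_inl, cliqueAt_inr, centreAt_inl, leafAt_inr]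
      exact ⟨h3, h4⟩
    · obtain ⟨rfl, rfl⟩ := marked_inl_inr.1 hk.symm
      rw [cliqueAt_inl, cliqueAt_inr, centreAt_inr, leafAt_inl]
      exact ⟨fun h => h3 h.symm, h5⟩
    · rw [cliqueAt_inr, cliqueAt_inr, centreAt_inr, leafAt_inr]
      exact h2' h k (marked_inr_inr.1 hk)

theorem isCanonical_single_iff [Finite V] : (single G).IsCanonical ↔ IsBlockShape G := by
  rw [isCanonical_iff]
  have : Finite (single G).Vertex := ‹Finite V›
  constructor
  · rintro ⟨h, -⟩
    exact (h ()).of_iso (singleIso G)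
  · intro h
    refine ⟨fun b => h.of_iso (singleIso G).symm, fun h k hk => ?_⟩
    exact (show False from hk).elim

end Decomposition

/-! ### Marker partitions and the corners of crossing cuts. -/

section MarkerPartitions

variable {V : Type u} {G : SimpleGraph V}

/-- Some edge joins a vertex of `A` to a vertex of `B`. -/
def EdgeBetween (G : SimpleGraph V) (A B : Set V) : Prop :=
  ∃ a ∈ A, ∃ b ∈ B, G.Adj a b

theorem EdgeBetween.symm {A B : Set V} : EdgeBetween G A B → EdgeBetween G B A :=
  fun ⟨a, ha, b, hb, h⟩ => ⟨b, hb, a, ha, h.symm⟩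

theorem edgeBetween_markerGraph_iff {X : Set V} {P Q : Set (Option X)} (h : Disjoint P Q) :
    EdgeBetween (markerGraph G X) P Q ↔
      EdgeBetween G (markerProj X ⁻¹' P) (markerProj X ⁻¹' Q) :=
  exists_markerGraph_adj_iff h

theorem markerProj_preimage_none {X : Set V} : markerProj X ⁻¹' {none} = Xᶜ := by
  ext v
  by_cases hv : v ∈ X
  · simp [markerProj_mem hv, hv]
  · simp [markerProj_notMem hv, hv]

theorem markerProj_preimage_some {X : Set V} {m : V} (hm : m ∈ X) :
    markerProj X ⁻¹' {some ⟨m, hm⟩} = {m} := by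
  ext v
  by_cases hv : v ∈ X
  · simp [markerProj_mem hv]
  · simp only [Set.mem_preimage, markerProj_notMem hv, Set.mem_singleton_iff, reduceCtorEq,
      false_iff]
    rintro rfl
    exact hv hm

theorem markerProj_preimage_image {X A : Set V} (h : A ⊆ X ∨ Xᶜ ⊆ A) :
    markerProj X ⁻¹' (markerProj X '' A) = A := by
  refine Set.Subset.antisymm ?_ (Set.subset_preimage_image _ _)
  rintro v ⟨a, ha, hav⟩
  by_cases hv : v ∈ X
  · rw [markerProj_mem hv] at hav
    by_cases haX : a ∈ X
    · rw [markerProj_mem haX] at hav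
      obtain rfl : a = v := by simpa using hav
      exact ha
    · rw [markerProj_notMem haX] at hav
      cases hav
  · rcases h with h | h
    · rw [markerProj_notMem hv, markerProj_mem (h ha)] at hav
      cases hav
    · exact h hv

/-- A partition of the vertices into `m` and two sets whose cuts have rank one. -/
structure MarkerPartition (G : SimpleGraph V) (m : V) (R S : Set V) : Prop where
  left_nonempty : R.Nonempty
  right_nonempty : S.Nonempty
  disjoint : Disjoint R S
  notMem_left : m ∉ R
  notMem_right : m ∉ S
  cover : ∀ v, v = m ∨ v ∈ R ∨ v ∈ S
  left_low : LowCut G R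
  right_low : LowCut G S

theorem MarkerPartition.symm {m : V} {R S : Set V} (h : MarkerPartition G m R S) :
    MarkerPartition G m S R :=
  ⟨h.2, h.1, h.3.symm, h.5, h.4, fun v => by have := h.6 v; tauto, h.8, h.7⟩

theorem markerPartition_markerGraph_iff {X : Set V} (hX : LowCut G X) (hXc : Xᶜ.Nonempty) {m : V}
    (hm : m ∈ X) {R S : Set (Option X)} :
    MarkerPartition (markerGraph G X) (some ⟨m, hm⟩) R S ↔
      MarkerPartition G m (markerProj X ⁻¹' R) (markerProj X ⁻¹' S) := by
  have hs := markerProj_surjective hXc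
  constructor
  · rintro ⟨h1, h2, h3, h4, h5, h6, h7, h8⟩
    refine ⟨h1.preimage hs, h2.preimage hs, h3.preimage _, ?_, ?_, fun v => ?_,
      (lowCut_markerGraph_iff hX).1 h7, (lowCut_markerGraph_iff hX).1 h8⟩
    · rwa [Set.mem_preimage, markerProj_mem hm]
    · rwa [Set.mem_preimage, markerProj_mem hm]
    · refine (h6 (markerProj X v)).imp_left fun h => ?_
      have : v ∈ markerProj X ⁻¹' {some ⟨m, hm⟩} := h
      rwa [markerProj_preimage_some] at this
  · rintro ⟨⟨a, ha⟩, ⟨b, hb⟩, h3, h4, h5, h6, h7, h8⟩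
    rw [Set.mem_preimage, markerProj_mem hm] at h4 h5
    refine ⟨⟨_, ha⟩, ⟨_, hb⟩, ?_, h4, h5, fun v => ?_,
      (lowCut_markerGraph_iff hX).2 h7, (lowCut_markerGraph_iff hX).2 h8⟩
    · rw [Set.disjoint_left] at h3 ⊢
      intro a ha hb
      obtain ⟨v, rfl⟩ := hs a
      exact h3 ha hb
    · obtain ⟨v, rfl⟩ := hs v
      refine (h6 v).imp_left ?_
      rintro rfl
      exact markerProj_mem hm

/-- The two corners inside `X` are low and survive in the marker graph, where only the marker is
left over. -/
theorem Crosses.markerPartition (hG : EdgeConn G) {X P : Set V} (hX : LowCut G X)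
    (hP : LowCut G P) (hc : Crosses X P) : MarkerPartition (markerGraph G X) none
      (markerProj X '' (X ∩ P)) (markerProj X '' (X \ P)) := by
  have hs := markerProj_surjective (X := X) (let ⟨_, _, ⟨d, hd⟩, _⟩ := hc; ⟨d, hd.2⟩)
  have e1 : markerProj X ⁻¹' (markerProj X '' (X ∩ P)) = X ∩ P :=
    markerProj_preimage_image (.inl Set.inter_subset_left)
  have e2 : markerProj X ⁻¹' (markerProj X '' (X \ P)) = X \ P :=
    markerProj_preimage_image (.inl Set.sdiff_subset)
  refine ⟨hc.1.image _, hc.2.1.image _, ?_, ?_, ?_, ?_, ?_, ?_⟩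
  · rw [Set.disjoint_left]
    intro a ha hb
    obtain ⟨v, rfl⟩ := hs a
    have h1 : v ∈ X ∩ P := e1 ▸ (show v ∈ markerProj X ⁻¹' _ from ha)
    have h2 : v ∈ X \ P := e2 ▸ (show v ∈ markerProj X ⁻¹' _ from hb)
    exact h2.2 h1.2
  · rintro ⟨a, ha, h⟩
    rw [markerProj_mem ha.1] at h
    cases h
  · rintro ⟨a, ha, h⟩
    rw [markerProj_mem ha.1] at h
    cases h
  · rintro (_ | x)
    · exact .inl rfl
    · right
      by_cases hx : (x : V) ∈ P
      · exact .inl ⟨x, ⟨x.2, hx⟩, markerProj_coe x⟩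
      · exact .inr ⟨x, ⟨x.2, hx⟩, markerProj_coe x⟩
  · rw [lowCut_markerGraph_iff hX, e1]
    exact hX.inter hG hP hc
  · rw [lowCut_markerGraph_iff hX, e2]
    exact hX.diff hG hP hc

/-- If two low cuts cross, the four corners form a star or a clique. -/
theorem Crosses.not_edgeBetween (hG : EdgeConn G) {X P : Set V} (hX : LowCut G X)
    (hP : LowCut G P) (hc : Crosses X P) (h : ¬ EdgeBetween G (X ∩ P) (X \ P)) :
    ¬ EdgeBetween G (P \ X) X ∨ ¬ EdgeBetween G (X ∪ P)ᶜ X := by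
  by_contra! hcon
  obtain ⟨⟨a₃, ha₃, x, hx, hxa⟩, a₄, ha₄, x', hx', hxa'⟩ := hcon
  obtain ⟨c1, c2, -, ⟨c4, hc4⟩⟩ := hc
  have hc4' : c4 ∉ X := fun h => hc4 (.inl h)
  have ha₄X : a₄ ∉ X := fun h => ha₄ (.inl h)
  have ha₄P : a₄ ∉ P := fun h => ha₄ (.inr h)
  -- With no edge between the two corners inside `X`, connectivity gives each of them an edge
  -- leaving `X`. The cut of `X` redirects these to `a₄` and `a₃`, and the cut of `P` then joins the
  -- two corners after all.
  have out : ∀ {A B : Set V}, A ∪ B = X → A.Nonempty → ¬ EdgeBetween G A B →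
      ∃ u ∈ A, ∃ w ∉ X, G.Adj u w := by
    intro A B hAB hA hE
    obtain ⟨u, hu, w, hw, huw⟩ := hG A hA ⟨c4, fun h => hc4' (hAB ▸ .inl h)⟩
    refine ⟨u, hu, w, fun hwX => ?_, huw⟩
    rw [← hAB] at hwX
    exact hwX.elim hw (fun h => hE ⟨u, hu, w, h, huw⟩)
  obtain ⟨u, hu, w, hw, huw⟩ := out (Set.inter_union_sdiff X P) c1 h
  obtain ⟨v, hv, z, hz, hvz⟩ := out (Set.sdiff_union_inter X P) c2 (fun h' => h h'.symm)
  have h1 : G.Adj u a₄ := hX hu.1 hx' hw ha₄X huw hxa'.symm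
  have h2 : G.Adj v a₃ := hX hv.1 hx hz ha₃.2 hvz hxa.symm
  exact h ⟨u, hu, v, hv, hP hu.2 ha₃.1 ha₄P hv.2 h1 h2.symm⟩

/-- Both given edges cross the cut of `P`; completing their rectangle gives edges that cross `X`. -/
theorem Crosses.edgeBetween {X P : Set V} (hP : LowCut G P)
    (h : EdgeBetween G (X ∩ P) (X \ P)) (h' : EdgeBetween G (P \ X) (X ∪ P)ᶜ) :
    EdgeBetween G (X ∩ P) (X ∪ P)ᶜ ∧ EdgeBetween G (P \ X) (X \ P) := by
  obtain ⟨a, ha, b, hb, hab⟩ := h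
  obtain ⟨c, hc, d, hd, hcd⟩ := h'
  have hdP : d ∉ P := fun h => hd (.inr h)
  exact ⟨⟨a, ha, d, hd, hP ha.2 hc.1 hb.2 hdP hab hcd⟩,
    ⟨c, hc, b, hb, hP hc.1 ha.2 hdP hb.2 hcd hab⟩⟩

/-- In a prime graph `R` and `S` are singletons, since otherwise one of them is a split. Three
vertices remain, and every cut has a side with at most one element. -/
theorem IsBlockShape.clique_or_star [Finite V] (hG : EdgeConn G) (h : IsBlockShape G) {m : V}
    {R S : Set V} (hp : MarkerPartition G m R S) :
    IsCliqueGraph G ∨ ∃ c, IsStarGraphAt G c := by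
  rcases h with h | h
  swap
  · exact h
  obtain ⟨r, hr⟩ := hp.left_nonempty
  obtain ⟨s, hs⟩ := hp.right_nonempty
  have small : ∀ {R S : Set V}, MarkerPartition G m R S → R.Subsingleton := by
    intro R S hp
    rw [← Set.not_nontrivial_iff]
    intro hR
    obtain ⟨s, hs⟩ := hp.right_nonempty
    refine h R ((isSplit_iff hG).2 ⟨hR, ⟨m, hp.notMem_left, s, ?_, ?_⟩, hp.left_low⟩)
    · exact fun h => Set.disjoint_left.1 hp.disjoint h hs
    · rintro rfl
      exact hp.notMem_right hs
  have hR := small hp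
  have hS := small hp.symm
  have hmr : m ≠ r := fun e => hp.notMem_left (e ▸ hr)
  have hms : m ≠ s := fun e => hp.notMem_right (e ▸ hs)
  have hrs : r ≠ s := fun e => Set.disjoint_left.1 hp.disjoint hr (e ▸ hs)
  have huniv : (Set.univ : Set V) = {m, r, s} := by
    refine (Set.eq_univ_of_forall fun v => ?_).symm
    rcases hp.cover v with rfl | hv | hv
    · exact .inl rfl
    · exact .inr (.inl (hR hv hr))
    · exact .inr (.inr (hS hv hs))
  have hcard : Nat.card V = 3 := by
    rw [← Set.ncard_univ, huniv]
    exact Set.ncard_eq_three.2 ⟨m, r, s, hmr, hms, hrs, rfl⟩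
  refine isClique_or_isStar_of_forall_lowCut hG hcard.ge fun X => ?_
  have := Set.ncard_add_ncard_compl X
  by_cases hX : X.ncard ≤ 1
  · exact lowCut_of_subsingleton (Set.ncard_le_one_iff_subsingleton.1 hX)
  · rw [← lowCut_compl_iff]
    exact lowCut_of_subsingleton (Set.ncard_le_one_iff_subsingleton.1 (by omega))

end MarkerPartitions

/-! ### Splits of canonical decompositions are uncrossed. -/

namespace Decomposition

variable {V : Type u} {G : SimpleGraph V}

/-- The kind of the block of `w` is determined by the edges between the parts of a marker
partition. -/
structure KindsMatch (D : Decomposition G) (w : D.Vertex) (rs rm sm : Prop) : Prop where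
  centre : ¬ rs → D.CentreAt w
  leaf_left : ¬ rm → D.LeafAt w
  leaf_right : ¬ sm → D.LeafAt w
  clique : rs → rm → sm → D.CliqueAt w

/-- Marker partitions determine the kinds of the blocks of `D`. -/
def PartitionsDetermineKinds (D : Decomposition G) : Prop :=
  ∀ (m : V) (R S : Set V), MarkerPartition G m R S → D.KindsMatch (D.incl m)
    (EdgeBetween G R S) (EdgeBetween G R {m}) (EdgeBetween G S {m})

/-- In a star the part that contains the centre is joined to the two others, so a missing pair of
parts locates the centre. In a clique no pair is missing. -/
theorem partitionsDetermineKinds_single [Finite V] (hG : EdgeConn G) (h : IsBlockShape G) :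
    (single G).PartitionsDetermineKinds := by
  intro m R S hp
  have hrs : ∀ {r s}, r ∈ R → s ∈ S → r ≠ s := by
    rintro r s hr hs rfl
    exact Set.disjoint_left.1 hp.disjoint hr hs
  have hrm : ∀ {r}, r ∈ R → r ≠ m := by
    rintro r hr rfl
    exact hp.notMem_left hr
  have hsm : ∀ {s}, s ∈ S → s ≠ m := by
    rintro r hr rfl
    exact hp.notMem_right hr
  obtain ⟨r, hr⟩ := hp.left_nonempty
  obtain ⟨s, hs⟩ := hp.right_nonempty
  change (single G).KindsMatch m _ _ _
  rcases h.clique_or_star hG hp with hcl | ⟨c, hst⟩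
  · have hadj : ∀ {a b}, a ≠ b → G.Adj a b := by
      intro a b hab
      rw [hcl.2]
      exact hab
    refine ⟨fun h => ?_, fun h => ?_, fun h => ?_, fun _ _ _ => cliqueAt_single.2 hcl⟩
    · exact (h ⟨r, hr, s, hs, hadj (hrs hr hs)⟩).elim
    · exact (h ⟨r, hr, m, rfl, hadj (hrm hr)⟩).elim
    · exact (h ⟨s, hs, m, rfl, hadj (hsm hs)⟩).elim
  · have hadj : ∀ {a b}, G.Adj a b ↔ a ≠ b ∧ (a = c ∨ b = c) := by
      intro a b
      rw [hst.2, SimpleGraph.starGraph_adj]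
    refine ⟨fun h => ?_, fun h => ?_, fun h => ?_, ?_⟩
    · rw [centreAt_single]
      rcases hp.cover c with rfl | hc | hc
      · exact hst
      · exact (h ⟨c, hc, s, hs, hadj.2 ⟨hrs hc hs, .inl rfl⟩⟩).elim
      · exact (h ⟨r, hr, c, hc, hadj.2 ⟨hrs hr hc, .inr rfl⟩⟩).elim
    · refine leafAt_single.2 ⟨c, ?_, hst⟩
      rintro rfl
      exact h ⟨r, hr, c, rfl, hadj.2 ⟨hrm hr, .inr rfl⟩⟩
    · refine leafAt_single.2 ⟨c, ?_, hst⟩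
      rintro rfl
      exact h ⟨s, hs, c, rfl, hadj.2 ⟨hsm hs, .inr rfl⟩⟩
    · rintro ⟨a, ha, b, hb, hab⟩ ⟨a', ha', _, rfl, ham⟩ ⟨b', hb', _, rfl, hbm⟩
      rw [hadj] at hab ham hbm
      have h1 : c ∈ R ∨ c ∈ S := by
        rcases hab.2 with rfl | rfl
        · exact .inl ha
        · exact .inr hb
      rcases h1 with h1 | h1
      · rcases hbm.2 with rfl | rfl
        · exact (hrs h1 hb' rfl).elim
        · exact (hrm h1 rfl).elim
      · rcases ham.2 with rfl | rfl
        · exact (hrs ha' h1 rfl).elim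
        · exact (hsm h1 rfl).elim

/-- No low cut crosses a split of a canonical decomposition. -/
theorem not_crosses_of_partitionsDetermineKinds (hG : EdgeConn G) {X P : Set V}
    {D₁ : Decomposition (markerGraph G X)} {D₂ : Decomposition (markerGraph G Xᶜ)}
    (hX : LowCut G X) (h₁ : D₁.PartitionsDetermineKinds) (h₂ : D₂.PartitionsDetermineKinds)
    (hcl : ¬ (D₁.CliqueAt (D₁.incl none) ∧ D₂.CliqueAt (D₂.incl none)))
    (hcs : ¬ (D₁.CentreAt (D₁.incl none) ∧ D₂.LeafAt (D₂.incl none)))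
    (hsc : ¬ (D₂.CentreAt (D₂.incl none) ∧ D₁.LeafAt (D₁.incl none)))
    (hP : LowCut G P) : ¬ Crosses X P := by
  intro hc
  have transfer : ∀ {Z : Set V} {D : Decomposition (markerGraph G Z)}, LowCut G Z →
      Crosses Z P → D.PartitionsDetermineKinds → D.KindsMatch (D.incl none)
        (EdgeBetween G (Z ∩ P) (Z \ P)) (EdgeBetween G (Z ∩ P) Zᶜ)
        (EdgeBetween G (Z \ P) Zᶜ) := by
    intro Z D hZ hc hD
    have hp := hc.markerPartition hG hZ hP
    have := hD _ _ _ hp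
    rwa [edgeBetween_markerGraph_iff hp.disjoint,
      edgeBetween_markerGraph_iff (Set.disjoint_singleton_right.2 hp.notMem_left),
      edgeBetween_markerGraph_iff (Set.disjoint_singleton_right.2 hp.notMem_right),
      markerProj_preimage_none, markerProj_preimage_image (.inl Set.inter_subset_left),
      markerProj_preimage_image (.inl Set.sdiff_subset)] at this
  have k₁ := transfer hX hc h₁
  have k₂ := transfer hX.compl hc.compl_left h₂
  have e3 : Xᶜ ∩ P = P \ X := by ext; simp [and_comm]
  have e4 : Xᶜ \ P = (X ∪ P)ᶜ := by ext; simp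
  rw [compl_compl, e3, e4] at k₂
  -- If the corners are joined on both sides of `X`, both markers lie in clique blocks. If they are
  -- not joined on one side, the marker there is a centre and the opposite marker is a leaf.
  by_cases h12 : EdgeBetween G (X ∩ P) (X \ P)
  · by_cases h34 : EdgeBetween G (P \ X) (X ∪ P)ᶜ
    · obtain ⟨⟨a, ha, d, hd, had⟩, c, hc, b, hb, hcb⟩ := Crosses.edgeBetween hP h12 h34
      have hdX : d ∉ X := fun h => hd (.inl h)
      exact hcl ⟨k₁.clique h12 ⟨a, ha, d, hdX, had⟩ ⟨b, hb, c, hc.2, hcb.symm⟩,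
        k₂.clique h34 ⟨c, hc, b, hb.1, hcb⟩ ⟨d, hd, a, ha.1, had.symm⟩⟩
    · have h := hc.compl_left.not_edgeBetween hG hX.compl hP (by rwa [e3, e4])
      have e1 : P \ Xᶜ = X ∩ P := by ext; simp [and_comm]
      have e2 : (Xᶜ ∪ P)ᶜ = X \ P := by ext; simp
      rw [e1, e2] at h
      exact hsc ⟨k₂.centre h34, h.elim k₁.leaf_left k₁.leaf_right⟩
  · have h := hc.not_edgeBetween hG hX hP h12
    exact hcs ⟨k₁.centre h12, h.elim k₂.leaf_left k₂.leaf_right⟩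

/-- If both `R` and `S` met the complement of `Z`, then one of them would cross `Z`, by an element
of `Z` other than `m`. So the complement lies in one part and the partition descends to the marker
graph. -/
theorem kindsMatch_of_markerPartition {Z : Set V} (hZ : LowCut G Z) (hZ' : Z.Nontrivial)
    (hZc : Zᶜ.Nonempty) {D : Decomposition (markerGraph G Z)} (hD : D.PartitionsDetermineKinds)
    (hcross : ∀ P, LowCut G P → ¬ Crosses Z P) {m : V} (hm : m ∈ Z) {R S : Set V}
    (hp : MarkerPartition G m R S) : D.KindsMatch (D.incl (some ⟨m, hm⟩))
      (EdgeBetween G R S) (EdgeBetween G R {m}) (EdgeBetween G S {m}) := by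
  have hdis := Set.disjoint_left.1 hp.disjoint
  have hside : Zᶜ ⊆ R ∨ Zᶜ ⊆ S := by
    by_contra! hcon
    obtain ⟨⟨y, hy, hyR⟩, y', hy', hyS⟩ : (∃ y ∈ Zᶜ, y ∉ R) ∧ ∃ y ∈ Zᶜ, y ∉ S := by
      rwa [Set.not_subset, Set.not_subset] at hcon
    have hne : ∀ {z}, z ∈ Zᶜ → z ≠ m := by
      rintro z hz rfl
      exact hz hm
    have hyS' : y ∈ S := by have := hp.cover y; have := hne hy; tauto
    have hyR' : y' ∈ R := by have := hp.cover y'; have := hne hy'; tauto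
    obtain ⟨z, hz, hzm⟩ := hZ'.exists_ne m
    rcases hp.cover z with rfl | hzR | hzS
    · exact hzm rfl
    · exact hcross R hp.left_low ⟨⟨z, hz, hzR⟩, ⟨m, hm, hp.notMem_left⟩, ⟨y', hyR', hy'⟩,
        ⟨y, fun h => h.elim hy hyR⟩⟩
    · exact hcross S hp.right_low ⟨⟨z, hz, hzS⟩, ⟨m, hm, hp.notMem_right⟩, ⟨y, hyS', hy⟩,
        ⟨y', fun h => h.elim hy' hyS⟩⟩
  have hR : R ⊆ Z ∨ Zᶜ ⊆ R := by
    refine hside.symm.imp_left fun h z hz => ?_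
    by_contra hzZ
    exact hdis hz (h hzZ)
  have hS : S ⊆ Z ∨ Zᶜ ⊆ S := by
    refine hside.imp_left fun h z hz => ?_
    by_contra hzZ
    exact hdis (h hzZ) hz
  have hp' : MarkerPartition (markerGraph G Z) (some ⟨m, hm⟩) (markerProj Z '' R)
      (markerProj Z '' S) := by
    rw [markerPartition_markerGraph_iff hZ hZc, markerProj_preimage_image hR,
      markerProj_preimage_image hS]
    exact hp
  have := hD _ _ _ hp'
  rwa [edgeBetween_markerGraph_iff hp'.disjoint,
    edgeBetween_markerGraph_iff (Set.disjoint_singleton_right.2 hp'.notMem_left),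
    edgeBetween_markerGraph_iff (Set.disjoint_singleton_right.2 hp'.notMem_right),
    markerProj_preimage_some, markerProj_preimage_image hR, markerProj_preimage_image hS] at this

/-- The statement for the two parts shows that `X` is uncrossed; therefore the marker partitions of
`G` descend to the part containing `m`. -/
theorem IsCanonical.partitionsDetermineKinds {V : Type u} {G : SimpleGraph V}
    {D : Decomposition G} (hD : D.IsCanonical) :
    Finite V → EdgeConn G → D.PartitionsDetermineKinds := by
  induction D with
  | single G =>
    intro hV hG
    exact partitionsDetermineKinds_single hG (isCanonical_single_iff.1 hD)
  | split X hX D₁ D₂ ih₁ ih₂ =>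
    intro hV hG m R S hp
    obtain ⟨hD₁, hD₂, hcl, hcs, hsc⟩ := isCanonical_split_iff.1 hD
    have hX' := (isSplit_iff hG).1 hX
    have hXc : Xᶜᶜ.Nonempty := (compl_compl X).symm ▸ hX'.1.nonempty
    have k₁ := ih₁ hD₁ inferInstance (hG.markerGraph hX'.2.1.nonempty)
    have k₂ := ih₂ hD₂ inferInstance (hG.markerGraph hXc)
    have hcross : ∀ P, LowCut _ P → ¬ Crosses X P := fun P =>
      not_crosses_of_partitionsDetermineKinds hG hX'.2.2 k₁ k₂ hcl hcs hsc
    by_cases hm : m ∈ X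
    · have k := kindsMatch_of_markerPartition hX'.2.2 hX'.1 hX'.2.1.nonempty k₁ hcross hm hp
      rw [incl_split_mem hm]
      exact ⟨fun h => centreAt_inl.2 (k.centre h), fun h => leafAt_inl.2 (k.leaf_left h),
        fun h => leafAt_inl.2 (k.leaf_right h), fun h h' h'' => cliqueAt_inl.2 (k.clique h h' h'')⟩
    · have k := kindsMatch_of_markerPartition hX'.2.2.compl hX'.2.1 hXc k₂
        (fun P hP hc => hcross P hP (compl_compl X ▸ hc.compl_left)) hm hp
      rw [incl_split_notMem hm]
      exact ⟨fun h => centreAt_inr.2 (k.centre h), fun h => leafAt_inr.2 (k.leaf_left h),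
        fun h => leafAt_inr.2 (k.leaf_right h), fun h h' h'' => cliqueAt_inr.2 (k.clique h h' h'')⟩

/-- The splits of a canonical decomposition are not crossed by a split. -/
theorem IsCanonical.not_crosses [Finite V] (hG : EdgeConn G) {X P : Set V} {hX : IsSplit G X}
    {D₁ : Decomposition (markerGraph G X)} {D₂ : Decomposition (markerGraph G Xᶜ)}
    (hD : (split X hX D₁ D₂).IsCanonical) (hP : LowCut G P) : ¬ Crosses X P := by
  obtain ⟨hD₁, hD₂, hcl, hcs, hsc⟩ := isCanonical_split_iff.1 hD
  have hX' := (isSplit_iff hG).1 hX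
  have hXc : Xᶜᶜ.Nonempty := (compl_compl X).symm ▸ hX'.1.nonempty
  exact not_crosses_of_partitionsDetermineKinds hG hX'.2.2
    (hD₁.partitionsDetermineKinds inferInstance (hG.markerGraph hX'.2.1.nonempty))
    (hD₂.partitionsDetermineKinds inferInstance (hG.markerGraph hXc)) hcl hcs hsc hP

end Decomposition

/-! ### Marker partitions obtained from clique and star blocks. -/

namespace Decomposition

variable {V : Type u} {G : SimpleGraph V}

/-- The block of `w` gives rise to marker partitions of the vertex `m`. -/
structure RealizesKinds (D : Decomposition G) (m : V) (w : D.Vertex) : Prop where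
  clique : D.CliqueAt w → ∃ R S, MarkerPartition G m R S ∧ EdgeBetween G R S ∧
    EdgeBetween G R {m} ∧ EdgeBetween G S {m}
  centre : D.CentreAt w → ∃ R S, MarkerPartition G m R S ∧ ¬ EdgeBetween G R S
  leaf : D.LeafAt w → ∃ R S, MarkerPartition G m R S ∧ ¬ EdgeBetween G S {m}

theorem markerPartition_singleton [Finite V] (h : ∀ X : Set V, LowCut G X)
    (hcard : 3 ≤ Nat.card V) {m r : V} (hrm : r ≠ m) : MarkerPartition G m {r} {r, m}ᶜ := by
  refine ⟨⟨r, rfl⟩, ?_, ?_, hrm.symm, fun h => h (.inr rfl), fun v => ?_, h _, h _⟩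
  · rw [Set.nonempty_compl]
    intro hu
    have h1 : ({r, m} : Set V).ncard ≤ 2 := (Set.ncard_insert_le _ _).trans (by simp)
    rw [hu, Set.ncard_univ] at h1
    omega
  · rw [Set.disjoint_singleton_left]
    exact fun h => h (.inl rfl)
  · by_cases hv : v ∈ ({r, m} : Set V)
    · rcases hv with rfl | rfl
      · exact .inr (.inl rfl)
      · exact .inl rfl
    · exact .inr (.inr hv)

/-- The partition isolates one vertex `r` from the rest: any `r` for a clique or a centre `m`, and
the centre of the star for a leaf `m`. -/
theorem realizesKinds_single [Finite V] (m : V) : (single G).RealizesKinds m m := by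
  have other : 3 ≤ Nat.card V → ∃ r, r ≠ m := by
    intro h
    have : Nontrivial V := Finite.one_lt_card_iff_nontrivial.1 (by omega)
    exact exists_ne m
  refine ⟨fun h => ?_, fun h => ?_, fun h => ?_⟩
  · rw [cliqueAt_single] at h
    obtain ⟨r, hr⟩ := other h.1
    have hp := markerPartition_singleton h.lowCut h.1 hr
    have hadj : ∀ {a b}, a ≠ b → G.Adj a b := by
      intro a b hab
      rw [h.2]
      exact hab
    obtain ⟨s, hs⟩ := hp.right_nonempty
    exact ⟨_, _, hp, ⟨r, rfl, s, hs, hadj fun e => hs (.inl e.symm)⟩, ⟨r, rfl, m, rfl, hadj hr⟩,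
      ⟨s, hs, m, rfl, hadj fun e => hs (.inr e)⟩⟩
  · rw [centreAt_single] at h
    obtain ⟨r, hr⟩ := other h.1
    refine ⟨_, _, markerPartition_singleton h.lowCut h.1 hr, ?_⟩
    rintro ⟨_, rfl, b, hb, hab⟩
    rw [h.2, SimpleGraph.starGraph_adj] at hab
    rcases hab.2 with rfl | rfl
    · exact hr rfl
    · exact hb (.inr rfl)
  · obtain ⟨c, hc, hst⟩ := leafAt_single.1 h
    refine ⟨_, _, markerPartition_singleton hst.lowCut hst.1 hc, ?_⟩
    rintro ⟨a, ha, _, rfl, hab⟩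
    rw [hst.2, SimpleGraph.starGraph_adj] at hab
    rcases hab.2 with rfl | rfl
    · exact ha (.inl rfl)
    · exact hc rfl

theorem realizesKinds_of_markerGraph {Z : Set V} (hZ : LowCut G Z) (hZc : Zᶜ.Nonempty)
    {D : Decomposition (markerGraph G Z)} {m : V} {hm : m ∈ Z} {w : D.Vertex}
    (hD : D.RealizesKinds (some ⟨m, hm⟩) w) :
    (D.CliqueAt w → ∃ R S, MarkerPartition G m R S ∧ EdgeBetween G R S ∧
      EdgeBetween G R {m} ∧ EdgeBetween G S {m}) ∧
    (D.CentreAt w → ∃ R S, MarkerPartition G m R S ∧ ¬ EdgeBetween G R S) ∧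
    (D.LeafAt w → ∃ R S, MarkerPartition G m R S ∧ ¬ EdgeBetween G S {m}) := by
  have edges : ∀ {R S}, MarkerPartition (markerGraph G Z) (some ⟨m, hm⟩) R S →
      (EdgeBetween (markerGraph G Z) R S ↔
        EdgeBetween G (markerProj Z ⁻¹' R) (markerProj Z ⁻¹' S)) ∧
      (EdgeBetween (markerGraph G Z) R {some ⟨m, hm⟩} ↔
        EdgeBetween G (markerProj Z ⁻¹' R) {m}) ∧
      (EdgeBetween (markerGraph G Z) S {some ⟨m, hm⟩} ↔
        EdgeBetween G (markerProj Z ⁻¹' S) {m}) := by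
    intro R S hp
    rw [edgeBetween_markerGraph_iff hp.disjoint,
      edgeBetween_markerGraph_iff (Set.disjoint_singleton_right.2 hp.notMem_left),
      edgeBetween_markerGraph_iff (Set.disjoint_singleton_right.2 hp.notMem_right),
      markerProj_preimage_some]
    exact ⟨Iff.rfl, Iff.rfl, Iff.rfl⟩
  refine ⟨fun h => ?_, fun h => ?_, fun h => ?_⟩
  · obtain ⟨R, S, hp, h1, h2, h3⟩ := hD.clique h
    obtain ⟨e1, e2, e3⟩ := edges hp
    exact ⟨_, _, (markerPartition_markerGraph_iff hZ hZc hm).1 hp, e1.1 h1, e2.1 h2, e3.1 h3⟩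
  · obtain ⟨R, S, hp, h1⟩ := hD.centre h
    exact ⟨_, _, (markerPartition_markerGraph_iff hZ hZc hm).1 hp,
      fun h => h1 ((edges hp).1.2 h)⟩
  · obtain ⟨R, S, hp, h1⟩ := hD.leaf h
    exact ⟨_, _, (markerPartition_markerGraph_iff hZ hZc hm).1 hp,
      fun h => h1 ((edges hp).2.2.2 h)⟩

/-- Converse to `PartitionsDetermineKinds`: the partition found in a block is pulled back through
the contractions. -/
theorem realizesKinds {V : Type u} {G : SimpleGraph V} (D : Decomposition G) :
    Finite V → EdgeConn G → ∀ m, D.RealizesKinds m (D.incl m) := by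
  induction D with
  | single G =>
    intro hV _ m
    exact realizesKinds_single m
  | split X hX D₁ D₂ ih₁ ih₂ =>
    intro hV hG m
    have hX' := (isSplit_iff hG).1 hX
    have hXc : Xᶜᶜ.Nonempty := (compl_compl X).symm ▸ hX'.1.nonempty
    by_cases hm : m ∈ X
    · have k := realizesKinds_of_markerGraph hX'.2.2 hX'.2.1.nonempty
        (ih₁ inferInstance (hG.markerGraph hX'.2.1.nonempty) (some ⟨m, hm⟩))
      rw [incl_split_mem hm]
      exact ⟨fun h => k.1 (cliqueAt_inl.1 h), fun h => k.2.1 (centreAt_inl.1 h),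
        fun h => k.2.2 (leafAt_inl.1 h)⟩
    · have k := realizesKinds_of_markerGraph hX'.2.2.compl hXc
        (ih₂ inferInstance (hG.markerGraph hXc) (some ⟨m, hm⟩))
      rw [incl_split_notMem hm]
      exact ⟨fun h => k.1 (cliqueAt_inr.1 h), fun h => k.2.1 (centreAt_inr.1 h),
        fun h => k.2.2 (leafAt_inr.1 h)⟩

end Decomposition

/-! ### Low cuts glued from marker partitions of both sides of a split. -/

section GluingPartitions

variable {V : Type u} {G : SimpleGraph V}

/-- Four sets which arise from marker partitions of the two marker graphs of a split. -/
structure CornerPartition (G : SimpleGraph V) (X R S R' S' : Set V) : Prop where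
  left : R ∪ S = X
  right : R' ∪ S' = Xᶜ
  disjoint_left : Disjoint R S
  disjoint_right : Disjoint R' S'
  nonempty : R.Nonempty ∧ S.Nonempty ∧ R'.Nonempty ∧ S'.Nonempty
  low : LowCut G R ∧ LowCut G S ∧ LowCut G R' ∧ LowCut G S'

theorem CornerPartition.symm {X R S R' S' : Set V} (h : CornerPartition G X R S R' S') :
    CornerPartition G Xᶜ R' S' R S := by
  obtain ⟨h1, h2, h3, h4, ⟨h5, h6, h7, h8⟩, h9, h10, h11, h12⟩ := h
  exact ⟨h2, by rw [compl_compl, h1], h4, h3, ⟨h7, h8, h5, h6⟩, h11, h12, h9, h10⟩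

theorem cornerPartition_of_markerPartitions {X : Set V} (hX : LowCut G X)
    {R S : Set (Option X)} {R' S' : Set (Option (Xᶜ : Set V))} (hX₁ : X.Nonempty)
    (hX₂ : Xᶜ.Nonempty) (hp : MarkerPartition (markerGraph G X) none R S)
    (hp' : MarkerPartition (markerGraph G Xᶜ) none R' S') :
    CornerPartition G X (markerProj X ⁻¹' R) (markerProj X ⁻¹' S) (markerProj Xᶜ ⁻¹' R')
      (markerProj Xᶜ ⁻¹' S') := by
  have union : ∀ {Z : Set V} {R S : Set (Option Z)}, MarkerPartition (markerGraph G Z) none R S →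
      markerProj Z ⁻¹' R ∪ markerProj Z ⁻¹' S = Z := by
    intro Z R S hp
    ext v
    by_cases hv : v ∈ Z
    · have := hp.cover (some ⟨v, hv⟩)
      simp only [Set.mem_union, Set.mem_preimage, markerProj_mem hv]
      simpa [hv] using this
    · simp [markerProj_notMem hv, hv, hp.notMem_left, hp.notMem_right]
  have s1 := markerProj_surjective hX₂
  have s2 := markerProj_surjective (X := Xᶜ) (by rwa [compl_compl])
  exact ⟨union hp, union hp', hp.disjoint.preimage _, hp'.disjoint.preimage _,
    ⟨hp.1.preimage s1, hp.2.preimage s1, hp'.1.preimage s2, hp'.2.preimage s2⟩,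
    (lowCut_markerGraph_iff hX).1 hp.left_low, (lowCut_markerGraph_iff hX).1 hp.right_low,
    (lowCut_markerGraph_iff hX.compl).1 hp'.left_low,
    (lowCut_markerGraph_iff hX.compl).1 hp'.right_low⟩

theorem CornerPartition.mem_iff {X R S R' S' : Set V} (h : CornerPartition G X R S R' S') {v : V} :
    v ∉ R ∪ R' ↔ v ∈ S ∪ S' := by
  have h1 := Set.ext_iff.1 h.left v
  have h2 := Set.ext_iff.1 h.right v
  have h3 : v ∈ R → v ∉ S := fun e => Set.disjoint_left.1 h.disjoint_left e
  have h4 : v ∈ R' → v ∉ S' := fun e => Set.disjoint_left.1 h.disjoint_right e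
  simp only [Set.mem_union, Set.mem_compl_iff] at *
  tauto

theorem CornerPartition.crosses {X R S R' S' : Set V} (h : CornerPartition G X R S R' S') :
    Crosses X (R ∪ R') := by
  obtain ⟨⟨r, hr⟩, ⟨s, hs⟩, ⟨r', hr'⟩, ⟨s', hs'⟩⟩ := h.nonempty
  have hR' : ∀ {v}, v ∈ R' → v ∉ X := fun hv => (h.right ▸ .inl hv : _ ∈ Xᶜ)
  have hS' : ∀ {v}, v ∈ S' → v ∉ X := fun hv => (h.right ▸ .inr hv : _ ∈ Xᶜ)
  exact ⟨⟨r, h.left ▸ .inl hr, .inl hr⟩, ⟨s, h.left ▸ .inr hs, h.mem_iff.2 (.inl hs)⟩,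
    ⟨r', .inr hr', hR' hr'⟩, ⟨s', fun e => e.elim (hS' hs') (h.mem_iff.2 (.inr hs'))⟩⟩

/-- Every edge leaving `R ∪ R'` starts in `R`, since `R'` is joined neither to `S` nor to `S'`.
Hence the lowness of `R` suffices. -/
theorem CornerPartition.lowCut_of_star {X R S R' S' : Set V} (h : CornerPartition G X R S R' S')
    (h₁ : ¬ EdgeBetween G S Xᶜ) (h₂ : ¬ EdgeBetween G R' S') : LowCut G (R ∪ R') := by
  have key : ∀ {u v}, u ∈ R ∪ R' → v ∉ R ∪ R' → G.Adj u v → u ∈ R := by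
    intro u v hu hv huv
    by_contra hcon
    have hu : u ∈ R' := hu.resolve_left hcon
    rcases h.mem_iff.1 hv with hv | hv
    · exact h₁ ⟨v, hv, u, h.right ▸ .inl hu, huv.symm⟩
    · exact h₂ ⟨u, hu, v, hv, huv⟩
  intro u u' v v' hu hu' hv hv' huv huv'
  exact h.low.1 (key hu hv huv) (key hu' hv' huv') (fun e => hv (.inl e)) (fun e => hv' (.inl e))
    huv huv'

/-- Each corner in `R ∪ R'` is joined to each corner outside it. Take an edge between the corner of
`u` and that of `v'`; the lowness of these two corners moves its ends to `u` and `v'`. -/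
theorem CornerPartition.lowCut_of_clique {X R S R' S' : Set V} (hX : LowCut G X)
    (h : CornerPartition G X R S R' S') (h₁ : EdgeBetween G R S) (h₂ : EdgeBetween G R Xᶜ)
    (h₃ : EdgeBetween G S Xᶜ) (h₁' : EdgeBetween G R' S') (h₂' : EdgeBetween G R' X)
    (h₃' : EdgeBetween G S' X) : LowCut G (R ∪ R') := by
  have inR : ∀ {v}, v ∈ R → v ∈ X := fun hv => h.left ▸ .inl hv
  have inS : ∀ {v}, v ∈ S → v ∈ X := fun hv => h.left ▸ .inr hv
  have inR' : ∀ {v}, v ∈ R' → v ∉ X := fun hv => (h.right ▸ .inl hv : _ ∈ Xᶜ)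
  have inS' : ∀ {v}, v ∈ S' → v ∉ X := fun hv => (h.right ▸ .inr hv : _ ∈ Xᶜ)
  have cross : ∀ {A B : Set V}, (∀ {v}, v ∈ A → v ∈ X) → (∀ {v}, v ∈ B → v ∉ X) →
      EdgeBetween G A Xᶜ → EdgeBetween G B X → EdgeBetween G A B := by
    rintro A B hA hB ⟨a, ha, b, hb, hab⟩ ⟨c, hc, d, hd, hcd⟩
    exact ⟨a, ha, c, hc, hX (hA ha) hd hb (hB hc) hab hcd.symm⟩
  have join : ∀ {A B : Set V}, LowCut G A → LowCut G B → (∀ {v}, v ∈ A → v ∉ B) →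
      EdgeBetween G A B → ∀ {u v u' v'}, u ∈ A → v' ∈ B → v ∉ A → u' ∉ B → G.Adj u v →
      G.Adj u' v' → G.Adj u v' := by
    rintro A B hA hB hAB ⟨a, ha, b, hb, hab⟩ u v u' v' hu hv' hv hu' huv huv'
    have h1 : G.Adj u b := hA hu ha hv (fun e => hAB e hb) huv hab
    exact (hB hv' hb hu' (hAB hu) huv'.symm h1.symm).symm
  obtain ⟨lR, lS, lR', lS'⟩ := h.low
  have d1 := Set.disjoint_left.1 h.disjoint_left
  have d2 := Set.disjoint_left.1 h.disjoint_right
  intro u u' v v' hu hu' hv hv' huv huv'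
  have hu'' : u' ∉ S ∪ S' := fun e => h.mem_iff.2 e hu'
  have hvR : v ∉ R := fun e => hv (.inl e)
  have hvR' : v ∉ R' := fun e => hv (.inr e)
  have hu'S : u' ∉ S := fun e => hu'' (.inl e)
  have hu'S' : u' ∉ S' := fun e => hu'' (.inr e)
  rcases hu with hu | hu <;> rcases h.mem_iff.1 hv' with hv' | hv'
  · exact join lR lS (fun h => d1 h) h₁ hu hv' hvR hu'S huv huv'
  · exact join lR lS' (fun h h' => inS' h' (inR h)) (cross inR inS' h₂ h₃') hu hv' hvR hu'S' huv
      huv'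
  · exact join lR' lS (fun h h' => inR' h (inS h')) (cross inS inR' h₃ h₂').symm hu hv' hvR' hu'S
      huv huv'
  · exact join lR' lS' (fun h => d2 h) h₁' hu hv' hvR' hu'S' huv huv'

end GluingPartitions

/-! ### Existence of canonical decompositions. -/

namespace Decomposition

/-- Canonical decompositions of the two marker graphs of a split which is not crossed by another
split form a canonical decomposition. -/
theorem isCanonical_split_of_not_crosses {V : Type u} {G : SimpleGraph V} [Finite V]
    (hG : EdgeConn G) {X : Set V} (hX : IsSplit G X) {D₁ : Decomposition (markerGraph G X)}
    {D₂ : Decomposition (markerGraph G Xᶜ)} (h₁ : D₁.IsCanonical) (h₂ : D₂.IsCanonical)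
    (hcross : ∀ P, LowCut G P → ¬ Crosses X P) : (split X hX D₁ D₂).IsCanonical := by
  obtain ⟨hX₁, hX₂, hlow⟩ := (isSplit_iff hG).1 hX
  have hX₂' : Xᶜᶜ.Nonempty := (compl_compl X).symm ▸ hX₁.nonempty
  have k₁ := D₁.realizesKinds inferInstance (hG.markerGraph hX₂.nonempty) none
  have k₂ := D₂.realizesKinds inferInstance (hG.markerGraph hX₂') none
  have none₁ : ∀ {Z : Set V} {P : Set (Option Z)}, none ∉ P →
      (EdgeBetween (markerGraph G Z) P {none} ↔ EdgeBetween G (markerProj Z ⁻¹' P) Zᶜ) := by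
    intro Z P hP
    rw [edgeBetween_markerGraph_iff (Set.disjoint_singleton_right.2 hP), markerProj_preimage_none]
  refine isCanonical_split_iff.2 ⟨h₁, h₂, ?_, ?_, ?_⟩
  · rintro ⟨c₁, c₂⟩
    obtain ⟨R, S, hp, a1, a2, a3⟩ := k₁.clique c₁
    obtain ⟨R', S', hp', b1, b2, b3⟩ := k₂.clique c₂
    have hc := cornerPartition_of_markerPartitions hlow hX₁.nonempty hX₂.nonempty hp hp'
    rw [edgeBetween_markerGraph_iff hp.disjoint] at a1
    rw [edgeBetween_markerGraph_iff hp'.disjoint] at b1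
    rw [none₁ hp.notMem_left] at a2
    rw [none₁ hp.notMem_right] at a3
    rw [none₁ hp'.notMem_left, compl_compl] at b2
    rw [none₁ hp'.notMem_right, compl_compl] at b3
    exact hcross _ (hc.lowCut_of_clique hlow a1 a2 a3 b1 b2 b3) hc.crosses
  · rintro ⟨c₁, c₂⟩
    obtain ⟨R, S, hp, a1⟩ := k₁.centre c₁
    obtain ⟨R', S', hp', b1⟩ := k₂.leaf c₂
    have hc := (cornerPartition_of_markerPartitions hlow hX₁.nonempty hX₂.nonempty hp hp').symm
    rw [edgeBetween_markerGraph_iff hp.disjoint] at a1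
    rw [none₁ hp'.notMem_right] at b1
    have hcr := hc.crosses.compl_left
    rw [compl_compl] at hcr
    exact hcross _ (hc.lowCut_of_star b1 a1) hcr
  · rintro ⟨c₂, c₁⟩
    obtain ⟨R', S', hp', b1⟩ := k₂.centre c₂
    obtain ⟨R, S, hp, a1⟩ := k₁.leaf c₁
    have hc := cornerPartition_of_markerPartitions hlow hX₁.nonempty hX₂.nonempty hp hp'
    rw [edgeBetween_markerGraph_iff hp'.disjoint] at b1
    rw [none₁ hp.notMem_right] at a1
    exact hcross _ (hc.lowCut_of_star a1 b1) hc.crosses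

/-- Split along an uncrossed split if there is one; both marker graphs have fewer vertices. -/
theorem exists_isCanonical {V : Type u} [hV : Finite V] (G : SimpleGraph V) (hG : EdgeConn G) :
    ∃ D : Decomposition G, D.IsCanonical := by
  obtain ⟨n, hn⟩ : ∃ n, Nat.card V = n := ⟨_, rfl⟩
  induction n using Nat.strong_induction_on generalizing V with
  | _ n ih =>
    by_cases h : ∀ X : Set V, IsSplit G X → ∃ P, LowCut G P ∧ Crosses X P
    · exact ⟨single G, isCanonical_single_iff.2 (prime_or_clique_or_star_of_splits_crossed hG h)⟩
    · push Not at h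
      obtain ⟨X, hX, hcross⟩ := h
      obtain ⟨hX₁, hX₂, -⟩ := (isSplit_iff hG).1 hX
      have hX₂' : Xᶜᶜ.Nonempty := (compl_compl X).symm ▸ hX₁.nonempty
      have card : ∀ Z : Set V, Zᶜ.Nontrivial → Nat.card (Option Z) < n := by
        intro Z hZ
        rw [← Set.one_lt_ncard_iff_nontrivial] at hZ
        have := Set.ncard_add_ncard_compl Z
        rw [Finite.card_option, Nat.card_coe_set_eq]
        omega
      obtain ⟨D₁, h₁⟩ := ih _ (card X hX₂) _ (hG.markerGraph hX₂.nonempty) rfl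
      obtain ⟨D₂, h₂⟩ := ih _ (card Xᶜ ((compl_compl X).symm ▸ hX₁)) _ (hG.markerGraph hX₂') rfl
      exact ⟨split X hX D₁ D₂, isCanonical_split_of_not_crosses hG hX h₁ h₂ hcross⟩

end Decomposition

/-! ### Low layouts and linear rank-width one. -/

/-- The injective map `g` arranges the vertices in a line such that every cut between an initial
segment and the rest has rank at most one. -/
def IsLowLayout {V : Type u} (G : SimpleGraph V) (g : V → ℤ) : Prop :=
  Function.Injective g ∧ ∀ t, LowCut G {v | g v < t}

section LowLayouts

variable {V : Type u} {G : SimpleGraph V}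

theorem lowCut_univ : LowCut G Set.univ := by
  rw [← lowCut_compl_iff, Set.compl_univ]
  exact lowCut_of_subsingleton Set.subsingleton_empty

theorem IsLowLayout.neg {g : V → ℤ} (h : IsLowLayout G g) : IsLowLayout G (-g) := by
  refine ⟨neg_injective.comp h.1, fun t => ?_⟩
  have : {v | (-g) v < t} = {v | g v < -t + 1}ᶜ := by
    ext v
    simp only [Pi.neg_apply, Set.mem_ofPred_eq, Set.mem_compl_iff]
    omega
  rw [this]
  exact (h.2 _).compl

theorem orderingCutRank_le_one_iff [Finite V] {n : ℕ} {π : Fin n ≃ V} :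
    orderingCutRank G π ≤ 1 ↔ ∀ i, LowCut G {v | (π.symm v : ℕ) < i} := by
  have hc : ∀ i, {v | i ≤ (π.symm v : ℕ)} = {v | (π.symm v : ℕ) < i}ᶜ := fun i => by
    ext v
    simp
  rw [orderingCutRank, Finset.sup_le_iff]
  simp only [hc, cutRank_le_one_iff]
  refine ⟨fun h i => ?_, fun h i _ => h i⟩
  rcases Nat.eq_zero_or_pos i with rfl | hi
  · exact lowCut_of_subsingleton (by simp)
  · by_cases hn : i ≤ n
    · exact h i (Finset.mem_Icc.2 ⟨hi, hn⟩)
    · convert lowCut_univ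
      ext v
      have := (π.symm v).2
      simp only [Set.mem_ofPred_eq, Set.mem_univ, iff_true]
      omega

/-- By connectivity the first vertex has a neighbour, so every ordering has cut-rank at least one.
Orderings exist, so `sInf` does not take its default value `0`. -/
theorem linearRankWidth_eq_one_iff_ordering [Finite V] [Nontrivial V] (hG : EdgeConn G) :
    linearRankWidth G = 1 ↔ ∃ π : Fin (Nat.card V) ≃ V, orderingCutRank G π ≤ 1 := by
  have hpos : ∀ π : Fin (Nat.card V) ≃ V, 1 ≤ orderingCutRank G π := by
    intro π
    have hn : 1 < Nat.card V := Finite.one_lt_card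
    have h1 : cutRank G {v | (π.symm v : ℕ) < 1} {v | 1 ≤ (π.symm v : ℕ)} ≤ orderingCutRank G π :=
      Finset.le_sup (f := fun i => cutRank G {v | (π.symm v : ℕ) < i} {v | i ≤ (π.symm v : ℕ)})
        (Finset.mem_Icc.2 ⟨le_rfl, hn.le⟩)
    have hc : {v | 1 ≤ (π.symm v : ℕ)} = {v | (π.symm v : ℕ) < 1}ᶜ := by
      ext v
      simp [Nat.one_le_iff_ne_zero]
    obtain ⟨x, hx, y, hy, hxy⟩ := hG {v : V | (π.symm v : ℕ) < 1}
      ⟨π ⟨0, by omega⟩, by simp⟩ ⟨π ⟨1, hn⟩, by simp⟩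
    have := cutRank_ne_zero hx hy hxy
    rw [← hc] at this
    omega
  have hne : (Set.range fun π : Fin (Nat.card V) ≃ V => orderingCutRank G π).Nonempty :=
    have : Nonempty (Fin (Nat.card V) ≃ V) := ⟨(Finite.equivFin V).symm⟩
    Set.range_nonempty _
  constructor
  · intro h
    obtain ⟨π, hπ⟩ := Nat.sInf_mem hne
    exact ⟨π, (hπ.trans h).le⟩
  · rintro ⟨π, hπ⟩
    refine le_antisymm ((Nat.sInf_le (Set.mem_range_self π)).trans hπ) ?_
    obtain ⟨π', hπ'⟩ := Nat.sInf_mem hne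
    exact (hpos π').trans hπ'.le

/-- Linear rank-width one in terms of low layouts. -/
theorem linearRankWidth_eq_one_iff [Finite V] [Nontrivial V] (hG : EdgeConn G) :
    linearRankWidth G = 1 ↔ ∃ g, IsLowLayout G g := by
  rw [linearRankWidth_eq_one_iff_ordering hG]
  simp only [orderingCutRank_le_one_iff]
  constructor
  · rintro ⟨π, hπ⟩
    refine ⟨fun v => (π.symm v : ℕ), fun u v huv => ?_, fun t => ?_⟩
    · have : (π.symm u : ℕ) = π.symm v := by simpa using huv
      exact π.symm.injective (Fin.ext this)
    · convert hπ t.toNat using 1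
      ext v
      simp only [Set.mem_ofPred_eq]
      omega
  · rintro ⟨g, hg, hlow⟩
    have := Fintype.ofFinite V
    let _ : LinearOrder V := LinearOrder.lift' g hg
    have hlt : ∀ u v : V, u < v ↔ g u < g v := fun u v => Iff.rfl
    let e := Fintype.orderIsoFinOfCardEq V (Nat.card_eq_fintype_card (α := V)).symm
    refine ⟨e.toEquiv, fun i => ?_⟩
    by_cases hi : i < Nat.card V
    · convert hlow (g (e ⟨i, hi⟩)) using 1
      ext v
      simp only [Set.mem_ofPred_eq]
      rw [← hlt, ← OrderIso.symm_apply_lt]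
      exact Iff.rfl
    · convert lowCut_univ
      ext v
      have := (e.toEquiv.symm v).2
      simp only [Set.mem_ofPred_eq, Set.mem_univ, iff_true]
      omega

end LowLayouts

/-! ### Low layouts imply distance heredity. -/

section LayoutsAndDistances

variable {V W : Type u} {G : SimpleGraph V} {H : SimpleGraph W}

theorem exists_walk_of_weakHom {r : V → W}
    (h : ∀ u v, G.Adj u v → r u = r v ∨ H.Adj (r u) (r v)) {u v : V} (w : G.Walk u v) :
    ∃ w' : H.Walk (r u) (r v), w'.length ≤ w.length := by
  induction w with
  | nil => exact ⟨.nil, le_rfl⟩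
  | @cons a b c hab p ih =>
    obtain ⟨q, hq⟩ := ih
    rcases h a b hab with e | e
    · exact ⟨q.copy e.symm rfl, by simp; omega⟩
    · exact ⟨.cons e q, by simpa using hq⟩

theorem IsInducedPath.le_length_of_le_two {n : ℕ} {f : ℕ → V} (hf : IsInducedPath G n f)
    (hn : n ≤ 2) (w : G.Walk (f 0) (f n)) : n ≤ w.length := by
  by_contra! hlt
  have : w.length = 0 ∨ w.length = 1 := by omega
  rcases this with h | h
  · have := hf.1 0 (by omega) n le_rfl (SimpleGraph.Walk.eq_of_length_eq_zero h)
    omega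
  · have := (hf.2 0 (by omega) n le_rfl).1 (SimpleGraph.Walk.adj_of_length_eq_one h)
    omega

/-- The map to the graph without `a` which sends `a` to `b`. -/
noncomputable def mergeVertex {a b : V} (hab : a ≠ b) (v : V) : ({a}ᶜ : Set V) :=
  open Classical in if h : v = a then ⟨b, hab.symm⟩ else ⟨v, h⟩

theorem mergeVertex_self {a b : V} (hab : a ≠ b) : (mergeVertex hab a : V) = b := by
  simp [mergeVertex]

theorem mergeVertex_ne {a b : V} (hab : a ≠ b) {v : V} (hv : v ≠ a) :
    (mergeVertex hab v : V) = v := by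
  simp [mergeVertex, hv]

/-- Adding a twin preserves distance heredity. -/
theorem NoShortcut.of_twin {a b : V} (hab : a ≠ b)
    (htw : ∀ x, x ≠ a → x ≠ b → (G.Adj a x ↔ G.Adj b x))
    (h : NoShortcut (G.induce ({a}ᶜ : Set V))) : NoShortcut G := by
  intro n f hf w
  by_cases hn : n ≤ 2
  · exact hf.le_length_of_le_two hn w
  have adj_merge : ∀ {u v}, ¬ (u = a ∧ v = b) → ¬ (u = b ∧ v = a) →
      (G.Adj (mergeVertex hab u) (mergeVertex hab v) ↔ G.Adj u v) := by
    intro u v h1 h2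
    by_cases hu : u = a <;> by_cases hv : v = a
    · subst hu hv; simp
    · subst hu
      rw [mergeVertex_self, mergeVertex_ne hab hv, htw v hv (by tauto)]
    · subst hv
      rw [mergeVertex_self, mergeVertex_ne hab hu, G.adj_comm, G.adj_comm u,
        htw u hu (by tauto)]
    · rw [mergeVertex_ne hab hu, mergeVertex_ne hab hv]
  obtain ⟨w', hw'⟩ := exists_walk_of_weakHom (G := G) (H := G.induce ({a}ᶜ : Set V))
    (r := mergeVertex hab) (fun u v huv => by
      by_cases h1 : u = a ∧ v = b
      · left
        apply Subtype.ext
        rw [h1.1, h1.2, mergeVertex_self, mergeVertex_ne hab hab.symm]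
      by_cases h2 : u = b ∧ v = a
      · left
        apply Subtype.ext
        rw [h2.1, h2.2, mergeVertex_self, mergeVertex_ne hab hab.symm]
      exact .inr ((adj_merge h1 h2).2 huv)) w
  -- Twins on an induced path would have the same neighbours on it apart from each other. No two
  -- positions on a path with at least four vertices do; shorter paths were settled before.
  have hnot : ∀ i ≤ n, ∀ j ≤ n, ¬ (f i = a ∧ f j = b) := by
    rintro i hi j hj ⟨hia, hjb⟩
    have key : ∀ k ≤ n, k ≠ i → k ≠ j → ((i + 1 = k ∨ k + 1 = i) ↔ (j + 1 = k ∨ k + 1 = j)) := by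
      intro k hk hki hkj
      rw [← hf.2 i hi k hk, ← hf.2 j hj k hk, hia, hjb]
      exact htw _ (fun e => hki (hf.1 k hk i hi (e.trans hia.symm)))
        (fun e => hkj (hf.1 k hk j hj (e.trans hjb.symm)))
    have hij : i ≠ j := by
      rintro rfl
      exact hab (hia.symm.trans hjb)
    have k1 := key (i + 1)
    have k2 := key (i - 1)
    have k3 := key (j + 1)
    have k4 := key (j - 1)
    omega
  have := h n (fun i => mergeVertex hab (f i)) ⟨fun i hi j hj hij => ?_, fun i hi j hj => ?_⟩ w'
  · omega
  · have hij' : (mergeVertex hab (f i) : V) = mergeVertex hab (f j) := congrArg Subtype.val hij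
    refine hf.1 i hi j hj ?_
    by_cases hu : f i = a <;> by_cases hv : f j = a
    · rw [hu, hv]
    · rw [hu, mergeVertex_self, mergeVertex_ne hab hv] at hij'
      exact (hnot i hi j hj ⟨hu, hij'.symm⟩).elim
    · rw [hv, mergeVertex_self, mergeVertex_ne hab hu] at hij'
      exact (hnot j hj i hi ⟨hv, hij'⟩).elim
    · rwa [mergeVertex_ne hab hu, mergeVertex_ne hab hv] at hij'
  · exact (adj_merge (hnot i hi j hj) (fun e => hnot j hj i hi ⟨e.2, e.1⟩)).trans (hf.2 i hi j hj)

/-- Adding an isolated or pendant vertex preserves distance heredity. -/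
theorem NoShortcut.of_pendant {a b : V} (hab : a ≠ b) (hpd : ∀ x, G.Adj a x → x = b)
    (h : NoShortcut (G.induce ({a}ᶜ : Set V))) : NoShortcut G := by
  have hr : ∀ u v, G.Adj u v → mergeVertex hab u = mergeVertex hab v ∨
      (G.induce ({a}ᶜ : Set V)).Adj (mergeVertex hab u) (mergeVertex hab v) := by
    intro u v huv
    by_cases hu : u = a
    · subst hu
      obtain rfl := hpd v huv
      exact .inl (Subtype.ext ((mergeVertex_self hab).trans (mergeVertex_ne hab hab.symm).symm))
    by_cases hv : v = a
    · subst hv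
      obtain rfl := hpd u huv.symm
      exact .inl (Subtype.ext ((mergeVertex_ne hab hab.symm).trans (mergeVertex_self hab).symm))
    · right
      rw [SimpleGraph.comap_adj]
      change G.Adj (mergeVertex hab u) (mergeVertex hab v)
      rwa [mergeVertex_ne hab hu, mergeVertex_ne hab hv]
  have avoid : ∀ (n : ℕ) (f : ℕ → V), IsInducedPath G n f → (∀ i ≤ n, f i ≠ a) →
      ∀ w : G.Walk (f 0) (f n), n ≤ w.length := by
    intro n f hf ha w
    obtain ⟨w', hw'⟩ := exists_walk_of_weakHom hr w
    refine (h n (fun i => mergeVertex hab (f i)) ⟨fun i hi j hj hij => ?_, fun i hi j hj => ?_⟩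
      w').trans hw'
    · have hij' : (mergeVertex hab (f i) : V) = mergeVertex hab (f j) := congrArg Subtype.val hij
      rw [mergeVertex_ne hab (ha i hi), mergeVertex_ne hab (ha j hj)] at hij'
      exact hf.1 i hi j hj hij'
    · rw [← hf.2 i hi j hj]
      change G.Adj (mergeVertex hab (f i)) (mergeVertex hab (f j)) ↔ _
      rw [mergeVertex_ne hab (ha i hi), mergeVertex_ne hab (ha j hj)]
  -- A walk from `a` must first step to `b`, as the path does; removing this edge from both leaves a
  -- path that avoids `a`.
  have first : ∀ (n : ℕ) (f : ℕ → V), IsInducedPath G n f → f 0 = a →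
      ∀ w : G.Walk (f 0) (f n), n ≤ w.length := by
    intro n f hf ha w
    rcases n with _ | n
    · exact Nat.zero_le _
    have hshift : IsInducedPath G n (fun i => f (i + 1)) :=
      ⟨fun i hi j hj hij => by
        have := hf.1 (i + 1) (by omega) (j + 1) (by omega) hij
        omega,
      fun i hi j hj => by
        rw [hf.2 (i + 1) (by omega) (j + 1) (by omega)]
        omega⟩
    have h1 : f 1 = b :=
      hpd _ (ha ▸ (hf.2 0 (by omega) 1 (by omega)).2 (.inl rfl))
    have hw : ∀ {x y : V} (w : G.Walk x y), x = f 0 → y = f (n + 1) → n + 1 ≤ w.length := by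
      intro x y w hx hy
      cases w with
      | nil =>
        have := hf.1 0 (by omega) (n + 1) le_rfl (hx.symm.trans hy)
        omega
      | @cons _ z _ hxz p =>
        have hz : z = f 1 := by
          rw [h1]
          rw [hx, ha] at hxz
          exact hpd z hxz
        have := avoid n _ hshift (fun i hi e => by
          have := hf.1 (i + 1) (by omega) 0 (by omega) (e.trans ha.symm)
          omega) (p.copy hz hy)
        rw [SimpleGraph.Walk.length_copy] at this
        simpa using this
    exact hw w rfl rfl
  intro n f hf w
  by_cases hav : ∀ i ≤ n, f i ≠ a
  · exact avoid n f hf hav w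
  push Not at hav
  obtain ⟨i, hi, hia⟩ := hav
  have hends : i = 0 ∨ i = n := by
    by_contra! hcon
    have e1 := hpd _ (hia ▸ (hf.2 i hi (i + 1) (by omega)).2 (.inl rfl))
    have e2 := hpd _ (hia ▸ (hf.2 i hi (i - 1) (by omega)).2 (.inr (by omega)))
    have := hf.1 (i + 1) (by omega) (i - 1) (by omega) (e1.trans e2.symm)
    omega
  rcases hends with rfl | rfl
  · exact first n f hf hia w
  · have hrev : IsInducedPath G i (fun k => f (i - k)) :=
      ⟨fun j hj k hk hjk => by
        have := hf.1 (i - j) (by omega) (i - k) (by omega) hjk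
        omega,
      fun j hj k hk => by
        rw [hf.2 (i - j) (by omega) (i - k) (by omega)]
        omega⟩
    have := first i _ hrev hia (w.reverse.copy rfl (by simp))
    simpa using this

theorem LowCut.comap_map {X : Set V} (h : LowCut G X) (f : W → V) :
    LowCut (G.comap f) (f ⁻¹' X) :=
  fun _ _ _ _ hx hx' hy hy' hxy hxy' => h hx hx' hy hy' hxy hxy'

/-- Graphs of linear rank-width at most one are distance hereditary. -/
theorem IsLowLayout.noShortcut {V : Type u} [hV : Finite V] {G : SimpleGraph V} {g : V → ℤ}
    (h : IsLowLayout G g) : NoShortcut G := by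
  obtain ⟨n, hn⟩ : ∃ n, Nat.card V = n := ⟨_, rfl⟩
  induction n generalizing V with
  | zero =>
    intro k f hf w
    have : IsEmpty V := (Finite.card_eq_zero_iff).1 hn
    exact (this.false (f 0)).elim
  | succ n ih =>
    by_cases hnt : Nontrivial V
    swap
    · intro k f hf w
      rw [not_nontrivial_iff_subsingleton] at hnt
      have := hf.1 0 (by omega) k le_rfl (Subsingleton.elim _ _)
      omega
    obtain ⟨a, ha⟩ := Finite.exists_min g
    have hne : ({a}ᶜ : Set V).Nonempty := by
      obtain ⟨b, hb⟩ := exists_ne a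
      exact ⟨b, hb⟩
    obtain ⟨b, hba, hb⟩ := Set.exists_min_image ({a}ᶜ : Set V) g (Set.toFinite _) hne
    have hab : a ≠ b := fun e => hba e.symm
    have hset : {v | g v < g b + 1} = {a, b} := by
      ext v
      simp only [Set.mem_ofPred_eq, Set.mem_insert_iff, Set.mem_singleton_iff]
      constructor
      · intro hv
        by_cases hva : v = a
        · exact .inl hva
        · exact .inr (h.1 (le_antisymm (by omega) (hb v hva)))
      · rintro (rfl | rfl)
        · have := ha b
          omega
        · omega
    have hlow := h.2 (g b + 1)
    rw [hset] at hlow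
    have hrest : ∀ c : V, NoShortcut (G.induce ({c}ᶜ : Set V)) := by
      intro c
      refine ih (g := fun v => g v) ⟨fun u v huv => Subtype.ext (h.1 huv), fun t => ?_⟩ ?_
      · exact (h.2 t).comap_map _
      · have := Set.ncard_add_ncard_compl ({c} : Set V)
        rw [Set.ncard_singleton, hn] at this
        rw [Nat.card_coe_set_eq]
        omega
    -- The first two vertices form a low cut. If both have neighbours outside they have the same
    -- ones there and are twins; otherwise one of them is pendant or isolated.
    by_cases h1 : ∃ x, x ∉ ({a, b} : Set V) ∧ G.Adj a x
    · by_cases h2 : ∃ x, x ∉ ({a, b} : Set V) ∧ G.Adj b x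
      · obtain ⟨x, hx, hax⟩ := h1
        obtain ⟨y, hy, hby⟩ := h2
        refine NoShortcut.of_twin hab (fun z hza hzb => ?_) (hrest a)
        have hz : z ∉ ({a, b} : Set V) := fun e => e.elim hza hzb
        exact ⟨fun e => hlow (.inr rfl) (.inl rfl) hy hz hby e,
          fun e => hlow (.inl rfl) (.inr rfl) hx hz hax e⟩
      · refine NoShortcut.of_pendant hab.symm (fun x hx => ?_) (hrest b)
        by_contra hxa
        exact h2 ⟨x, fun e => e.elim hxa hx.ne', hx⟩
    · refine NoShortcut.of_pendant hab (fun x hx => ?_) (hrest a)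
      by_contra hxb
      exact h1 ⟨x, fun e => e.elim hx.ne' hxb, hx⟩

end LayoutsAndDistances

/-! ### Paths as integer layouts. -/

section PathLayouts

variable {W : Type*} {T : SimpleGraph W}

/-- The map `f` numbers the vertices of `T` by consecutive integers such that adjacency means that
the numbers differ by one. -/
structure IsPathLayout (T : SimpleGraph W) (f : W → ℤ) : Prop where
  injective : Function.Injective f
  consecutive : ∀ x y t, f x ≤ t → t ≤ f y → ∃ z, f z = t
  adj_iff : ∀ x y, T.Adj x y ↔ f x + 1 = f y ∨ f y + 1 = f x

theorem IsPathLayout.neg {f : W → ℤ} (h : IsPathLayout T f) : IsPathLayout T (-f) := by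
  refine ⟨neg_injective.comp h.injective, fun x y t hx hy => ?_, fun x y => ?_⟩
  · simp only [Pi.neg_apply] at hx hy
    obtain ⟨z, hz⟩ := h.consecutive y x (-t) (by omega) (by omega)
    exact ⟨z, by simp [hz]⟩
  · rw [h.adj_iff]
    simp only [Pi.neg_apply]
    omega

theorem isPathShaped_iff [Finite W] [Nonempty W] :
    IsPathShaped T ↔ ∃ f, IsPathLayout T f := by
  constructor
  · rintro ⟨n, hn, ⟨e⟩⟩
    refine ⟨fun x => (e x : ℕ), fun x y hxy => ?_, fun x y t hx hy => ?_, fun x y => ?_⟩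
    · exact e.injective (Fin.ext (by simpa using hxy))
    · have := (e y).2
      refine ⟨e.symm ⟨t.toNat, by omega⟩, ?_⟩
      simp only [RelIso.apply_symm_apply]
      omega
    · rw [← e.map_adj_iff, SimpleGraph.pathGraph_adj]
      omega
  · rintro ⟨f, hf⟩
    obtain ⟨a, ha⟩ := Finite.exists_min f
    obtain ⟨b, hb⟩ := Finite.exists_max f
    let e : W → Fin ((f b - f a).toNat + 1) := fun x => ⟨(f x - f a).toNat, by
      have := hb x
      omega⟩
    have hval : ∀ x, ((e x : ℕ) : ℤ) = f x - f a := fun x => by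
      have := ha x
      simp only [e]
      omega
    have hbij : Function.Bijective e := by
      constructor
      · intro x y hxy
        have h1 := hval x
        rw [hxy, hval y] at h1
        exact hf.injective (by omega)
      · intro i
        have hi := i.2
        obtain ⟨z, hz⟩ := hf.consecutive a b (f a + i) (by omega) (by have := ha b; omega)
        refine ⟨z, Fin.ext ?_⟩
        have := hval z
        omega
    refine ⟨_, by omega, ⟨⟨Equiv.ofBijective e hbij, ?_⟩⟩⟩
    intro x y
    rw [Equiv.ofBijective_apply, Equiv.ofBijective_apply, SimpleGraph.pathGraph_adj, hf.adj_iff]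
    have := hval x
    have := hval y
    omega

end PathLayouts

/-! ### Paths composed of two paths and a connecting edge. -/

section SumPathLayouts

variable {W₁ W₂ : Type*} {T₁ : SimpleGraph W₁} {T₂ : SimpleGraph W₂} {T : SimpleGraph (W₁ ⊕ W₂)}
  {b₁ : W₁} {b₂ : W₂}

/-- `T` is the disjoint union of `T₁` and `T₂` with the additional edge between `b₁` and `b₂`. -/
structure IsEdgeSum (T : SimpleGraph (W₁ ⊕ W₂)) (T₁ : SimpleGraph W₁) (T₂ : SimpleGraph W₂)
    (b₁ : W₁) (b₂ : W₂) : Prop where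
  inl_inl : ∀ x y, T.Adj (.inl x) (.inl y) ↔ T₁.Adj x y
  inr_inr : ∀ x y, T.Adj (.inr x) (.inr y) ↔ T₂.Adj x y
  inl_inr : ∀ x y, T.Adj (.inl x) (.inr y) ↔ x = b₁ ∧ y = b₂

/-- The shifts put the last vertex `b₁` of the first path at `0` and the first vertex `b₂` of the
second at `1`. -/
theorem IsEdgeSum.isPathLayout (hT : IsEdgeSum T T₁ T₂ b₁ b₂) {f₁ : W₁ → ℤ} {f₂ : W₂ → ℤ}
    (h₁ : IsPathLayout T₁ f₁) (h₂ : IsPathLayout T₂ f₂) (hb₁ : ∀ x, f₁ x ≤ f₁ b₁)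
    (hb₂ : ∀ y, f₂ b₂ ≤ f₂ y) :
    IsPathLayout T (Sum.elim (fun x => f₁ x - f₁ b₁) (fun y => f₂ y - f₂ b₂ + 1)) := by
  refine ⟨?_, ?_, ?_⟩
  · rintro (x | x) (y | y) hxy
    · have : f₁ x - f₁ b₁ = f₁ y - f₁ b₁ := hxy
      rw [h₁.injective (show f₁ x = f₁ y by omega)]
    · have h : f₁ x - f₁ b₁ = f₂ y - f₂ b₂ + 1 := hxy
      have := hb₁ x
      have := hb₂ y
      omega
    · have h : f₂ x - f₂ b₂ + 1 = f₁ y - f₁ b₁ := hxy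
      have := hb₁ y
      have := hb₂ x
      omega
    · have : f₂ x - f₂ b₂ + 1 = f₂ y - f₂ b₂ + 1 := hxy
      rw [h₂.injective (show f₂ x = f₂ y by omega)]
  · have low : ∀ x t, f₁ x - f₁ b₁ ≤ t → t ≤ 0 → ∃ z, f₁ z - f₁ b₁ = t := by
      intro x t h h'
      obtain ⟨z, hz⟩ := h₁.consecutive x b₁ (t + f₁ b₁) (by omega) (by omega)
      exact ⟨z, by omega⟩
    have high : ∀ y t, t ≤ f₂ y - f₂ b₂ + 1 → 1 ≤ t → ∃ z, f₂ z - f₂ b₂ + 1 = t := by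
      intro y t h h'
      obtain ⟨z, hz⟩ := h₂.consecutive b₂ y (t + f₂ b₂ - 1) (by omega) (by omega)
      exact ⟨z, by omega⟩
    rintro x y t hx hy
    by_cases ht : t ≤ 0
    · rcases x with x | x
      · obtain ⟨z, hz⟩ := low x t hx ht
        exact ⟨.inl z, hz⟩
      · have h : f₂ x - f₂ b₂ + 1 ≤ t := hx
        have := hb₂ x
        omega
    · rcases y with y | y
      · have h : t ≤ f₁ y - f₁ b₁ := hy
        have := hb₁ y
        omega
      · obtain ⟨z, hz⟩ := high y t hy (by omega)
        exact ⟨.inr z, hz⟩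
  · have cross : ∀ x y, T.Adj (.inl x) (.inr y) ↔ f₁ x - f₁ b₁ + 1 = f₂ y - f₂ b₂ + 1 ∨
        f₂ y - f₂ b₂ + 1 + 1 = f₁ x - f₁ b₁ := by
      intro x y
      rw [hT.inl_inr]
      have hx := hb₁ x
      have hy := hb₂ y
      constructor
      · rintro ⟨rfl, rfl⟩
        omega
      · intro h
        exact ⟨h₁.injective (by omega), h₂.injective (by omega)⟩
    rintro (x | x) (y | y)
    · rw [hT.inl_inl, h₁.adj_iff]
      simp only [Sum.elim_inl]
      omega
    · exact cross x y
    · rw [T.adj_comm, cross]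
      exact or_comm
    · rw [hT.inr_inr, h₂.adj_iff]
      simp only [Sum.elim_inr]
      omega

/-- Going right from `b₂` in unit steps, a return to the first part would have to use the edge `b₁
b₂`, but `b₁` lies to the left of `b₂`. The other side is symmetric. -/
theorem IsPathLayout.le_of_isEdgeSum (hT : IsEdgeSum T T₁ T₂ b₁ b₂) {f : W₁ ⊕ W₂ → ℤ}
    (hf : IsPathLayout T f) (hb : f (.inl b₁) + 1 = f (.inr b₂)) :
    (∀ x, f (.inl x) ≤ f (.inl b₁)) ∧ ∀ y, f (.inr b₂) ≤ f (.inr y) := by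
  have right : ∀ (k : ℕ) z, f z = f (.inr b₂) + k → ∃ y, z = .inr y := by
    intro k
    induction k with
    | zero => exact fun z hz => ⟨b₂, hf.injective (by simpa using hz)⟩
    | succ k ih =>
      intro z hz
      push_cast at hz
      obtain ⟨z', hz'⟩ := hf.consecutive (.inr b₂) z (f (.inr b₂) + k) (by omega) (by omega)
      obtain ⟨y, rfl⟩ := ih z' hz'
      rcases z with x | y'
      · have hadj : T.Adj (.inl x) (.inr y) := (hf.adj_iff _ _).2 (.inr (by omega))
        obtain ⟨rfl, rfl⟩ := (hT.inl_inr _ _).1 hadj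
        omega
      · exact ⟨y', rfl⟩
  have left : ∀ (k : ℕ) z, f z = f (.inl b₁) - k → ∃ x, z = .inl x := by
    intro k
    induction k with
    | zero => exact fun z hz => ⟨b₁, hf.injective (by simpa using hz)⟩
    | succ k ih =>
      intro z hz
      push_cast at hz
      obtain ⟨z', hz'⟩ := hf.consecutive z (.inl b₁) (f (.inl b₁) - k) (by omega) (by omega)
      obtain ⟨x, rfl⟩ := ih z' hz'
      rcases z with x' | y
      · exact ⟨x', rfl⟩
      · have hadj : T.Adj (.inl x) (.inr y) := (hf.adj_iff _ _).2 (.inr (by omega))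
        obtain ⟨rfl, rfl⟩ := (hT.inl_inr _ _).1 hadj
        omega
  constructor
  · intro x
    by_contra! hlt
    obtain ⟨y, hy⟩ := right (f (.inl x) - f (.inr b₂)).toNat (.inl x) (by omega)
    cases hy
  · intro y
    by_contra! hlt
    obtain ⟨x, hx⟩ := left (f (.inl b₁) - f (.inr y)).toNat (.inr y) (by omega)
    cases hx

theorem IsPathLayout.of_isEdgeSum (hT : IsEdgeSum T T₁ T₂ b₁ b₂) {f : W₁ ⊕ W₂ → ℤ}
    (hf : IsPathLayout T f) (hb : f (.inl b₁) + 1 = f (.inr b₂)) :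
    IsPathLayout T₁ (f ∘ Sum.inl) ∧ IsPathLayout T₂ (f ∘ Sum.inr) := by
  obtain ⟨h1, h2⟩ := hf.le_of_isEdgeSum hT hb
  refine ⟨⟨hf.injective.comp Sum.inl_injective, fun x y t hx hy => ?_, fun x y => ?_⟩,
    ⟨hf.injective.comp Sum.inr_injective, fun x y t hx hy => ?_, fun x y => ?_⟩⟩
  · obtain ⟨z | z, hz⟩ := hf.consecutive _ _ t hx hy
    · exact ⟨z, hz⟩
    · have := h1 y
      have := h2 z
      simp only [Function.comp] at hx hy
      omega
  · rw [← hT.inl_inl, hf.adj_iff]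
    rfl
  · obtain ⟨z | z, hz⟩ := hf.consecutive _ _ t hx hy
    · have := h1 z
      have := h2 x
      simp only [Function.comp] at hx hy
      omega
    · exact ⟨z, hz⟩
  · rw [← hT.inr_inr, hf.adj_iff]
    rfl

end SumPathLayouts

/-! ### The tree of a decomposition along one split. -/

namespace Decomposition

variable {V : Type u} {G : SimpleGraph V}

theorem finite_block {V : Type u} {G : SimpleGraph V} (D : Decomposition G) : Finite D.Block := by
  induction D with
  | single G => exact inferInstanceAs (Finite Unit)
  | split X hX D₁ D₂ ih₁ ih₂ => exact inferInstanceAs (Finite (D₁.Block ⊕ D₂.Block))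

/-- The block of a vertex of the decomposed graph. -/
noncomputable def home (D : Decomposition G) (v : V) : D.Block :=
  D.blockOf (D.incl v)

section Split

variable {X : Set V} {hX : IsSplit G X} {D₁ : Decomposition (markerGraph G X)}
  {D₂ : Decomposition (markerGraph G Xᶜ)}

theorem home_split_mem {v : V} (h : v ∈ X) :
    (split X hX D₁ D₂).home v = (Sum.inl (D₁.home (some ⟨v, h⟩)) : D₁.Block ⊕ D₂.Block) := by
  rw [home, incl_split_mem h]
  rfl

theorem home_split_notMem {v : V} (h : v ∉ X) :
    (split X hX D₁ D₂).home v = (Sum.inr (D₂.home (some ⟨v, h⟩)) : D₁.Block ⊕ D₂.Block) := by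
  rw [home, incl_split_notMem h]
  rfl

theorem isEdgeSum_tree : IsEdgeSum (W₁ := D₁.Block) (W₂ := D₂.Block) (split X hX D₁ D₂).tree
    D₁.tree D₂.tree (D₁.home none) (D₂.home none) := by
  refine ⟨fun x y => ?_, fun x y => ?_, fun x y => ?_⟩
  · constructor
    · rintro ⟨hne, h | h, k | k, hk, hx, hy⟩
      · exact ⟨fun e => hne (congrArg Sum.inl e), h, k, marked_inl_inl.1 hk,
          Sum.inl_injective (β := D₂.Block) hx, Sum.inl_injective (β := D₂.Block) hy⟩
      · exact (Sum.inr_ne_inl hy).elim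
      · exact (Sum.inr_ne_inl hx).elim
      · exact (Sum.inr_ne_inl hy).elim
    · rintro ⟨hne, h, k, hk, rfl, rfl⟩
      exact ⟨fun e => hne (Sum.inl_injective (β := D₂.Block) e), Sum.inl h, Sum.inl k,
        marked_inl_inl.2 hk, rfl, rfl⟩
  · constructor
    · rintro ⟨hne, h | h, k | k, hk, hx, hy⟩
      · exact (Sum.inl_ne_inr hy).elim
      · exact (Sum.inl_ne_inr hx).elim
      · exact (Sum.inl_ne_inr hy).elim
      · exact ⟨fun e => hne (congrArg Sum.inr e), h, k, marked_inr_inr.1 hk,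
          Sum.inr_injective (α := D₁.Block) hx, Sum.inr_injective (α := D₁.Block) hy⟩
    · rintro ⟨hne, h, k, hk, rfl, rfl⟩
      exact ⟨fun e => hne (Sum.inr_injective (α := D₁.Block) e), Sum.inr h, Sum.inr k,
        marked_inr_inr.2 hk, rfl, rfl⟩
  · constructor
    · rintro ⟨hne, h | h, k | k, hk, hx, hy⟩
      · exact (Sum.inl_ne_inr hy).elim
      · obtain ⟨rfl, rfl⟩ := marked_inl_inr.1 hk
        exact ⟨(Sum.inl_injective (β := D₂.Block) hx).symm,
          (Sum.inr_injective (α := D₁.Block) hy).symm⟩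
      · exact (Sum.inr_ne_inl hx).elim
      · exact (Sum.inr_ne_inl hx).elim
    · rintro ⟨rfl, rfl⟩
      exact ⟨Sum.inl_ne_inr, Sum.inl _, Sum.inr _, marked_inl_inr.2 ⟨rfl, rfl⟩, rfl, rfl⟩

end Split

theorem isPathLayout_single (f : Unit → ℤ) : IsPathLayout (single G).tree f := by
  refine ⟨fun _ _ _ => rfl, fun x y t hx hy => ⟨(), le_antisymm hx hy⟩, fun x y => ⟨fun h => ?_, ?_⟩⟩
  · exact (h.1 rfl).elim
  · intro h
    have hxy : f x = f y := rfl
    have h' : f x + 1 = f y ∨ f y + 1 = f x := h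
    omega

end Decomposition

/-! ### From low layouts to path-shaped trees. -/

namespace Decomposition

variable {V : Type u} {G : SimpleGraph V}

/-- The tree of `D` has a path layout whose end blocks contain the ends of the layout `g`. -/
def HasTreeLayout (D : Decomposition G) (g : V → ℤ) : Prop :=
  ∃ f, IsPathLayout D.tree f ∧ (∀ v, (∀ u, g v ≤ g u) → ∀ b, f (D.home v) ≤ f b) ∧
    ∀ v, (∀ u, g u ≤ g v) → ∀ b, f b ≤ f (D.home v)

theorem HasTreeLayout.neg {D : Decomposition G} {g : V → ℤ} (h : D.HasTreeLayout g) :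
    D.HasTreeLayout (-g) := by
  obtain ⟨f, hf, h1, h2⟩ := h
  refine ⟨-f, hf.neg, fun v hv b => ?_, fun v hv b => ?_⟩
  · have := h2 v (fun u => by simpa using hv u) b
    simpa using this
  · have := h1 v (fun u => by simpa using hv u) b
    simpa using this

/-- The marker takes the place of `z`, the first vertex outside `Z`. Initial segments then pull back
to initial segments of `g` or to everything. -/
theorem _root_.IsLowLayout.markerGraph {g : V → ℤ} (h : IsLowLayout G g) {Z : Set V}
    (hZ : LowCut G Z) {z : V} (hg : ∀ x ∈ Z, g x < g z)
    (hz' : ∀ y, y ∉ Z → g z ≤ g y) :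
    IsLowLayout (markerGraph G Z) (fun a => a.elim (g z) (fun x => g x)) := by
  constructor
  · rintro (_ | x) (_ | y) hxy
    · rfl
    · have : g z = g y := hxy
      have := hg y y.2
      omega
    · have : g x = g z := hxy
      have := hg x x.2
      omega
    · exact congrArg some (Subtype.ext (h.1 hxy))
  · intro t
    rw [lowCut_markerGraph_iff hZ]
    by_cases ht : t ≤ g z
    · convert h.2 t using 1
      ext v
      by_cases hv : v ∈ Z
      · simp [markerProj_mem hv]
      · have := hz' v hv
        simp only [Set.mem_preimage, markerProj_notMem hv, Set.mem_ofPred_eq, Option.elim_none]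
        omega
    · convert lowCut_univ
      ext v
      by_cases hv : v ∈ Z
      · have := hg v hv
        simp only [Set.mem_preimage, markerProj_mem hv, Set.mem_ofPred_eq, Option.elim_some,
          Set.mem_univ, iff_true]
        omega
      · simp only [Set.mem_preimage, markerProj_notMem hv, Set.mem_ofPred_eq, Option.elim_none,
          Set.mem_univ, iff_true]
        omega

/-- The marker comes last in the first layout and first in the second. Since ends of layouts lie in
end blocks, the new tree edge joins the ends of two paths. -/
theorem hasTreeLayout_split [Finite V] {X : Set V} {hX : IsSplit G X}
    {D₁ : Decomposition (markerGraph G X)} {D₂ : Decomposition (markerGraph G Xᶜ)}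
    (hX₁ : X.Nonempty) (hX₂ : Xᶜ.Nonempty) (hlow : LowCut G X)
    (h₁ : ∀ g, IsLowLayout (markerGraph G X) g → D₁.HasTreeLayout g)
    (h₂ : ∀ g, IsLowLayout (markerGraph G Xᶜ) g → D₂.HasTreeLayout g)
    {g : V → ℤ} (hg : IsLowLayout G g) (hord : ∀ x ∈ X, ∀ y ∉ X, g x < g y) :
    (split X hX D₁ D₂).HasTreeLayout g := by
  obtain ⟨y, hy, hymin⟩ := Set.exists_min_image Xᶜ g (Set.toFinite _) hX₂
  obtain ⟨x, hx, hxmax⟩ := Set.exists_max_image X g (Set.toFinite _) hX₁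
  have g₁ := hg.markerGraph hlow (z := y) (fun z hz => hord z hz y hy) hymin
  -- Read backwards, so that the second marker takes the place of the last vertex `x` of `X`.
  have g₂ := (hg.neg.markerGraph hlow.compl (z := x)
    (fun z hz => neg_lt_neg (hord x hx z hz))
    (fun z hz => neg_le_neg (hxmax z (not_not.1 hz)))).neg
  obtain ⟨f₁, hf₁, a1, a2⟩ := h₁ _ g₁
  obtain ⟨f₂, hf₂, b1, b2⟩ := h₂ _ g₂
  have c1 := a2 none (by
    rintro (_ | z)
    · exact le_rfl
    · exact (hord z z.2 y hy).le)
  have c2 := b1 none (by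
    rintro (_ | z)
    · exact le_rfl
    · simpa using (hord x hx z z.2).le)
  refine ⟨_, isEdgeSum_tree.isPathLayout hf₁ hf₂ c1 c2, fun v hv => ?_, fun v hv => ?_⟩
  · have hvX : v ∈ X := by
      by_contra hvX
      exact absurd (hord x hx v hvX) (not_lt.2 (hv x))
    have d1 := a1 (some ⟨v, hvX⟩) (by
      rintro (_ | z)
      · exact hv y
      · exact hv z)
    rw [home_split_mem hvX]
    rintro (b | b)
    · simpa using d1 b
    · have e1 := c1 (D₁.home (some ⟨v, hvX⟩))
      have e2 := c2 b
      simp only [Sum.elim_inl, Sum.elim_inr]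
      omega
  · have hvX : v ∉ X := by
      intro hvX
      exact absurd (hord v hvX y hy) (not_lt.2 (hv y))
    have d1 := b2 (some ⟨v, hvX⟩) (by
      rintro (_ | z)
      · simpa using hv x
      · simpa using hv z)
    rw [home_split_notMem hvX]
    rintro (b | b)
    · have e1 := c1 b
      have e2 := c2 (D₂.home (some ⟨v, hvX⟩))
      simp only [Sum.elim_inl, Sum.elim_inr]
      omega
    · simpa using d1 b

/-- In a low layout, the two sides of a split which is not crossed are not interleaved. -/
theorem _root_.IsLowLayout.lt_of_not_crosses [Finite V] {g : V → ℤ} (hg : IsLowLayout G g)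
    {X : Set V} (hX : Xᶜ.Nontrivial) (hcross : ∀ P, LowCut G P → ¬ Crosses X P) {v : V}
    (hv : v ∈ X) (hmin : ∀ u, g v ≤ g u) : ∀ x ∈ X, ∀ y ∉ X, g x < g y := by
  intro x hx y hy
  by_contra! hlt
  obtain ⟨y₀, hy₀, hmin₀⟩ := Set.exists_min_image Xᶜ g (Set.toFinite _) hX.nonempty
  obtain ⟨z, hz, hzy⟩ := hX.exists_ne y₀
  have hne : ∀ {a b}, a ∈ X → b ∉ X → g a ≠ g b := fun ha hb e => hb (hg.1 e ▸ ha)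
  have h1 := hne hv hy₀
  have h2 := hne hx hy
  have h3 := hmin y₀
  have h4 := hmin₀ y hy
  have h5 := hmin₀ z hz
  have h6 : g y₀ ≠ g z := fun e => hzy (hg.1 e).symm
  -- The initial segment ending with `y₀` contains `v` and `y₀` but neither `x` nor `z`, so it
  -- crosses `X`.
  refine hcross _ (hg.2 (g y₀ + 1)) ⟨⟨v, hv, ?_⟩, ⟨x, hx, ?_⟩, ⟨y₀, ?_, hy₀⟩, ⟨z, ?_⟩⟩
  · rw [Set.mem_ofPred_eq]; omega
  · rw [Set.mem_ofPred_eq]; omega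
  · rw [Set.mem_ofPred_eq]; omega
  · rw [Set.mem_compl_iff, Set.mem_union, Set.mem_ofPred_eq]
    rintro (h | h)
    · exact hz h
    · omega

theorem IsCanonical.hasTreeLayout {V : Type u} {G : SimpleGraph V} {D : Decomposition G}
    (hD : D.IsCanonical) : Finite V → EdgeConn G → ∀ g, IsLowLayout G g → D.HasTreeLayout g := by
  induction D with
  | single G =>
    intro _ _ g _
    exact ⟨fun _ => 0, isPathLayout_single _, fun _ _ _ => le_rfl, fun _ _ _ => le_rfl⟩
  | split X hX D₁ D₂ ih₁ ih₂ =>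
    intro hV hG
    obtain ⟨hD₁, hD₂, -⟩ := isCanonical_split_iff.1 hD
    obtain ⟨hX₁, hX₂, hlow⟩ := (isSplit_iff hG).1 hX
    have hXc : Xᶜᶜ.Nonempty := (compl_compl X).symm ▸ hX₁.nonempty
    have k₁ := ih₁ hD₁ inferInstance (hG.markerGraph hX₂.nonempty)
    have k₂ := ih₂ hD₂ inferInstance (hG.markerGraph hXc)
    have hcross : ∀ P, LowCut _ P → ¬ Crosses X P := fun P => hD.not_crosses hG
    have forward : ∀ g, IsLowLayout _ g → (∀ x ∈ X, ∀ y ∉ X, g x < g y) →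
        (split X hX D₁ D₂).HasTreeLayout g := fun g hg =>
      hasTreeLayout_split hX₁.nonempty hX₂.nonempty hlow k₁ k₂ hg
    intro g hg
    obtain ⟨x₀, -⟩ := hX₁.nonempty
    have : Nonempty _ := ⟨x₀⟩
    obtain ⟨v, hv⟩ := Finite.exists_min g
    -- If the first vertex lies outside `X`, the set `X` comes last, and reversing the layout puts
    -- it first.
    by_cases hvX : v ∈ X
    · exact forward g hg (hg.lt_of_not_crosses hX₂ hcross hvX hv)
    · have hord := hg.lt_of_not_crosses (X := Xᶜ) ((compl_compl X).symm ▸ hX₁)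
        (fun P hP hc => hcross P hP (compl_compl X ▸ hc.compl_left)) hvX hv
      have := (forward (-g) hg.neg fun x hx y hy => neg_lt_neg (hord y hy x (not_not.2 hx))).neg
      rwa [neg_neg] at this

/-! ### From path-shaped trees to low layouts. -/

/-- A low layout with prescribed first and last vertices exists if these lie in the end blocks of
the tree. -/
def HasLowLayouts (D : Decomposition G) (f : D.Block → ℤ) : Prop :=
  ∀ S T : Set V, S.Subsingleton → T.Subsingleton → Disjoint S T →
    (∀ v ∈ S, ∀ b, f (D.home v) ≤ f b) → (∀ v ∈ T, ∀ b, f b ≤ f (D.home v)) →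
    ∃ g, IsLowLayout G g ∧ (∀ v ∈ S, ∀ u, g v ≤ g u) ∧ ∀ v ∈ T, ∀ u, g u ≤ g v

theorem HasLowLayouts.of_neg {D : Decomposition G} {f : D.Block → ℤ}
    (h : D.HasLowLayouts (-f)) : D.HasLowLayouts f := by
  intro S T hS hT hST h1 h2
  obtain ⟨g, hg, h3, h4⟩ := h T S hT hS hST.symm (fun v hv b => by simpa using h2 v hv b)
    (fun v hv b => by simpa using h1 v hv b)
  exact ⟨-g, hg.neg, fun v hv u => by simpa using h4 v hv u, fun v hv u => by simpa using h3 v hv u⟩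

/-- Any order is low. The other vertices receive values from `0` to the cardinality minus one, so
`-1` and the cardinality are safe values for the prescribed ends. -/
theorem hasLowLayouts_single [Finite V] (h : ∀ X : Set V, LowCut G X) (f : Unit → ℤ) :
    (single G).HasLowLayouts f := by
  classical
  intro S T hS hT hST _ _
  have hdis := Set.disjoint_left.1 hST
  let e := Finite.equivFin V
  have he : ∀ v, ((e v : ℕ) : ℤ) < Nat.card V := fun v => by exact_mod_cast (e v).2
  refine ⟨fun v => if v ∈ S then -1 else if v ∈ T then Nat.card V else (e v : ℕ),
    ⟨fun u v huv => ?_, fun t => h _⟩, fun v hv u => ?_, fun v hv u => ?_⟩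
  · have hu := he u
    have hv := he v
    simp only at huv
    split_ifs at huv with h1 h2 h3 h4 h5 h6 h7 h8
    all_goals first
      | exact hS ‹_› ‹_›
      | exact hT ‹_› ‹_›
      | omega
      | skip
    exact e.injective (Fin.ext (by exact_mod_cast huv))
  · have := he u
    simp only [if_pos hv]
    split_ifs <;> omega
  · have := he u
    have hvS : v ∉ S := fun h => hdis h hv
    simp only [if_pos hv, if_neg hvS]
    split_ifs <;> omega

/-- Both markers are shifted to `0` and dropped. Thresholds up to `0` give cuts of the first marker
graph, larger ones cuts of the second. -/
theorem _root_.IsLowLayout.glue {X : Set V} (hX : LowCut G X) {g₁ : Option X → ℤ}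
    {g₂ : Option (Xᶜ : Set V) → ℤ} (h₁ : IsLowLayout (markerGraph G X) g₁)
    (h₂ : IsLowLayout (markerGraph G Xᶜ) g₂) (hm₁ : ∀ a, g₁ a ≤ g₁ none)
    (hm₂ : ∀ a, g₂ none ≤ g₂ a) : ∃ g, IsLowLayout G g ∧
      (∀ v (hv : v ∈ X), g v = g₁ (some ⟨v, hv⟩) - g₁ none ∧ g v < 0) ∧
      ∀ v (hv : v ∉ X), g v = g₂ (some ⟨v, hv⟩) - g₂ none ∧ 0 < g v := by
  classical
  let g : V → ℤ := fun v => if hv : v ∈ X then g₁ (some ⟨v, hv⟩) - g₁ none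
    else g₂ (some ⟨v, hv⟩) - g₂ none
  have e₁ : ∀ v (hv : v ∈ X), g v = g₁ (some ⟨v, hv⟩) - g₁ none ∧ g v < 0 := by
    intro v hv
    have h : g v = g₁ (some ⟨v, hv⟩) - g₁ none := dif_pos hv
    have hle := hm₁ (some ⟨v, hv⟩)
    have hne : g₁ (some ⟨v, hv⟩) ≠ g₁ none := fun e => by cases h₁.1 e
    exact ⟨h, by omega⟩
  have e₂ : ∀ v (hv : v ∉ X), g v = g₂ (some ⟨v, hv⟩) - g₂ none ∧ 0 < g v := by
    intro v hv
    have h : g v = g₂ (some ⟨v, hv⟩) - g₂ none := dif_neg hv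
    have hle := hm₂ (some ⟨v, hv⟩)
    have hne : g₂ (some ⟨v, hv⟩) ≠ g₂ none := fun e => by cases h₂.1 e
    exact ⟨h, by omega⟩
  refine ⟨g, ⟨fun u v huv => ?_, fun t => ?_⟩, e₁, e₂⟩
  · by_cases hu : u ∈ X <;> by_cases hv : v ∈ X
    · have a := e₁ u hu
      have b := e₁ v hv
      have := h₁.1 (show g₁ (some ⟨u, hu⟩) = g₁ (some ⟨v, hv⟩) by omega)
      simpa using this
    · have a := e₁ u hu
      have b := e₂ v hv
      omega
    · have a := e₂ u hu
      have b := e₁ v hv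
      omega
    · have a := e₂ u hu
      have b := e₂ v hv
      have := h₂.1 (show g₂ (some ⟨u, hu⟩) = g₂ (some ⟨v, hv⟩) by omega)
      simpa using this
  · by_cases ht : t ≤ 0
    · have h := (lowCut_markerGraph_iff hX).1 (h₁.2 (t + g₁ none))
      convert h using 1
      ext v
      by_cases hv : v ∈ X
      · have a := e₁ v hv
        simp only [Set.mem_preimage, markerProj_mem hv, Set.mem_ofPred_eq]
        omega
      · have a := e₂ v hv
        simp only [Set.mem_preimage, markerProj_notMem hv, Set.mem_ofPred_eq]
        omega
    · have h := (lowCut_markerGraph_iff hX.compl).1 (h₂.2 (t + g₂ none))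
      convert h using 1
      ext v
      by_cases hv : v ∈ X
      · have a := e₁ v hv
        have hv' : v ∉ Xᶜ := not_not.2 hv
        simp only [Set.mem_preimage, markerProj_notMem hv', Set.mem_ofPred_eq]
        omega
      · have a := e₂ v hv
        have hv' : v ∈ Xᶜ := hv
        simp only [Set.mem_preimage, markerProj_mem hv', Set.mem_ofPred_eq]
        omega

/-- The recursion prescribes the marker as the last vertex on the first side and as the first vertex
on the second. The subsingletons `S` and `T` stand for optional prescribed ends of the whole layout,
which the position of their blocks places on the correct sides. -/
theorem hasLowLayouts_split {X : Set V} {hX : IsSplit G X}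
    {D₁ : Decomposition (markerGraph G X)} {D₂ : Decomposition (markerGraph G Xᶜ)}
    (hlow : LowCut G X) (h₁ : ∀ f, IsPathLayout D₁.tree f → D₁.HasLowLayouts f)
    (h₂ : ∀ f, IsPathLayout D₂.tree f → D₂.HasLowLayouts f) {f : D₁.Block ⊕ D₂.Block → ℤ}
    (hf : IsPathLayout (W := D₁.Block ⊕ D₂.Block) (split X hX D₁ D₂).tree f)
    (hb : f (Sum.inl (D₁.home none)) + 1 = f (Sum.inr (D₂.home none))) :
    (split X hX D₁ D₂).HasLowLayouts f := by
  intro S T hS hT hST hSf hTf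
  obtain ⟨le₁, le₂⟩ := hf.le_of_isEdgeSum isEdgeSum_tree hb
  obtain ⟨hf₁, hf₂⟩ := hf.of_isEdgeSum isEdgeSum_tree hb
  have hSX : ∀ v ∈ S, v ∈ X := by
    intro v hv
    by_contra hvX
    have e1 := hSf v hv (Sum.inl (D₁.home none) : D₁.Block ⊕ D₂.Block)
    rw [home_split_notMem hvX] at e1
    have e2 := le₂ (D₂.home (some ⟨v, hvX⟩))
    omega
  have hTX : ∀ v ∈ T, v ∉ X := by
    intro v hv hvX
    have e1 := hTf v hv (Sum.inr (D₂.home none) : D₁.Block ⊕ D₂.Block)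
    rw [home_split_mem hvX] at e1
    have e2 := le₁ (D₁.home (some ⟨v, hvX⟩))
    omega
  obtain ⟨g₁, hg₁, s₁, t₁⟩ := h₁ _ hf₁ {a | ∃ x : X, (x : V) ∈ S ∧ a = some x} {none}
    (by
      rintro _ ⟨x, hx, rfl⟩ _ ⟨y, hy, rfl⟩
      exact congrArg some (Subtype.ext (hS hx hy)))
    Set.subsingleton_singleton
    (by
      rw [Set.disjoint_singleton_right]
      rintro ⟨x, -, h⟩
      cases h)
    (by
      rintro _ ⟨x, hx, rfl⟩ b
      have := hSf x hx (Sum.inl b : D₁.Block ⊕ D₂.Block)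
      rwa [home_split_mem x.2] at this)
    (by
      rintro _ rfl b
      exact le₁ b)
  obtain ⟨g₂, hg₂, s₂, t₂⟩ := h₂ _ hf₂ {none} {a | ∃ x : (Xᶜ : Set V), (x : V) ∈ T ∧ a = some x}
    Set.subsingleton_singleton
    (by
      rintro _ ⟨x, hx, rfl⟩ _ ⟨y, hy, rfl⟩
      exact congrArg some (Subtype.ext (hT hx hy)))
    (by
      rw [Set.disjoint_singleton_left]
      rintro ⟨x, -, h⟩
      cases h)
    (by
      rintro _ rfl b
      exact le₂ b)
    (by
      rintro _ ⟨x, hx, rfl⟩ b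
      have := hTf x hx (Sum.inr b : D₁.Block ⊕ D₂.Block)
      rwa [home_split_notMem x.2] at this)
  obtain ⟨g, hg, e₁, e₂⟩ := hg₁.glue hlow hg₂ (t₁ none rfl) (s₂ none rfl)
  refine ⟨g, hg, fun v hv u => ?_, fun v hv u => ?_⟩
  · have a := e₁ v (hSX v hv)
    by_cases hu : u ∈ X
    · have b := e₁ u hu
      have c := s₁ (some ⟨v, hSX v hv⟩) ⟨_, hv, rfl⟩ (some ⟨u, hu⟩)
      omega
    · have b := e₂ u hu
      omega
  · have a := e₂ v (hTX v hv)
    by_cases hu : u ∈ X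
    · have b := e₁ u hu
      omega
    · have b := e₂ u hu
      have c := t₂ (some ⟨v, hTX v hv⟩) ⟨_, hv, rfl⟩ (some ⟨u, hu⟩)
      omega

/-- A prime distance-hereditary graph that is connected has at most three vertices, so each of its
cuts has a side with at most one element. -/
theorem _root_.IsBlockShape.lowCut_of_noShortcut [Finite V] (hG : EdgeConn G)
    (h : IsBlockShape G) (hdh : NoShortcut G) (X : Set V) : LowCut G X := by
  rcases h with h | h | ⟨c, h⟩
  · by_cases hcard : 4 ≤ Nat.card V
    · have : Nonempty V := (Nat.card_pos_iff.1 (by omega)).1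
      obtain ⟨Y, hY⟩ := hdh.exists_lowCut hG.connected hcard
      exact (h Y ((isSplit_iff hG).2 hY)).elim
    · have := Set.ncard_add_ncard_compl X
      by_cases hX : X.ncard ≤ 1
      · exact lowCut_of_subsingleton (Set.ncard_le_one_iff_subsingleton.1 hX)
      · rw [← lowCut_compl_iff]
        exact lowCut_of_subsingleton (Set.ncard_le_one_iff_subsingleton.1 (by omega))
  · exact h.lowCut X
  · exact h.lowCut X

/-- Marker graphs are induced subgraphs, so distance heredity passes to both parts. The tree edge
between the two markers may point either way in the path layout; negation reduces to one direction.
-/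
theorem hasLowLayouts {V : Type u} {G : SimpleGraph V} (D : Decomposition G) :
    Finite V → EdgeConn G → NoShortcut G → (∀ b, IsBlockShape (D.blockGraph b)) →
      ∀ f, IsPathLayout D.tree f → D.HasLowLayouts f := by
  induction D with
  | single G =>
    intro hV hG hdh hshape f _
    exact hasLowLayouts_single
      (IsBlockShape.lowCut_of_noShortcut hG ((hshape ()).of_iso (singleIso G)) hdh) f
  | split X hX D₁ D₂ ih₁ ih₂ =>
    intro hV hG hdh hshape
    obtain ⟨s₁, s₂⟩ := blockShape_split_iff.1 hshape
    obtain ⟨hX₁, hX₂, hlow⟩ := (isSplit_iff hG).1 hX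
    have hXc : Xᶜᶜ.Nonempty := (compl_compl X).symm ▸ hX₁.nonempty
    obtain ⟨x, hx, y, hy, hxy⟩ := hG X hX₁.nonempty hX₂.nonempty
    obtain ⟨i₁⟩ := exists_markerGraph_embedding hlow hx hy hxy
    obtain ⟨i₂⟩ := exists_markerGraph_embedding hlow.compl hy (not_not.2 hx) hxy.symm
    have k₁ := ih₁ inferInstance (hG.markerGraph hX₂.nonempty) (hdh.comap i₁) s₁
    have k₂ := ih₂ inferInstance (hG.markerGraph hXc) (hdh.comap i₂) s₂
    intro f hf
    have hadj := (isEdgeSum_tree (hX := hX) (D₁ := D₁) (D₂ := D₂)).inl_inr _ _ |>.2 ⟨rfl, rfl⟩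
    rcases (hf.adj_iff _ _).1 hadj with h | h
    · exact hasLowLayouts_split hlow k₁ k₂ hf h
    · refine HasLowLayouts.of_neg (hasLowLayouts_split hlow k₁ k₂ hf.neg ?_)
      change -f _ + 1 = -f _
      omega

end Decomposition

/-! ### The theorem. -/

theorem theorem1 {V : Type*} [Finite V] [Nontrivial V] (G : SimpleGraph V) (hG : G.Connected) :
    (∃ D : Decomposition G, D.IsCanonical) ∧
    ∀ D : Decomposition G, D.IsCanonical →
      (linearRankWidth G = 1 ↔ IsDistanceHereditary G ∧ IsPathShaped D.tree) := by
  have hE := hG.edgeConn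
  refine ⟨Decomposition.exists_isCanonical G hE, fun D hD => ?_⟩
  obtain ⟨v⟩ := hG.nonempty
  have := D.finite_block
  have : Nonempty D.Block := ⟨D.home v⟩
  rw [linearRankWidth_eq_one_iff hE, isPathShaped_iff]
  constructor
  · rintro ⟨g, hg⟩
    obtain ⟨f, hf, -⟩ := hD.hasTreeLayout inferInstance hE g hg
    exact ⟨hg.noShortcut.isDistanceHereditary, f, hf⟩
  · rintro ⟨hdh, f, hf⟩
    obtain ⟨g, hg, -⟩ := D.hasLowLayouts inferInstance hE hdh.noShortcut hD.block_shape f hf ∅ ∅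
      Set.subsingleton_empty Set.subsingleton_empty (Set.disjoint_empty _) (by simp) (by simp)
    exact ⟨g, hg⟩
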